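/- All graphs are finite and simple, and $k\ge 1$. For a graph $G$, a \emph{$k$-rainbow function} on $G$ is a function $f:V(G)\to 2^{[k]}$ such that $f(x)=\varnothing$ implies $\bigcup_{y\in N(x)}f(y)=[k]$, for every vertex $x$; its cost is $\|f\|_G=\sum_{x}|f(x)|$, and the \emph{$k$-rainbow domination number} $\gamma_{rk}(G)$ is the minimum cost of a $k$-rainbow function on $G$. A \emph{cograph} is a graph without an induced path on four vertices. \textbf{Theorem.} (1) There is a linear-time algorithm that computes $\gamma_{rk}(G)$, given a cograph $G$ and an integer $k\ge 1$. That is, there are one program for a random access machine and one constant $C$ such that, for every cograph $G$ with $n$ vertices and $m$ edges, given by adjacency lists in any order, and every $k\ge1$, the program halts with output $\gamma_{rk}(G)$ after at most $C(n+m+1)$ unit-cost steps, and writes only numbers that are at most $C(n+m+k+1)$ (words of logarithmic length; the operations are addition, truncated subtraction, comparison and indirect addressing). (2) For a non-empty cograph $H$ let $$R^+(H)=\min\Big\{\|f\|_H : f \text{ a } k\text{-rainbow function on } H \text{ with } f(x)\ne\varnothing \text{ for all } x \text{ and } \bigcup_{x\in V(H)} f(x)=[k]\Big\},$$ $$R^-(H)=\min\big\{\|f\|_H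 : f \text{ a } k\text{-rainbow function on } H \text{ with } f(x)=\varnothing \text{ for some } x\big\},$$ where $R^-(H)=\infty$ if there is no such function. Then $R^+(H)=\max\{|V(H)|,k\}$ and $\gamma_{rk}(H)=\min\{|V(H)|,R^-(H)\}$. Moreover, for all non-empty cographs $H_1,H_2$, if $H$ is the disjoint union of $H_1$ and $H_2$, then $$R^-(H)=\min\{R^-(H_1)+|V(H_2)|,\ R^-(H_2)+|V(H_1)|,\ R^-(H_1)+R^-(H_2)\},$$ and if $H$ is the join of $H_1$ and $H_2$, then $$R^-(H)=\min\{R^+(H_1),\ R^+(H_2),\ R^-(H_1),\ R^-(H_2),\ 2k\}.$$ -/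

import Mathlib

/-! ### Rainbow domination, cographs, union and join -/

namespace RainbowDom

/-- The union `⋃_{y ∈ S} f(y)` of the labels of the vertices in a set `S`. -/
def labels {V : Type*} {k : ℕ} (f : V → Finset (Fin k)) (S : Set V) : Set (Fin k) :=
  ⋃ y ∈ S, (f y : Set (Fin k))

/-- `f` is a `k`-rainbow function on `G`: every vertex with an empty label sees all `k` colors in
its neighborhood. -/
def IsRainbow {V : Type*} (G : SimpleGraph V) {k : ℕ} (f : V → Finset (Fin k)) : Prop :=
  ∀ x, f x = ∅ → labels f (G.neighborSet x) = Set.univ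

/-- The cost `‖f‖ = ∑ |f(x)|`. -/
def cost {V : Type*} [Fintype V] {k : ℕ} (f : V → Finset (Fin k)) : ℕ :=
  ∑ x, (f x).card

/-- The `k`-rainbow domination number, the minimum cost of a `k`-rainbow function.
(The set of costs is never empty: the function with all labels `[k]` is a `k`-rainbow function.) -/
noncomputable def rainbowNumber {V : Type*} [Fintype V] (G : SimpleGraph V) (k : ℕ) : ℕ :=
  sInf {c | ∃ f : V → Finset (Fin k), IsRainbow G f ∧ cost f = c}

/-- The `k`-rainbow functions on `G` without an empty label. -/
def FPlus {V : Type*} (G : SimpleGraph V) (k : ℕ) : Set (V → Finset (Fin k)) :=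
  {f | IsRainbow G f ∧ ∀ x, f x ≠ ∅}

/-- The `k`-rainbow functions on `G` with at least one empty label. -/
def FMinus {V : Type*} (G : SimpleGraph V) (k : ℕ) : Set (V → Finset (Fin k)) :=
  {f | IsRainbow G f} \ FPlus G k

/-- The minimum cost of a function in `FPlus G k` that uses every color
(`⊤` if there is none). -/
noncomputable def RPlus {V : Type*} [Fintype V] (G : SimpleGraph V) (k : ℕ) : ℕ∞ :=
  ⨅ f ∈ {f | f ∈ FPlus G k ∧ labels f Set.univ = Set.univ}, (cost f : ℕ∞)

/-- The minimum cost of a function in `FMinus G k` (`⊤` if there is none). -/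
noncomputable def RMinus {V : Type*} [Fintype V] (G : SimpleGraph V) (k : ℕ) : ℕ∞ :=
  ⨅ f ∈ FMinus G k, (cost f : ℕ∞)

/-- A cograph: a graph without induced path on four vertices. -/
def IsCograph {V : Type*} (G : SimpleGraph V) : Prop :=
  ¬ (SimpleGraph.pathGraph 4).IsIndContained G

/-- The join of two graphs: their disjoint union together with all edges between them. -/
def join {V W : Type*} (G : SimpleGraph V) (H : SimpleGraph W) : SimpleGraph (V ⊕ W) :=
  G.sum H ⊔ completeBipartiteGraph V W

end RainbowDom

/-! ### A random access machine with word-size bound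

Programs are structured (`while`) programs over finitely many registers and finitely many
arrays of natural numbers, with addition, truncated subtraction and comparison as the only
operations.  Every instruction costs one unit plus the size of the expressions that it evaluates
(each array access and each arithmetic operation costs one unit), and every number that is
written into a register or an array cell has to fit into a word, that is, be at most `B`. -/

namespace WordRAM

/-- A memory state: the registers, and the arrays (array name, index). -/
structure State where
  reg : ℕ → ℕ
  arr : ℕ → ℕ → ℕ

/-- Expressions; `read a e` is the content of array `a` at index `e`. -/
inductive Expr where
  | const (c : ℕ)
  | reg (x : ℕ)
  | read (a : ℕ) (e : Expr)
  | add (e₁ e₂ : Expr)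
  | sub (e₁ e₂ : Expr)

/-- The value of an expression. -/
def Expr.eval (s : State) : Expr → ℕ
  | .const c => c
  | .reg x => s.reg x
  | .read a e => s.arr a (e.eval s)
  | .add e₁ e₂ => e₁.eval s + e₂.eval s
  | .sub e₁ e₂ => e₁.eval s - e₂.eval s

/-- The time for the evaluation of an expression: its size. -/
def Expr.time : Expr → ℕ
  | .const _ => 1
  | .reg _ => 1
  | .read _ e => e.time + 1
  | .add e₁ e₂ => e₁.time + e₂.time + 1
  | .sub e₁ e₂ => e₁.time + e₂.time + 1

/-- Tests. -/
inductive Test where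
  | lt (e₁ e₂ : Expr)
  | eq (e₁ e₂ : Expr)

/-- The truth of a test. -/
def Test.holds (s : State) : Test → Prop
  | .lt e₁ e₂ => e₁.eval s < e₂.eval s
  | .eq e₁ e₂ => e₁.eval s = e₂.eval s

/-- The time for the evaluation of a test. -/
def Test.time : Test → ℕ
  | .lt e₁ e₂ => e₁.time + e₂.time
  | .eq e₁ e₂ => e₁.time + e₂.time

/-- Programs. -/
inductive Prog where
  | skip
  | assign (x : ℕ) (e : Expr)
  | store (a : ℕ) (i e : Expr)
  | seq (p q : Prog)
  | ite (b : Test) (p q : Prog)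
  | loop (b : Test) (p : Prog)

/-- Write `v` into register `x`. -/
def State.setReg (s : State) (x v : ℕ) : State :=
  { s with reg := Function.update s.reg x v }

/-- Write `v` into array `a` at index `i`. -/
def State.setArr (s : State) (a i v : ℕ) : State :=
  { s with arr := Function.update s.arr a (Function.update (s.arr a) i v) }

/-- `Exec B p s s' t`: program `p`, started in the state `s`, halts in the state `s'` after time
`t`, and every number that it writes is at most `B`.  `loop b p` is `while b do p`. -/
inductive Exec (B : ℕ) : Prog → State → State → ℕ → Prop
  | skip (s : State) : Exec B .skip s s 1
  | assign (s : State) (x : ℕ) (e : Expr) (h : e.eval s ≤ B) :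
      Exec B (.assign x e) s (s.setReg x (e.eval s)) (e.time + 1)
  | store (s : State) (a : ℕ) (i e : Expr) (h : e.eval s ≤ B) :
      Exec B (.store a i e) s (s.setArr a (i.eval s) (e.eval s)) (i.time + e.time + 1)
  | seq (p q : Prog) (s s' s'' : State) (t t' : ℕ)
      (h : Exec B p s s' t) (h' : Exec B q s' s'' t') :
      Exec B (.seq p q) s s'' (t + t')
  | iteTrue (b : Test) (p q : Prog) (s s' : State) (t : ℕ)
      (hb : b.holds s) (h : Exec B p s s' t) :
      Exec B (.ite b p q) s s' (b.time + 1 + t)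
  | iteFalse (b : Test) (p q : Prog) (s s' : State) (t : ℕ)
      (hb : ¬ b.holds s) (h : Exec B q s s' t) :
      Exec B (.ite b p q) s s' (b.time + 1 + t)
  | loopTrue (b : Test) (p : Prog) (s s' s'' : State) (t t' : ℕ)
      (hb : b.holds s) (h : Exec B p s s' t) (h' : Exec B (.loop b p) s' s'' t') :
      Exec B (.loop b p) s s'' (b.time + 1 + t + t')
  | loopFalse (b : Test) (p : Prog) (s : State) (hb : ¬ b.holds s) :
      Exec B (.loop b p) s s (b.time + 1)

/-- The machine is deterministic: the final state and the running time are determined by the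
program and the initial state. -/
theorem Exec.deterministic {B B' : ℕ} {p : Prog} {s s₁ s₂ : State} {t₁ t₂ : ℕ}
    (h₁ : Exec B p s s₁ t₁) (h₂ : Exec B' p s s₂ t₂) : s₁ = s₂ ∧ t₁ = t₂ := by
  induction h₁ generalizing s₂ t₂ with
  | skip s => cases h₂; simp
  | assign s x e h => cases h₂; simp
  | store s a i e h => cases h₂; simp
  | seq p q s s' s'' t t' h h' ih ih' =>
    cases h₂ with
    | seq _ _ _ _ _ _ _ g g' =>
      obtain ⟨rfl, rfl⟩ := ih g
      obtain ⟨rfl, rfl⟩ := ih' g'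
      simp
  | iteTrue b p q s s' t hb h ih =>
    cases h₂ with
    | iteTrue _ _ _ _ _ _ _ g => obtain ⟨rfl, rfl⟩ := ih g; simp
    | iteFalse _ _ _ _ _ _ gb _ => exact absurd hb gb
  | iteFalse b p q s s' t hb h ih =>
    cases h₂ with
    | iteTrue _ _ _ _ _ _ gb _ => exact absurd gb hb
    | iteFalse _ _ _ _ _ _ _ g => obtain ⟨rfl, rfl⟩ := ih g; simp
  | loopTrue b p s s' s'' t t' hb h h' ih ih' =>
    cases h₂ with
    | loopTrue _ _ _ _ _ _ _ _ g g' =>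
      obtain ⟨rfl, rfl⟩ := ih g
      obtain ⟨rfl, rfl⟩ := ih' g'
      simp
    | loopFalse _ _ _ gb => exact absurd hb gb
  | loopFalse b p s hb =>
    cases h₂ with
    | loopTrue _ _ _ _ _ _ _ gb _ _ => exact absurd gb hb
    | loopFalse _ _ _ _ => simp

/-- `off`, `adj` are the adjacency lists of the graph `G` with the vertices `0, …, n - 1`,
stored consecutively: the cells `off v, …, off (v + 1) - 1` of `adj` hold the neighbors of `v`,
each of them once, in an arbitrary order.  Unused cells hold `0`. -/
structure IsAdjacencyLists {n : ℕ} (G : SimpleGraph (Fin n)) (off adj : ℕ → ℕ) : Prop where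
  off_zero : off 0 = 0
  off_le : ∀ v < n, off v ≤ off (v + 1)
  bijOn : ∀ v : Fin n, Set.BijOn adj (Set.Ico (off v) (off (v + 1))) (Fin.val '' G.neighborSet v)
  off_unused : ∀ v, n < v → off v = 0
  adj_unused : ∀ i, off n ≤ i → adj i = 0

/-- The initial memory for the input that consists of a graph on `n` vertices, given by adjacency
lists, and a number `k`: `n` and `k` are in the registers `0` and `1`, `off` and `adj` in the
arrays `0` and `1`, and everything else is `0`. -/
def inputState (n k : ℕ) (off adj : ℕ → ℕ) : State where
  reg := fun x => if x = 0 then n else if x = 1 then k else 0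
  arr := fun a => if a = 0 then off else if a = 1 then adj else fun _ => 0

end WordRAM

/-! Formulas. A rainbow function without empty labels costs at least the number of vertices; in one
with an empty label, the empty vertex sees every color, so the cost is at least `k`. This dichotomy
yields `RPlus_eq`, `rainbowNumber_eq_min` and, on the two sides of a disjoint union, `RMinus_sum`.
For a join, a function on one side that uses every color extends by empty labels to the other side,
and one label `[k]` on each side costs `2k`. Conversely, if a function with an empty label costs
less than `2k`, then some color `c` occurs at exactly one vertex `v`. Move all labels of the
opposite side to `v`: an empty vertex on the side of `v` sees `c`, hence is adjacent to `v` and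
loses no color (`min_le_cost_of_unique_color`). Since `RMinus` is at least `k`, the join formula can
be rewritten in terms of the orders and rainbow numbers of the two sides alone
(`rainbowNumber_join`), and rainbow numbers are additive over disjoint unions (`rainbowNumber_sum`).
So the number is computed bottom-up along a cotree.

Algorithm. The cotree is built by inserting the vertices one at a time, in the manner of Corneil,
Perl and Stewart, each in time proportional to its degree plus one. Call a node full for the new
vertex `x` if `x` is adjacent to all leaves below it, and mixed if `x` is adjacent to some but not
all of them. A mixed node together with a wrongly attached leaf outside of it would produce an
induced path on four vertices (`adj_of_mixed`); so the mixed nodes form a chain, and `x` belongs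
directly below the lowest of them, or below the root if there is none. Full nodes are found by
passing marks upwards from the neighbors of `x`; since inner nodes have two children or more, at
most twice as many nodes are marked as there are neighbors (`Marked.len_le`). The place of `x` is
then recognized by a local test on the nodes that have a full child without being full
(`exists_place`). At the place, `x` is attached to it or next to one of its children, if necessary
after the full children have been split off (`insert_of_no_full`, `insert_of_unique`,
`insert_below`, `insert_over`).

Only parent pointers are stored. Lists of children are replaced by the number of children and the
sum of their names modulo a number `M` above all names; if all children but one are full, a
difference of sums names the exception (`Placed.exists_eq_sum`). Two isolated dummy leaves `n` and
`n + 1` ensure that the root `n + 2` is always parallel, has two children and is never full.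

Evaluation. The same marking, started from all vertices `0, …, n - 1`, lists the nodes with children
before parents. Adding the entries to their parents one by one is a sequence of disjoint unions and
joins, and the value at the root is the answer, because the marked children of the root cover
exactly the vertices (`seen_root`). -/

set_option linter.unusedSimpArgs false

/-! ### Rainbow functions on disjoint unions and joins. -/

namespace RainbowDom

section Rainbow

variable {V W : Type*} {k : ℕ}

theorem mem_labels {f : V → Finset (Fin k)} {S : Set V} {c : Fin k} :
    c ∈ labels f S ↔ ∃ y ∈ S, c ∈ f y := by
  simp [labels]

theorem isRainbow_iff {G : SimpleGraph V} {f : V → Finset (Fin k)} :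
    IsRainbow G f ↔ ∀ x, f x = ∅ → ∀ c, ∃ y, G.Adj x y ∧ c ∈ f y := by
  simp [IsRainbow, Set.eq_univ_iff_forall, mem_labels]

theorem mem_FMinus {G : SimpleGraph V} {f : V → Finset (Fin k)} :
    f ∈ FMinus G k ↔ IsRainbow G f ∧ ∃ x, f x = ∅ := by
  simp only [FMinus, FPlus, Set.mem_sdiff, Set.mem_ofPred_eq]
  constructor
  · rintro ⟨h, h'⟩
    refine ⟨h, ?_⟩
    by_contra! hne
    exact h' ⟨h, fun x => (hne x).ne_empty⟩
  · rintro ⟨h, x, hx⟩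
    exact ⟨h, fun h' => h'.2 x hx⟩

theorem isRainbow_of_ne_empty {G : SimpleGraph V} {f : V → Finset (Fin k)}
    (h : ∀ x, f x ≠ ∅) : IsRainbow G f :=
  fun x hx => absurd hx (h x)

theorem exists_color_of_mem_FMinus {G : SimpleGraph V} {f : V → Finset (Fin k)}
    (h : f ∈ FMinus G k) (c : Fin k) : ∃ y, c ∈ f y := by
  obtain ⟨h, x, hx⟩ := mem_FMinus.1 h
  obtain ⟨y, -, hy⟩ := isRainbow_iff.1 h x hx c
  exact ⟨y, hy⟩


theorem isRainbow_sum {G : SimpleGraph V} {H : SimpleGraph W} {f : V ⊕ W → Finset (Fin k)} :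
    IsRainbow (G.sum H) f ↔
      IsRainbow G (fun x => f (.inl x)) ∧ IsRainbow H fun x => f (.inr x) := by
  simp [isRainbow_iff]

theorem join_adj_inl_inl {G : SimpleGraph V} {H : SimpleGraph W} {x y : V} :
    (join G H).Adj (.inl x) (.inl y) ↔ G.Adj x y := by simp [join]

theorem join_adj_inl_inr {G : SimpleGraph V} {H : SimpleGraph W} {x : V} {y : W} :
    (join G H).Adj (.inl x) (.inr y) := by simp [join]

theorem join_adj_inr_inl {G : SimpleGraph V} {H : SimpleGraph W} {x : V} {y : W} :
    (join G H).Adj (.inr y) (.inl x) := by simp [join]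

theorem join_adj_inr_inr {G : SimpleGraph V} {H : SimpleGraph W} {x y : W} :
    (join G H).Adj (.inr x) (.inr y) ↔ H.Adj x y := by simp [join]

/-- The isomorphism between the joins in both orders. -/
def joinComm (G : SimpleGraph V) (H : SimpleGraph W) : join G H ≃g join H G where
  toEquiv := Equiv.sumComm V W
  map_rel_iff' := by rintro (x | x) (y | y) <;> simp [join]

theorem isRainbow_comp_iso {G : SimpleGraph V} {H : SimpleGraph W} (e : G ≃g H)
    {f : W → Finset (Fin k)} : IsRainbow G (fun x => f (e x)) ↔ IsRainbow H f := by
  simp only [isRainbow_iff]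
  refine ⟨fun h x hx c => ?_, fun h x hx c => ?_⟩
  · obtain ⟨y, hy, hc⟩ := h (e.symm x) (by simpa using hx) c
    exact ⟨e y, by simpa using e.map_adj_iff.2 hy, hc⟩
  · obtain ⟨y, hy, hc⟩ := h (e x) hx c
    exact ⟨e.symm y, by simpa using e.symm.map_adj_iff.2 hy, by simpa using hc⟩

variable [Fintype V] [Fintype W]

theorem card_le_cost {f : V → Finset (Fin k)} (h : ∀ x, f x ≠ ∅) : Fintype.card V ≤ cost f := by
  rw [cost, Fintype.card_eq_sum_ones]
  exact Finset.sum_le_sum fun x _ => Finset.card_pos.2 (Finset.nonempty_iff_ne_empty.2 (h x))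

theorem le_cost_of_forall_color {f : V → Finset (Fin k)} (h : ∀ c, ∃ y, c ∈ f y) :
    k ≤ cost f := by
  classical
  have h1 : (Finset.univ : Finset (Fin k)) ⊆ Finset.univ.biUnion f := by
    intro c _
    obtain ⟨y, hy⟩ := h c
    exact Finset.mem_biUnion.2 ⟨y, Finset.mem_univ _, hy⟩
  have h2 := (Finset.card_le_card h1).trans Finset.card_biUnion_le
  simpa [cost] using h2

/-- Double counting of the pairs of a vertex and a color in its label. It yields a color that occurs
at most once when the cost is below `2k`. -/
theorem cost_eq_sum_colors (f : V → Finset (Fin k)) :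
    cost f = ∑ c : Fin k, (Finset.univ.filter fun x => c ∈ f x).card := by
  classical
  have := Finset.sum_card_bipartiteAbove_eq_sum_card_bipartiteBelow
    (s := (Finset.univ : Finset V)) (t := (Finset.univ : Finset (Fin k))) (fun x c => c ∈ f x)
  simpa [cost, Finset.bipartiteAbove, Finset.bipartiteBelow] using this

/-- With at most `k` vertices, the fibers of a surjection from the colors to the vertices serve as
labels; otherwise the singletons of the values of a surjection from the vertices to the colors. -/
theorem exists_cost_eq_max [Nonempty V] (hk : 1 ≤ k) :
    ∃ f : V → Finset (Fin k), (∀ x, f x ≠ ∅) ∧ (∀ c, ∃ y, c ∈ f y) ∧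
      cost f = max (Fintype.card V) k := by
  classical
  have : Nonempty (Fin k) := ⟨⟨0, hk⟩⟩
  rcases le_total (Fintype.card V) k with h | h
  · obtain ⟨e⟩ : Nonempty (V ↪ Fin k) :=
      Function.Embedding.nonempty_of_card_le (by simpa using h)
    let g := Function.invFun e
    have hg : Function.Surjective g := (Function.leftInverse_invFun e.injective).surjective
    refine ⟨fun x => Finset.univ.filter fun c => g c = x, fun x hx => ?_, fun c => ⟨g c, by simp⟩, ?_⟩
    · obtain ⟨c, hc⟩ := hg x
      have : c ∈ (Finset.univ.filter fun c => g c = x) := by simp [hc]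
      beta_reduce at hx
      rw [hx] at this
      simp at this
    · rw [max_eq_right h, cost]
      have := Finset.card_eq_sum_card_fiberwise (f := g) (s := Finset.univ) (t := Finset.univ)
        (fun _ _ => by simp)
      simpa using this.symm
  · obtain ⟨e⟩ : Nonempty (Fin k ↪ V) :=
      Function.Embedding.nonempty_of_card_le (by simpa using h)
    let g := Function.invFun e
    have hg : Function.Surjective g := (Function.leftInverse_invFun e.injective).surjective
    refine ⟨fun x => {g x}, fun x => by simp, fun c => ?_, ?_⟩
    · obtain ⟨y, hy⟩ := hg c
      exact ⟨y, by simp [hy]⟩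
    · simp [cost, h]

theorem RPlus_eq (G : SimpleGraph V) [Nonempty V] (hk : 1 ≤ k) :
    RPlus G k = max (Fintype.card V : ℕ∞) (k : ℕ∞) := by
  apply le_antisymm
  · obtain ⟨f, h1, h2, h3⟩ := exists_cost_eq_max (V := V) hk
    have hf : f ∈ {f | f ∈ FPlus G k ∧ labels f Set.univ = Set.univ} :=
      ⟨⟨isRainbow_of_ne_empty h1, h1⟩,
        Set.eq_univ_of_forall fun c => mem_labels.2 (by simpa using h2 c)⟩
    refine (iInf₂_le f hf).trans ?_
    rw [h3]
    exact le_of_eq (Nat.mono_cast.map_max ..)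
  · refine le_iInf₂ fun f hf => ?_
    obtain ⟨⟨_, h1⟩, h2⟩ := hf
    refine max_le (Nat.cast_le.2 (card_le_cost h1)) (Nat.cast_le.2 (le_cost_of_forall_color ?_))
    intro c
    have : c ∈ labels f Set.univ := h2 ▸ Set.mem_univ c
    simpa using mem_labels.1 this

theorem rainbowNumber_le {G : SimpleGraph V} {f : V → Finset (Fin k)} (h : IsRainbow G f) :
    rainbowNumber G k ≤ cost f :=
  Nat.sInf_le ⟨f, h, rfl⟩

theorem exists_cost_eq_rainbowNumber (G : SimpleGraph V) (hk : 1 ≤ k) :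
    ∃ f : V → Finset (Fin k), IsRainbow G f ∧ cost f = rainbowNumber G k := by
  have : Nonempty (Fin k) := ⟨⟨0, hk⟩⟩
  exact Nat.sInf_mem (s := {c | ∃ f : V → Finset (Fin k), IsRainbow G f ∧ cost f = c})
    ⟨_, fun _ => Finset.univ, isRainbow_of_ne_empty fun _ => Finset.univ_nonempty.ne_empty, rfl⟩

theorem RMinus_le {G : SimpleGraph V} {f : V → Finset (Fin k)} (h : f ∈ FMinus G k) :
    RMinus G k ≤ cost f :=
  iInf₂_le f h

/-- Upper bounds in terms of `RMinus` are trivial when it is infinite; otherwise they may start from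
an optimal function. -/
theorem RMinus_eq_top_or (G : SimpleGraph V) (k : ℕ) :
    RMinus G k = ⊤ ∨ ∃ f ∈ FMinus G k, RMinus G k = cost f := by
  classical
  by_cases h : (FMinus G k).Nonempty
  · right
    have hne : ({c | ∃ f ∈ FMinus G k, cost f = c} : Set ℕ).Nonempty := by
      obtain ⟨f, hf⟩ := h
      exact ⟨_, f, hf, rfl⟩
    obtain ⟨f, hf, hc⟩ := Nat.sInf_mem hne
    refine ⟨f, hf, le_antisymm (RMinus_le hf) (le_iInf₂ fun g hg => ?_)⟩
    rw [hc]
    exact Nat.cast_le.2 (Nat.sInf_le ⟨g, hg, rfl⟩)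
  · left
    rw [Set.not_nonempty_iff_eq_empty] at h
    simp [RMinus, h]

theorem le_RMinus (G : SimpleGraph V) (k : ℕ) : (k : ℕ∞) ≤ RMinus G k :=
  le_iInf₂ fun _ hf => Nat.cast_le.2 (le_cost_of_forall_color (exists_color_of_mem_FMinus hf))

/-- Without empty labels the cheapest choice is one color everywhere; the other functions are those
of `FMinus`. -/
theorem rainbowNumber_eq_min (G : SimpleGraph V) (hk : 1 ≤ k) :
    (rainbowNumber G k : ℕ∞) = min (Fintype.card V : ℕ∞) (RMinus G k) := by
  apply le_antisymm
  · refine le_min (Nat.cast_le.2 ?_) (le_iInf₂ fun f hf =>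
      Nat.cast_le.2 (rainbowNumber_le (mem_FMinus.1 hf).1))
    have h := rainbowNumber_le (G := G) (f := fun _ : V => {(⟨0, hk⟩ : Fin k)})
      (isRainbow_of_ne_empty fun _ => Finset.singleton_ne_empty _)
    simpa [cost] using h
  · obtain ⟨f, hf, hc⟩ := exists_cost_eq_rainbowNumber G hk
    rw [← hc]
    by_cases h : ∃ x, f x = ∅
    · exact (min_le_right _ _).trans (RMinus_le (mem_FMinus.2 ⟨hf, h⟩))
    · exact (min_le_left _ _).trans (Nat.cast_le.2 (card_le_cost (by simpa using h)))

theorem cost_sum (f : V ⊕ W → Finset (Fin k)) :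
    cost f = cost (fun x => f (.inl x)) + cost fun x => f (.inr x) :=
  Fintype.sum_sum_type _

/-- Being rainbow is a condition on each side separately. At least one side carries the empty label,
and a side without empty labels costs at least its order, which singletons attain. -/
theorem RMinus_sum (G : SimpleGraph V) (H : SimpleGraph W) (hk : 1 ≤ k) :
    RMinus (G.sum H) k = min (RMinus G k + (Fintype.card W : ℕ∞))
      (min (RMinus H k + (Fintype.card V : ℕ∞)) (RMinus G k + RMinus H k)) := by
  apply le_antisymm
  · refine le_min ?_ (le_min ?_ ?_)
    · obtain h | ⟨f, hf, hc⟩ := RMinus_eq_top_or G k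
      · simp [h]
      obtain ⟨hf, x, hx⟩ := mem_FMinus.1 hf
      refine (RMinus_le (f := Sum.elim f fun _ => {(⟨0, hk⟩ : Fin k)}) (mem_FMinus.2
        ⟨isRainbow_sum.2 ⟨hf, isRainbow_of_ne_empty fun _ => by simp⟩, .inl x, hx⟩)).trans ?_
      rw [hc, cost_sum]
      simp [cost]
    · obtain h | ⟨f, hf, hc⟩ := RMinus_eq_top_or H k
      · simp [h]
      obtain ⟨hf, x, hx⟩ := mem_FMinus.1 hf
      refine (RMinus_le (f := Sum.elim (fun _ => {(⟨0, hk⟩ : Fin k)}) f) (mem_FMinus.2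
        ⟨isRainbow_sum.2 ⟨isRainbow_of_ne_empty fun _ => by simp, hf⟩, .inr x, hx⟩)).trans ?_
      rw [hc, cost_sum]
      simp [cost, add_comm]
    · obtain h | ⟨f, hf, hc⟩ := RMinus_eq_top_or G k
      · simp [h]
      obtain h | ⟨g, hg, hd⟩ := RMinus_eq_top_or H k
      · simp [h]
      obtain ⟨hf, x, hx⟩ := mem_FMinus.1 hf
      refine (RMinus_le (f := Sum.elim f g) (mem_FMinus.2
        ⟨isRainbow_sum.2 ⟨hf, (mem_FMinus.1 hg).1⟩, .inl x, hx⟩)).trans ?_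
      rw [hc, hd, cost_sum]
      simp
  · refine le_iInf₂ fun f hf => ?_
    obtain ⟨hf, hx⟩ := mem_FMinus.1 hf
    obtain ⟨hG, hH⟩ := isRainbow_sum.1 hf
    rw [cost_sum, Nat.cast_add]
    by_cases h1 : ∃ x, f (.inl x) = ∅
    · have hG' := RMinus_le (mem_FMinus.2 ⟨hG, h1⟩)
      by_cases h2 : ∃ x, f (.inr x) = ∅
      · have hH' := RMinus_le (mem_FMinus.2 ⟨hH, h2⟩)
        exact (min_le_right _ _).trans ((min_le_right _ _).trans (add_le_add hG' hH'))
      · exact (min_le_left _ _).trans (add_le_add hG'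
          (Nat.cast_le.2 (card_le_cost (by simpa using h2))))
    · have h2 : ∃ x, f (.inr x) = ∅ := by
        obtain ⟨x | x, hx⟩ := hx
        · exact absurd ⟨x, hx⟩ h1
        · exact ⟨x, hx⟩
      rw [add_comm (Nat.cast (R := ℕ∞) _) (Nat.cast _)]
      exact (min_le_right _ _).trans ((min_le_left _ _).trans (add_le_add
        (RMinus_le (mem_FMinus.2 ⟨hH, h2⟩)) (Nat.cast_le.2 (card_le_cost (by simpa using h1)))))

theorem cost_comp_equiv (e : V ≃ W) (f : W → Finset (Fin k)) :
    cost (fun x => f (e x)) = cost f :=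
  e.sum_comp fun x => (f x).card

theorem RMinus_le_of_iso {G : SimpleGraph V} {H : SimpleGraph W} (e : G ≃g H) :
    RMinus G k ≤ RMinus H k := by
  refine le_iInf₂ fun f hf => ?_
  obtain ⟨hf, x, hx⟩ := mem_FMinus.1 hf
  rw [← cost_comp_equiv e.toEquiv f]
  exact RMinus_le (mem_FMinus.2 ⟨(isRainbow_comp_iso e).2 hf, e.symm x, by simpa using hx⟩)

theorem RMinus_congr {G : SimpleGraph V} {H : SimpleGraph W} (e : G ≃g H) :
    RMinus G k = RMinus H k :=
  le_antisymm (RMinus_le_of_iso e) (RMinus_le_of_iso e.symm)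

theorem rainbowNumber_congr {G : SimpleGraph V} {H : SimpleGraph W} (e : G ≃g H) (hk : 1 ≤ k) :
    rainbowNumber G k = rainbowNumber H k := by
  have h1 := rainbowNumber_eq_min G hk
  rw [RMinus_congr e, Fintype.card_congr e.toEquiv, ← rainbowNumber_eq_min H hk] at h1
  exact_mod_cast h1

/-- Every vertex on the right sees the whole left side, so its label may be empty as soon as the
left side uses every color. -/
theorem RMinus_join_le_left [Nonempty V] [Nonempty W] (G : SimpleGraph V) (H : SimpleGraph W) :
    RMinus (join G H) k ≤ min (RPlus G k) (RMinus G k) := by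
  have key : ∀ f : V → Finset (Fin k), IsRainbow G f → (∀ c, ∃ y, c ∈ f y) →
      RMinus (join G H) k ≤ cost f := by
    intro f hf hc
    have h : Sum.elim f (fun _ : W => ∅) ∈ FMinus (join G H) k := by
      refine mem_FMinus.2 ⟨isRainbow_iff.2 ?_, .inr (Classical.arbitrary W), rfl⟩
      rintro (x | x) hx c
      · obtain ⟨y, hy, hc⟩ := isRainbow_iff.1 hf x hx c
        exact ⟨.inl y, join_adj_inl_inl.2 hy, hc⟩
      · obtain ⟨y, hy⟩ := hc c
        exact ⟨.inl y, join_adj_inr_inl, hy⟩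
    refine (RMinus_le h).trans ?_
    rw [cost_sum]
    simp [cost]
  refine le_min (le_iInf₂ fun f hf => key f hf.1.1 fun c => ?_) (le_iInf₂ fun f hf =>
    key f (mem_FMinus.1 hf).1 (exists_color_of_mem_FMinus hf))
  have : c ∈ labels f Set.univ := hf.2 ▸ Set.mem_univ c
  simpa using mem_labels.1 this

/-- A color that occurs only once, on the left hand side of a join, allows us to move all labels
to this side. -/
theorem min_le_cost_of_unique_color (G : SimpleGraph V) (H : SimpleGraph W)
    {f : V ⊕ W → Finset (Fin k)} (hf : f ∈ FMinus (join G H) k) {c : Fin k} {v : V}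
    (hv : ∀ x, c ∈ f x → x = .inl v) : min (RPlus G k) (RMinus G k) ≤ cost f := by
  classical
  let B : Finset (Fin k) := Finset.univ.biUnion fun y : W => f (.inr y)
  let g : V → Finset (Fin k) := fun x => if x = v then f (.inl v) ∪ B else f (.inl x)
  have hr := isRainbow_iff.1 (mem_FMinus.1 hf).1
  have hsub : ∀ x, f (.inl x) ⊆ g x := by
    intro x
    by_cases hx : x = v
    · subst hx
      simp [g]
    · simp [g, hx]
  have hB : ∀ y, f (.inr y) ⊆ g v := by
    intro y d hd
    simp only [g, if_true]
    exact Finset.mem_union_right _ (Finset.mem_biUnion.2 ⟨y, Finset.mem_univ _, hd⟩)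
  have hg : IsRainbow G g := by
    refine isRainbow_iff.2 fun x hx d => ?_
    have hx' : f (.inl x) = ∅ := Finset.subset_empty.1 (hx ▸ hsub x)
    -- An empty vertex on the left sees the color `c`, which occurs only at `v`. So it is adjacent
    -- to `v`, where the labels moved from the right are now found.
    have hadj : G.Adj x v := by
      obtain ⟨y, hy, hyc⟩ := hr (.inl x) hx' c
      rw [hv y hyc] at hy
      exact join_adj_inl_inl.1 hy
    obtain ⟨y | y, hy, hyd⟩ := hr (.inl x) hx' d
    · exact ⟨y, join_adj_inl_inl.1 hy, hsub y hyd⟩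
    · exact ⟨v, hadj, hB y hyd⟩
  have hcost : cost g ≤ cost f := by
    have hBc : B.card ≤ cost fun y => f (.inr y) := Finset.card_biUnion_le
    have h1 : ∑ x, (g x).card ≤ ∑ x, ((f (.inl x)).card + if x = v then B.card else 0) := by
      refine Finset.sum_le_sum fun x _ => ?_
      by_cases hx : x = v
      · subst hx
        simpa [g] using Finset.card_union_le _ _
      · simp [g, hx]
    rw [Finset.sum_add_distrib] at h1
    simp only [Finset.sum_ite_eq', Finset.mem_univ, if_true] at h1
    rw [cost_sum]
    exact h1.trans (Nat.add_le_add_left hBc _)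
  by_cases he : ∃ x, g x = ∅
  · exact (min_le_right _ _).trans ((RMinus_le (mem_FMinus.2 ⟨hg, he⟩)).trans
      (Nat.cast_le.2 hcost))
  · refine (min_le_left _ _).trans ((iInf₂_le g ⟨⟨hg, by simpa using he⟩, ?_⟩).trans
      (Nat.cast_le.2 hcost))
    refine Set.eq_univ_of_forall fun d => mem_labels.2 ?_
    obtain ⟨y | y, hy⟩ := exists_color_of_mem_FMinus hf d
    · exact ⟨y, trivial, hsub y hy⟩
    · exact ⟨v, trivial, hB y hy⟩

theorem RMinus_join [Nonempty V] [Nonempty W] (G : SimpleGraph V) (H : SimpleGraph W)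
    (hk : 1 ≤ k) :
    RMinus (join G H) k = min (RPlus G k) (min (RPlus H k)
      (min (RMinus G k) (min (RMinus H k) (2 * k : ℕ∞)))) := by
  classical
  have hG := RMinus_join_le_left (k := k) G H
  have hH := RMinus_join_le_left (k := k) H G
  rw [RMinus_congr (joinComm H G)] at hH
  rw [le_min_iff] at hG hH
  apply le_antisymm
  · refine le_min hG.1 (le_min hH.1 (le_min hG.2 (le_min hH.2 ?_)))
    -- The witness of cost `2k` has an empty label only if some side has a second vertex. If the
    -- left side has at most `k` vertices, then `RPlus` is already `k`.
    by_cases hcard : Fintype.card V ≤ k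
    · refine hG.1.trans ?_
      rw [RPlus_eq G hk, max_eq_right (Nat.cast_le.2 hcard)]
      exact_mod_cast (by omega : k ≤ 2 * k)
    · obtain ⟨v⟩ := ‹Nonempty V›
      obtain ⟨w⟩ := ‹Nonempty W›
      have : Nontrivial V := Fintype.one_lt_card_iff_nontrivial.1 (by omega)
      obtain ⟨v', hv'⟩ := exists_ne v
      let f : V ⊕ W → Finset (Fin k) :=
        Sum.elim (fun x => if x = v then Finset.univ else ∅)
          (fun x => if x = w then Finset.univ else ∅)
      have hf : f ∈ FMinus (join G H) k := by
        refine mem_FMinus.2 ⟨isRainbow_iff.2 ?_, .inl v', by simp [f, hv']⟩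
        rintro (x | x) hx c
        · exact ⟨.inr w, join_adj_inl_inr, by simp [f]⟩
        · exact ⟨.inl v, join_adj_inr_inl, by simp [f]⟩
      refine (RMinus_le hf).trans ?_
      have h1 : ∀ x : V, (if x = v then (Finset.univ : Finset (Fin k)) else ∅).card =
          if x = v then k else 0 := fun x => by split_ifs <;> simp
      have h2 : ∀ x : W, (if x = w then (Finset.univ : Finset (Fin k)) else ∅).card =
          if x = w then k else 0 := fun x => by split_ifs <;> simp
      have : cost f = 2 * k := by
        rw [cost_sum]
        simp [f, cost, h1, h2, two_mul]
      rw [this]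
      simp
  · refine le_iInf₂ fun f hf => ?_
    by_cases h2 : 2 * k ≤ cost f
    · refine (min_le_right _ _).trans ((min_le_right _ _).trans ((min_le_right _ _).trans
        ((min_le_right _ _).trans ?_)))
      exact_mod_cast h2
    -- If every color occurred twice, then double counting would give a cost of at least `2k`.
    obtain ⟨c, hc⟩ : ∃ c : Fin k, (Finset.univ.filter fun x => c ∈ f x).card ≤ 1 := by
      by_contra! hall
      apply h2
      rw [cost_eq_sum_colors]
      calc 2 * k = ∑ _c : Fin k, 2 := by simp [mul_comm]
        _ ≤ _ := Finset.sum_le_sum fun c _ => hall c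
    obtain ⟨z, hz⟩ := exists_color_of_mem_FMinus hf c
    have huniq : ∀ x, c ∈ f x → x = z := fun x hx =>
      Finset.card_le_one.1 hc x (by simpa using hx) z (by simpa using hz)
    obtain v | w := z
    · have := min_le_cost_of_unique_color G H hf huniq
      refine le_trans (le_min ?_ ?_) this
      · exact min_le_left _ _
      · exact (min_le_right _ _).trans ((min_le_right _ _).trans (min_le_left _ _))
    · let e := joinComm H G
      have hf' : (fun x => f (e x)) ∈ FMinus (join H G) k := by
        obtain ⟨h, x, hx⟩ := mem_FMinus.1 hf
        exact mem_FMinus.2 ⟨(isRainbow_comp_iso e).2 h, e.symm x, by simpa using hx⟩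
      have := min_le_cost_of_unique_color H G hf' (c := c) (v := w) (fun x hx => by
        apply e.injective
        rw [huniq _ hx]
        rfl)
      rw [show cost (fun x => f (e x)) = cost f from cost_comp_equiv e.toEquiv f] at this
      refine le_trans (le_min ?_ ?_) this
      · exact (min_le_right _ _).trans (min_le_left _ _)
      · exact (min_le_right _ _).trans ((min_le_right _ _).trans ((min_le_right _ _).trans
          (min_le_left _ _)))

theorem rainbowNumber_sum (G : SimpleGraph V) (H : SimpleGraph W) (hk : 1 ≤ k) :
    rainbowNumber (G.sum H) k = rainbowNumber G k + rainbowNumber H k := by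
  apply le_antisymm
  · obtain ⟨f, hf, hc⟩ := exists_cost_eq_rainbowNumber G hk
    obtain ⟨g, hg, hd⟩ := exists_cost_eq_rainbowNumber H hk
    have := rainbowNumber_le (isRainbow_sum.2
      (⟨hf, hg⟩ : IsRainbow G (fun x => Sum.elim f g (.inl x)) ∧
        IsRainbow H fun x => Sum.elim f g (.inr x)))
    rw [← hc, ← hd]
    simpa [cost_sum] using this
  · obtain ⟨f, hf, hc⟩ := exists_cost_eq_rainbowNumber (G.sum H) hk
    rw [← hc, cost_sum]
    obtain ⟨h1, h2⟩ := isRainbow_sum.1 hf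
    exact add_le_add (rainbowNumber_le h1) (rainbowNumber_le h2)

/-- As `RMinus` is at least `k`, the minimum of `RPlus` and `RMinus` on one side equals the maximum
of `k` and the rainbow number of that side. So the order and the rainbow number are all that has to
be stored at a node. -/
theorem rainbowNumber_join [Nonempty V] [Nonempty W] (G : SimpleGraph V) (H : SimpleGraph W)
    (hk : 1 ≤ k) :
    rainbowNumber (join G H) k = min (Fintype.card V + Fintype.card W)
      (min (2 * k) (max k (min (rainbowNumber G k) (rainbowNumber H k)))) := by
  have h : ((rainbowNumber (join G H) k : ℕ) : ℕ∞) = _ := rainbowNumber_eq_min (join G H) hk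
  rw [RMinus_join G H hk, RPlus_eq G hk, RPlus_eq H hk] at h
  have hG := rainbowNumber_eq_min G hk
  have hH := rainbowNumber_eq_min H hk
  have hG' := le_RMinus G k
  have hH' := le_RMinus H k
  have key : ((rainbowNumber (join G H) k : ℕ) : ℕ∞) =
      ((min (Fintype.card V + Fintype.card W)
      (min (2 * k) (max k (min (rainbowNumber G k) (rainbowNumber H k)))) : ℕ) : ℕ∞) := by
    rw [h]
    simp only [(Nat.mono_cast (α := ℕ∞)).map_min, (Nat.mono_cast (α := ℕ∞)).map_max, hG, hH,
      Fintype.card_sum, Nat.cast_add, Nat.cast_mul, Nat.cast_ofNat]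
    congr 1
    generalize RMinus G k = a at *
    generalize RMinus H k = b at *
    rw [max_min_distrib_left, max_min_distrib_left, max_min_distrib_left, max_eq_right hG',
      max_eq_right hH', max_comm (k : ℕ∞), max_comm (k : ℕ∞)]
    ac_rfl
  exact_mod_cast key

end Rainbow

end RainbowDom

/-! ### Cotrees, given by parent functions -/

namespace Cotree

/-- The children of `p` in the rooted tree with root `r`, set of nodes `N` and parent function
`par`. -/
def kids (r : ℕ) (N : Finset ℕ) (par : ℕ → ℕ) (p : ℕ) : Finset ℕ :=
  N.filter fun c => c ≠ r ∧ par c = p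

theorem mem_kids {r : ℕ} {N : Finset ℕ} {par : ℕ → ℕ} {p c : ℕ} :
    c ∈ kids r N par p ↔ c ∈ N ∧ c ≠ r ∧ par c = p := by
  simp [kids]

/-- A cotree of the subgraph of `G` that is induced by the set `V` of leaves.  The parallel nodes
have `ser p = 0` and the series nodes `ser p = 1`; `L p` is the set of leaves below `p`.  The
root is parallel.  The kind of a node differs from the kind of its parent, except
possibly at the node `e`. -/
structure IsCotree (G : SimpleGraph ℕ) (r : ℕ) (N V : Finset ℕ) (par ser : ℕ → ℕ)
    (L : ℕ → Finset ℕ) (e : ℕ) : Prop where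
  root_mem : r ∈ N
  root_notMem : r ∉ V
  leaf_mem : ∀ v ∈ V, v ∈ N
  ser_root : ser r = 0
  par_root : par r = r
  ser_le : ∀ p ∈ N, p ∉ V → ser p ≤ 1
  par_mem : ∀ c ∈ N, par c ∈ N
  par_notMem : ∀ c ∈ N, par c ∉ V
  two_le : ∀ p ∈ N, p ∉ V → 2 ≤ (kids r N par p).card
  L_leaf : ∀ v ∈ V, L v = {v}
  mem_L : ∀ p ∈ N, p ∉ V → ∀ y, y ∈ L p ↔ ∃ c ∈ kids r N par p, y ∈ L c
  nonempty : ∀ p ∈ N, (L p).Nonempty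
  disj : ∀ p ∈ N, ∀ c ∈ kids r N par p, ∀ d ∈ kids r N par p, c ≠ d →
    ∀ y ∈ L c, y ∉ L d
  adj : ∀ p ∈ N, ∀ c ∈ kids r N par p, ∀ d ∈ kids r N par p, c ≠ d →
    ∀ y ∈ L c, ∀ z ∈ L d, (G.Adj y z ↔ ser p = 1)
  alt : ∀ c ∈ N, c ∉ V → c ≠ r → c ≠ e → ser (par c) + ser c = 1

namespace IsCotree

variable {G : SimpleGraph ℕ} {r : ℕ} {N V : Finset ℕ} {par ser : ℕ → ℕ} {L : ℕ → Finset ℕ}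
  {e : ℕ}

theorem mem_kids_par (_T : IsCotree G r N V par ser L e) {c : ℕ} (hc : c ∈ N) (hr : c ≠ r) :
    c ∈ kids r N par (par c) :=
  mem_kids.2 ⟨hc, hr, rfl⟩

theorem subset_par (T : IsCotree G r N V par ser L e) {c : ℕ} (hc : c ∈ N) :
    L c ⊆ L (par c) := by
  by_cases hr : c = r
  · rw [hr, T.par_root]
  · intro y hy
    exact (T.mem_L _ (T.par_mem c hc) (T.par_notMem c hc) y).2 ⟨c, T.mem_kids_par hc hr, hy⟩

theorem notMem_of_mem_kids (T : IsCotree G r N V par ser L e) {p c : ℕ}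
    (hc : c ∈ kids r N par p) : p ∈ N ∧ p ∉ V := by
  obtain ⟨h1, -, rfl⟩ := mem_kids.1 hc
  exact ⟨T.par_mem c h1, T.par_notMem c h1⟩

theorem subset_of_mem_kids (T : IsCotree G r N V par ser L e) {p c : ℕ}
    (hc : c ∈ kids r N par p) : L c ⊆ L p := by
  obtain ⟨h1, -, rfl⟩ := mem_kids.1 hc
  exact T.subset_par h1

theorem exists_other_kid (T : IsCotree G r N V par ser L e) {p : ℕ} (hp : p ∈ N) (hV : p ∉ V)
    (c : ℕ) : ∃ d ∈ kids r N par p, d ≠ c :=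
  Finset.exists_mem_ne (T.two_le p hp hV) c

theorem not_subset_of_mem_kids (T : IsCotree G r N V par ser L e) {p c : ℕ}
    (hc : c ∈ kids r N par p) : ¬ L p ⊆ L c := by
  intro h
  obtain ⟨hp, hV⟩ := T.notMem_of_mem_kids hc
  obtain ⟨d, hd, hne⟩ := T.exists_other_kid hp hV c
  obtain ⟨y, hy⟩ := T.nonempty d (mem_kids.1 hd).1
  exact T.disj p hp d hd c hc hne y hy (h (T.subset_of_mem_kids hd hy))

/-- Acyclicity of `par` is not an axiom of `IsCotree`; the strict growth of the leaf sets replaces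
it and is the measure for inductions along the tree. -/
theorem card_lt_of_mem_kids (T : IsCotree G r N V par ser L e) {p c : ℕ}
    (hc : c ∈ kids r N par p) : (L c).card < (L p).card :=
  Finset.card_lt_card ⟨T.subset_of_mem_kids hc, T.not_subset_of_mem_kids hc⟩

theorem kids_induction (T : IsCotree G r N V par ser L e) {P : ℕ → Prop}
    (hl : ∀ v ∈ V, P v)
    (hi : ∀ p ∈ N, p ∉ V → (∀ c ∈ kids r N par p, P c) → P p) : ∀ p ∈ N, P p := by
  have : ∀ m, ∀ p ∈ N, (L p).card = m → P p := by
    intro m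
    induction m using Nat.strong_induction_on with
    | _ m ih =>
      rintro p hp rfl
      by_cases hV : p ∈ V
      · exact hl p hV
      · exact hi p hp hV fun c hc => ih _ (T.card_lt_of_mem_kids hc) c (mem_kids.1 hc).1 rfl
  exact fun p hp => this _ p hp rfl

theorem subset_leaves (T : IsCotree G r N V par ser L e) : ∀ p ∈ N, L p ⊆ V := by
  refine T.kids_induction (fun v hv => by rw [T.L_leaf v hv]; simpa using hv) fun p hp hV ih y hy => ?_
  obtain ⟨c, hc, hy⟩ := (T.mem_L p hp hV y).1 hy
  exact ih c hc hy

theorem subset_iterate (T : IsCotree G r N V par ser L e) {c : ℕ} (hc : c ∈ N) (i : ℕ) :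
    par^[i] c ∈ N ∧ L c ⊆ L (par^[i] c) := by
  induction i with
  | zero => exact ⟨hc, subset_rfl⟩
  | succ i ih =>
    rw [Function.iterate_succ_apply']
    exact ⟨T.par_mem _ ih.1, ih.2.trans (T.subset_par ih.1)⟩

theorem exists_iterate_of_mem (T : IsCotree G r N V par ser L e) {y : ℕ} :
    ∀ p ∈ N, y ∈ L p → ∃ i, par^[i] y = p := by
  refine T.kids_induction (fun v hv hy => ⟨0, ?_⟩) fun p hp hV ih hy => ?_
  · rw [T.L_leaf v hv] at hy
    simpa using hy
  · obtain ⟨c, hc, hy⟩ := (T.mem_L p hp hV y).1 hy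
    obtain ⟨i, hi⟩ := ih c hc hy
    refine ⟨i + 1, ?_⟩
    rw [Function.iterate_succ_apply', hi]
    exact (mem_kids.1 hc).2.2

/-- Both nodes lie on the sequence of iterated parents of the common leaf `y`. -/
theorem laminar (T : IsCotree G r N V par ser L e) {p q y : ℕ} (hp : p ∈ N) (hq : q ∈ N)
    (hyp : y ∈ L p) (hyq : y ∈ L q) : (∃ i, par^[i] p = q) ∨ ∃ i, par^[i] q = p := by
  obtain ⟨i, rfl⟩ := T.exists_iterate_of_mem p hp hyp
  obtain ⟨j, rfl⟩ := T.exists_iterate_of_mem q hq hyq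
  rcases le_total i j with h | h
  · left
    refine ⟨j - i, ?_⟩
    rw [← Function.iterate_add_apply, Nat.sub_add_cancel h]
  · right
    refine ⟨i - j, ?_⟩
    rw [← Function.iterate_add_apply, Nat.sub_add_cancel h]

theorem eq_of_iterate_of_subset (T : IsCotree G r N V par ser L e) {c : ℕ} (hc : c ∈ N) (i : ℕ)
    (h : L (par^[i] c) ⊆ L c) : par^[i] c = c := by
  induction i with
  | zero => rfl
  | succ i ih =>
    rw [Function.iterate_succ_apply'] at h ⊢
    obtain ⟨h1, h2⟩ := T.subset_iterate hc i
    have h3 := ih ((T.subset_par h1).trans h)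
    rw [h3] at h ⊢
    by_cases hr : c = r
    · rw [hr, T.par_root]
    · exact absurd h (T.not_subset_of_mem_kids (T.mem_kids_par hc hr))

theorem exists_iterate_of_subset (T : IsCotree G r N V par ser L e) {p t : ℕ} (hp : p ∈ N)
    (ht : t ∈ N) (h : L t ⊆ L p) : ∃ i, par^[i] t = p := by
  obtain ⟨y, hy⟩ := T.nonempty t ht
  obtain hi | ⟨i, rfl⟩ := T.laminar ht hp hy (h hy)
  · exact hi
  · exact ⟨0, T.eq_of_iterate_of_subset hp i h⟩

theorem eq_or_exists_kid (T : IsCotree G r N V par ser L e) {p t : ℕ} (hp : p ∈ N)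
    (ht : t ∈ N) (h : L t ⊆ L p) : t = p ∨ ∃ c ∈ kids r N par p, L t ⊆ L c := by
  obtain ⟨i, hi⟩ := T.exists_iterate_of_subset hp ht h
  clear h
  induction i with
  | zero => exact .inl hi
  | succ i ih =>
    rw [Function.iterate_succ_apply'] at hi
    obtain ⟨h1, h2⟩ := T.subset_iterate ht i
    by_cases hr : par^[i] t = r
    · rw [hr, T.par_root] at hi
      exact ih (hr.trans hi)
    · exact .inr ⟨_, hi ▸ T.mem_kids_par h1 hr, h2⟩

theorem mem_kids_unique (T : IsCotree G r N V par ser L e) {p c d y : ℕ}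
    (hc : c ∈ kids r N par p) (hd : d ∈ kids r N par p) (hyc : y ∈ L c) (hyd : y ∈ L d) :
    c = d := by
  by_contra hne
  exact T.disj p (T.notMem_of_mem_kids hc).1 c hc d hd hne y hyc hyd

theorem subset_kids_unique (T : IsCotree G r N V par ser L e) {p c d t : ℕ} (ht : t ∈ N)
    (hc : c ∈ kids r N par p) (hd : d ∈ kids r N par p) (hyc : L t ⊆ L c) (hyd : L t ⊆ L d) :
    c = d := by
  obtain ⟨y, hy⟩ := T.nonempty t ht
  exact T.mem_kids_unique hc hd (hyc hy) (hyd hy)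

theorem eq_of_subset_of_subset (T : IsCotree G r N V par ser L e) {p t : ℕ} (hp : p ∈ N)
    (ht : t ∈ N) (h : L t ⊆ L p) (h' : L p ⊆ L t) : t = p := by
  obtain rfl | ⟨c, hc, hs⟩ := T.eq_or_exists_kid hp ht h
  · rfl
  · exact absurd (h'.trans hs) (T.not_subset_of_mem_kids hc)

/-- Going to the parent enlarges the leaf set strictly, which is possible only finitely often inside
`V`; the ascent stops only at the root. -/
theorem subset_root (T : IsCotree G r N V par ser L e) {p : ℕ} (hp : p ∈ N) : L p ⊆ L r := by
  have : ∀ m, ∀ p ∈ N, V.card - (L p).card = m → L p ⊆ L r := by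
    intro m
    induction m using Nat.strong_induction_on with
    | _ m ih =>
      rintro p hp rfl
      by_cases hr : p = r
      · rw [hr]
      · have h1 := T.card_lt_of_mem_kids (T.mem_kids_par hp hr)
        have h2 := Finset.card_le_card (T.subset_leaves _ (T.par_mem p hp))
        exact (T.subset_par hp).trans (ih _ (by omega) _ (T.par_mem p hp) rfl)
  exact this _ p hp rfl

theorem L_root (T : IsCotree G r N V par ser L e) : L r = V := by
  refine (T.subset_leaves r T.root_mem).antisymm fun v hv => ?_
  exact T.subset_root (T.leaf_mem v hv) (by simp [T.L_leaf v hv])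

/-- A node that contains two children of `u` contains `u`. -/
theorem subset_of_two_kids (T : IsCotree G r N V par ser L e) {u a b q : ℕ} (hq : q ∈ N)
    (ha : a ∈ kids r N par u) (hb : b ∈ kids r N par u) (hab : a ≠ b) (h1 : L a ⊆ L q)
    (h2 : L b ⊆ L q) : L u ⊆ L q := by
  obtain ⟨haN, har, hau⟩ := mem_kids.1 ha
  obtain ⟨i, hi⟩ := T.exists_iterate_of_subset hq haN h1
  obtain _ | i := i
  · exfalso
    have hi : a = q := hi
    subst hi
    exact hab (T.subset_kids_unique (mem_kids.1 hb).1 ha hb h2 subset_rfl)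
  · rw [Function.iterate_succ_apply, hau] at hi
    exact hi ▸ (T.subset_iterate (T.notMem_of_mem_kids ha).1 i).2

end IsCotree

end Cotree

/-! ### A new leaf below an inner node. -/

namespace Cotree

/-- The new vertex `x` is adjacent to the leaves that leave the path from `t` to the root at a
series node, and to no leaf that leaves it at a parallel node. -/
def Fits (G : SimpleGraph ℕ) (r : ℕ) (N : Finset ℕ) (par ser : ℕ → ℕ) (L : ℕ → Finset ℕ)
    (x t : ℕ) : Prop :=
  ∀ p ∈ N, ∀ c ∈ kids r N par p, L t ⊆ L c → ∀ d ∈ kids r N par p, d ≠ c →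
    ∀ z ∈ L d, (G.Adj x z ↔ ser p = 1)

variable {G : SimpleGraph ℕ} {r : ℕ} {N V : Finset ℕ} {par ser : ℕ → ℕ} {L : ℕ → Finset ℕ}
  {e x t : ℕ}

theorem kids_attach (hx : x ∉ N) (hr : x ≠ r) (p : ℕ) :
    kids r (insert x N) (Function.update par x t) p =
      if p = t then insert x (kids r N par p) else kids r N par p := by
  ext c
  split_ifs with h <;> simp only [mem_kids, Finset.mem_insert, Function.update_apply] <;> grind

namespace IsCotree

/-- `Fits` prescribes the adjacencies of `x` off the path from `t` to the root, and `hadj` those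
below `t`; together these are exactly the conditions that a new child `x` of `t` has to meet. -/
theorem attach (T : IsCotree G r N V par ser L e) (hx : x ∉ N) (ht : t ∈ N) (htV : t ∉ V)
    (hf : Fits G r N par ser L x t) (hadj : ∀ z ∈ L t, (G.Adj x z ↔ ser t = 1)) :
    ∃ L', IsCotree G r (insert x N) (insert x V) (Function.update par x t) ser L' e := by
  have hr : x ≠ r := fun h => hx (h ▸ T.root_mem)
  have hxV : x ∉ V := fun h => hx (T.leaf_mem x h)
  have hxL : ∀ p ∈ N, x ∉ L p := fun p hp h => hxV (T.subset_leaves p hp h)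
  -- The nodes whose leaf set contains that of `t` are `t` and its ancestors, and these gain the
  -- leaf `x`.
  let L' : ℕ → Finset ℕ := fun a => if a = x then {x} else if L t ⊆ L a then insert x (L a) else L a
  have hL' : ∀ a ∈ N, ∀ y, y ∈ L' a ↔ y ∈ L a ∨ (y = x ∧ L t ⊆ L a) := by
    intro a ha y
    have : a ≠ x := fun h => hx (h ▸ ha)
    simp only [L', if_neg this]
    split_ifs with h <;> simp [h, or_comm]
  have hL'x : ∀ y, y ∈ L' x ↔ y = x := by simp [L']
  have hN : ∀ {p c}, c ∈ kids r N par p → c ∈ N := fun h => (mem_kids.1 h).1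
  have hk := fun p => kids_attach (par := par) (t := t) hx hr p
  have hkt : ∀ c ∈ kids r N par t, ¬ L t ⊆ L c := fun c => T.not_subset_of_mem_kids
  refine ⟨L', ?_⟩
  constructor
  · exact Finset.mem_insert_of_mem T.root_mem
  · simp [hr.symm, T.root_notMem]
  · exact fun v hv => Finset.insert_subset_insert _ T.leaf_mem hv
  · exact T.ser_root
  · rw [Function.update_of_ne hr.symm, T.par_root]
  · intro p hp hpV
    exact T.ser_le p (by grind) (by grind)
  · intro c hc
    have := T.par_mem c
    grind
  · intro c hc
    have := T.par_notMem c
    have h2 := T.par_mem c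
    grind
  · intro p hp hpV
    have h1 := T.two_le p (by grind) (by grind)
    rw [hk]
    split_ifs
    · exact h1.trans (Finset.card_le_card (Finset.subset_insert _ _))
    · exact h1
  · intro v hv
    ext y
    rcases eq_or_ne v x with rfl | hvx
    · simp [hL'x]
    · have hvV : v ∈ V := by grind
      rw [hL' v (T.leaf_mem v hvV), T.L_leaf v hvV]
      simp only [Finset.mem_singleton, or_iff_left_iff_imp]
      rintro ⟨-, h⟩
      rw [← T.L_leaf v hvV] at h
      obtain rfl | ⟨c, hc, -⟩ := T.eq_or_exists_kid (T.leaf_mem v hvV) ht h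
      · exact absurd hvV htV
      · exact absurd hvV (T.notMem_of_mem_kids hc).2
  · intro p hp hpV y
    have hpx : p ≠ x := by grind
    have hpN : p ∈ N := by grind
    have hpV' : p ∉ V := by grind
    rw [hk, hL' p hpN, T.mem_L p hpN hpV']
    constructor
    · rintro (⟨c, hc, hy⟩ | ⟨rfl, h⟩)
      · exact ⟨c, by split_ifs <;> simp [hc], (hL' c (hN hc) y).2 (.inl hy)⟩
      · obtain rfl | ⟨c, hc, hs⟩ := T.eq_or_exists_kid hpN ht h
        · exact ⟨y, by simp, by simp [hL'x]⟩
        · exact ⟨c, by split_ifs <;> simp [hc], (hL' c (hN hc) y).2 (.inr ⟨rfl, hs⟩)⟩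
    · rintro ⟨c, hc, hy⟩
      have hc' : (p = t ∧ c = x) ∨ c ∈ kids r N par p := by grind
      obtain ⟨rfl, rfl⟩ | hc' := hc'
      · exact .inr ⟨by simpa [hL'x] using hy, subset_rfl⟩
      · obtain hy | ⟨hyx, hs⟩ := (hL' c (hN hc') y).1 hy
        · exact .inl ⟨c, hc', hy⟩
        · exact .inr ⟨hyx, hs.trans (T.subset_of_mem_kids hc')⟩
  · intro p hp
    rcases eq_or_ne p x with rfl | hpx
    · exact ⟨p, by simp [hL'x]⟩
    · obtain ⟨y, hy⟩ := T.nonempty p (by grind)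
      exact ⟨y, (hL' p (by grind) y).2 (.inl hy)⟩
  · intro p hp c hc d hd hne y hyc hyd
    have hc' : (p = t ∧ c = x) ∨ c ∈ kids r N par p := by rw [hk] at hc; grind
    have hd' : (p = t ∧ d = x) ∨ d ∈ kids r N par p := by rw [hk] at hd; grind
    obtain ⟨rfl, rfl⟩ | hc' := hc'
    · obtain ⟨-, rfl⟩ | hd' := hd'
      · exact hne rfl
      · have := hL' d (hN hd') y
        have := hL'x y
        have := hkt d hd'
        have := hxL d (hN hd')
        grind
    · obtain ⟨rfl, rfl⟩ | hd' := hd'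
      · have := hL' c (hN hc') y
        have := hL'x y
        have := hkt c hc'
        have := hxL c (hN hc')
        grind
      · have h1 := hL' c (hN hc') y
        have h2 := hL' d (hN hd') y
        have h3 := T.subset_kids_unique ht hc' hd'
        have h4 := T.mem_kids_unique (y := y) hc' hd'
        have := hxL c (hN hc')
        have := hxL d (hN hd')
        grind
  -- Only the adjacencies of `x` are new, and by symmetry `x` may be taken below `c`.
  · have key : ∀ p, ∀ c ∈ kids r (insert x N) (Function.update par x t) p,
        ∀ d ∈ kids r (insert x N) (Function.update par x t) p, c ≠ d →
        ∀ z ∈ L' d, x ∈ L' c → (G.Adj x z ↔ ser p = 1) := by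
      intro p c hc d hd hne z hz hxc
      have hc' : (p = t ∧ c = x) ∨ c ∈ kids r N par p := by rw [hk] at hc; grind
      have hd' : (p = t ∧ d = x) ∨ d ∈ kids r N par p := by rw [hk] at hd; grind
      obtain ⟨rfl, rfl⟩ | hc' := hc'
      · obtain ⟨-, rfl⟩ | hd' := hd'
        · exact absurd rfl hne
        · obtain hz | ⟨-, hz⟩ := (hL' d (hN hd') z).1 hz
          · exact hadj z (T.subset_of_mem_kids hd' hz)
          · exact absurd hz (hkt d hd')
      · have hs : L t ⊆ L c := by
          obtain h | h := (hL' c (hN hc') x).1 hxc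
          · exact absurd h (hxL c (hN hc'))
          · exact h.2
        obtain ⟨rfl, rfl⟩ | hd' := hd'
        · exact absurd hs (hkt c hc')
        · obtain hz | ⟨-, hz⟩ := (hL' d (hN hd') z).1 hz
          · exact hf p (T.notMem_of_mem_kids hc').1 c hc' hs d hd' (Ne.symm hne) z hz
          · exact absurd (T.subset_kids_unique ht hc' hd' hs hz) hne
    intro p hp c hc d hd hne y hy z hz
    rcases eq_or_ne y x with rfl | hyx
    · exact key p c hc d hd hne z hz hy
    rcases eq_or_ne z x with rfl | hzx
    · rw [G.adj_comm]
      exact key p d hd c hc (Ne.symm hne) y hy hz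
    · have hc' : c ∈ kids r N par p := by
        have := hL'x y
        rw [hk] at hc; grind
      have hd' : d ∈ kids r N par p := by
        have := hL'x z
        rw [hk] at hd; grind
      refine T.adj p (T.notMem_of_mem_kids hc').1 c hc' d hd' hne y ?_ z ?_
      · have := hL' c (hN hc') y
        grind
      · have := hL' d (hN hd') z
        grind
  · intro c hc hcV hcr hce
    have := T.alt c (by grind) (by grind) hcr hce
    have : c ≠ x := by grind
    rwa [Function.update_of_ne this]

end IsCotree

end Cotree

/-! ### A new inner node above a given node. -/

namespace Cotree

variable {G : SimpleGraph ℕ} {r : ℕ} {N V : Finset ℕ} {par ser : ℕ → ℕ} {L : ℕ → Finset ℕ}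
  {e x t s κ : ℕ}

/-- The parent function after the insertion of a new node `s` with the children `t` and `x` at the
position of `t`. -/
def parAbove (par : ℕ → ℕ) (t s x : ℕ) : ℕ → ℕ :=
  Function.update (Function.update (Function.update par s (par t)) t s) x s

theorem kids_above (hx : x ∉ N) (hs : s ∉ N) (hsx : s ≠ x) (hr : r ∈ N) (htN : t ∈ N) (htr : t ≠ r)
    (hp : ∀ c ∈ N, par c ∈ N) (p : ℕ) :
    kids r (insert s (insert x N)) (parAbove par t s x) p =
      if p = s then {t, x} else
        if p = par t then insert s ((kids r N par p).erase t) else kids r N par p := by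
  ext c
  have := hp t htN
  have := hp c
  split_ifs with h h' <;>
    simp only [mem_kids, Finset.mem_insert, Finset.mem_erase, Finset.mem_singleton, parAbove,
      Function.update_apply] <;> grind

namespace IsCotree

/-- The new node `s` takes the position of `t`. If the alternation of kinds failed at `t`, then `s`,
whose kind differs from both neighbors, repairs it; the exceptional node `r` of the result means no
exception, since nothing is required at the root anyway. -/
theorem above (T : IsCotree G r N V par ser L e) (hx : x ∉ N) (hs : s ∉ N) (hsx : s ≠ x)
    (ht : t ∈ N) (htr : t ≠ r)
    (hf : Fits G r N par ser L x t) (hκ : κ ≤ 1) (hadj : ∀ z ∈ L t, (G.Adj x z ↔ κ = 1))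
    (hpar : ser (par t) + κ = 1) (hser : t ∉ V → κ + ser t = 1) (he : e = r ∨ e = t) :
    ∃ L', IsCotree G r (insert s (insert x N)) (insert x V) (parAbove par t s x)
      (Function.update ser s κ) L' r := by
  have hr : x ≠ r := fun h => hx (h ▸ T.root_mem)
  have hsr : s ≠ r := fun h => hs (h ▸ T.root_mem)
  have hxV : x ∉ V := fun h => hx (T.leaf_mem x h)
  have hsV : s ∉ V := fun h => hs (T.leaf_mem s h)
  have hxL : ∀ p ∈ N, x ∉ L p := fun p hp h => hxV (T.subset_leaves p hp h)
  have hts : t ≠ s := fun h => hs (h ▸ ht)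
  have htx : t ≠ x := fun h => hx (h ▸ ht)
  -- Outside of `s`, the child `s` plays the former role of `t`; `o` translates new children into
  -- old ones.
  let o : ℕ → ℕ := fun c => if c = s then t else c
  -- The node `t` is exempt: `x` becomes its sibling and is a leaf only of `s` and the nodes above.
  let L' : ℕ → Finset ℕ := fun a => if a = x then {x} else
    if a ≠ t ∧ L t ⊆ L (o a) then insert x (L (o a)) else L (o a)
  have hL' : ∀ a, a ≠ t → a ≠ x → ∀ y, y ∈ L' a ↔ y ∈ L (o a) ∨ (y = x ∧ L t ⊆ L (o a)) := by
    intro a hat hax y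
    simp only [L', if_neg hax]
    split_ifs with h
    · simp [h, or_comm]
    · have : ¬ L t ⊆ L (o a) := fun h' => h ⟨hat, h'⟩
      simp [this]
  have hos : o s = t := by simp [o]
  have ho : ∀ a, a ≠ s → o a = a := fun a h => by simp [o, h]
  have hL't : ∀ y, y ∈ L' t ↔ y ∈ L t := by simp [L', htx, ho t hts]
  have hL'x : ∀ y, y ∈ L' x ↔ y = x := by simp [L']
  have hN : ∀ {p c}, c ∈ kids r N par p → c ∈ N := fun h => (mem_kids.1 h).1
  have hk := fun p => kids_above (p := p) hx hs hsx T.root_mem ht htr T.par_mem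
  have hkt : ∀ c ∈ kids r N par t, ¬ L t ⊆ L c := fun c => T.not_subset_of_mem_kids
  have hpt := T.mem_kids_par ht htr
  have hptN := T.par_mem t ht
  have hptV := T.par_notMem t ht
  have hkid : ∀ p, p ≠ s → ∀ c ∈ kids r (insert s (insert x N)) (parAbove par t s x) p,
      o c ∈ kids r N par p ∧ c ≠ t ∧ c ≠ x := by
    intro p hps c hc
    have := @hN p c
    have := (@mem_kids r N par p t).1
    rw [hk, if_neg hps] at hc
    grind
  have hinj : ∀ p, p ≠ s → ∀ c ∈ kids r (insert s (insert x N)) (parAbove par t s x) p,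
      ∀ d ∈ kids r (insert s (insert x N)) (parAbove par t s x) p, o c = o d → c = d := by
    intro p hps c hc d hd h
    have := hkid p hps c hc
    have := hkid p hps d hd
    grind
  have hsurj : ∀ p, p ≠ s → ∀ c ∈ kids r N par p,
      ∃ d ∈ kids r (insert s (insert x N)) (parAbove par t s x) p, o d = c := by
    intro p hps c hc
    have hcN := hN hc
    have := (mem_kids.1 hc).2.2
    by_cases hct : c = t
    · refine ⟨s, ?_, by rw [hos, hct]⟩
      rw [hk]
      grind
    · refine ⟨c, ?_, ho c (by grind)⟩
      rw [hk]
      grind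
  refine ⟨L', ?_⟩
  constructor
  · simp [T.root_mem]
  · simp [hr.symm, T.root_notMem]
  · intro v hv
    have := T.leaf_mem v
    grind
  · rw [Function.update_of_ne hsr.symm, T.ser_root]
  · have := T.par_root
    simp only [parAbove, Function.update_apply]
    grind
  · intro p hp hpV
    have := T.ser_le p
    simp only [Function.update_apply]
    grind
  · intro c hc
    have := T.par_mem c
    simp only [parAbove, Function.update_apply]
    grind
  · intro c hc
    have := T.par_notMem c
    have h2 := T.par_mem c
    simp only [parAbove, Function.update_apply]
    grind
  · intro p hp hpV
    rw [hk]
    split_ifs with h1 h2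
    · rw [Finset.card_pair htx]
    · have h1 := T.two_le p (by grind) (by grind)
      rw [Finset.card_insert_of_notMem (by intro h; exact hs (hN (Finset.mem_of_mem_erase h))),
        Finset.card_erase_of_mem (h2 ▸ hpt)]
      omega
    · exact T.two_le p (by grind) (by grind)
  · intro v hv
    ext y
    rcases eq_or_ne v x with rfl | hvx
    · simp [hL'x]
    · have hvV : v ∈ V := by grind
      have hvs : v ≠ s := by grind
      rcases eq_or_ne v t with rfl | hvt
      · rw [hL't, T.L_leaf v hvV]
      rw [hL' v hvt hvx, ho v hvs, T.L_leaf v hvV]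
      simp only [Finset.mem_singleton, or_iff_left_iff_imp]
      rintro ⟨-, h⟩
      rw [← T.L_leaf v hvV] at h
      obtain rfl | ⟨c, hc, -⟩ := T.eq_or_exists_kid (T.leaf_mem v hvV) ht h
      · exact absurd rfl hvt
      · exact absurd hvV (T.notMem_of_mem_kids hc).2
  · intro p hp hpV y
    have hpx : p ≠ x := by grind
    rcases eq_or_ne p s with rfl | hps
    · rw [hk, if_pos rfl, hL' p hts.symm hpx, hos]
      simp [hL't, hL'x]
    have hpN : p ∈ N := by grind
    have hpV' : p ∉ V := by grind
    have hC : (∃ c ∈ kids r (insert s (insert x N)) (parAbove par t s x) p, y ∈ L' c) ↔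
        y ∈ L p ∨ (y = x ∧ ∃ c ∈ kids r N par p, L t ⊆ L c) := by
      rw [T.mem_L p hpN hpV']
      constructor
      · rintro ⟨c, hc, hy⟩
        obtain ⟨h1, h2, h3⟩ := hkid p hps c hc
        obtain h | ⟨h, h'⟩ := (hL' c h2 h3 y).1 hy
        · exact .inl ⟨_, h1, h⟩
        · exact .inr ⟨h, _, h1, h'⟩
      · rintro (⟨c, hc, hy⟩ | ⟨hy, c, hc, hs⟩)
        · obtain ⟨d, hd, rfl⟩ := hsurj p hps c hc
          obtain ⟨h1, h2, h3⟩ := hkid p hps d hd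
          exact ⟨d, hd, (hL' d h2 h3 y).2 (.inl hy)⟩
        · obtain ⟨d, hd, rfl⟩ := hsurj p hps c hc
          obtain ⟨h1, h2, h3⟩ := hkid p hps d hd
          exact ⟨d, hd, (hL' d h2 h3 y).2 (.inr ⟨hy, hs⟩)⟩
    rw [hC]
    rcases eq_or_ne p t with rfl | hpt
    · rw [hL't]
      constructor
      · exact .inl
      · rintro (h | ⟨-, c, hc, h⟩)
        · exact h
        · exact absurd h (hkt c hc)
    · rw [hL' p hpt hpx, ho p hps]
      have : (∃ c ∈ kids r N par p, L t ⊆ L c) ↔ L t ⊆ L p := by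
        constructor
        · rintro ⟨c, hc, h⟩
          exact h.trans (T.subset_of_mem_kids hc)
        · intro h
          exact (T.eq_or_exists_kid hpN ht h).resolve_left hpt.symm
      rw [this]
  · intro p hp
    rcases eq_or_ne p x with rfl | hpx
    · exact ⟨p, by simp [hL'x]⟩
    rcases eq_or_ne p t with rfl | hpt
    · obtain ⟨y, hy⟩ := T.nonempty p ht
      exact ⟨y, (hL't y).2 hy⟩
    · obtain ⟨y, hy⟩ := T.nonempty (o p) (by grind)
      exact ⟨y, (hL' p hpt hpx y).2 (.inl hy)⟩
  · intro p hp c hc d hd hne y hyc hyd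
    rcases eq_or_ne p s with rfl | hps
    · have := hxL t ht
      have := hL't y
      have := hL'x y
      rw [hk, if_pos rfl] at hc hd
      grind
    · obtain ⟨h1, h2, h3⟩ := hkid p hps c hc
      obtain ⟨k1, k2, k3⟩ := hkid p hps d hd
      have hne' : o c ≠ o d := fun h => hne (hinj p hps c hc d hd h)
      have := (hL' c h2 h3 y).1 hyc
      have := (hL' d k2 k3 y).1 hyd
      have := T.subset_kids_unique ht h1 k1
      have := T.mem_kids_unique (y := y) h1 k1
      have := hxL _ (hN h1)
      have := hxL _ (hN k1)
      grind
  · have key : ∀ p, p ≠ s → ∀ c ∈ kids r (insert s (insert x N)) (parAbove par t s x) p,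
        ∀ d ∈ kids r (insert s (insert x N)) (parAbove par t s x) p, c ≠ d →
        ∀ z ∈ L' d, x ∈ L' c → (G.Adj x z ↔ ser p = 1) := by
      intro p hps c hc d hd hne z hz hxc
      obtain ⟨h1, h2, h3⟩ := hkid p hps c hc
      obtain ⟨k1, k2, k3⟩ := hkid p hps d hd
      have hne' : o c ≠ o d := fun h => hne (hinj p hps c hc d hd h)
      have hs : L t ⊆ L (o c) := by
        obtain h | h := (hL' c h2 h3 x).1 hxc
        · exact absurd h (hxL _ (hN h1))
        · exact h.2
      obtain hz | ⟨-, hz⟩ := (hL' d k2 k3 z).1 hz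
      · exact hf p (T.notMem_of_mem_kids h1).1 _ h1 hs _ k1 hne'.symm z hz
      · exact absurd (T.subset_kids_unique ht h1 k1 hs hz) hne'
    intro p hp c hc d hd hne y hy z hz
    rcases eq_or_ne p s with rfl | hps
    · rw [hk, if_pos rfl] at hc hd
      simp only [Finset.mem_insert, Finset.mem_singleton] at hc hd
      rw [Function.update_self]
      have h3 := G.adj_comm y z
      have h4 := hL't y
      have h5 := hL't z
      have h6 := hL'x y
      have h7 := hL'x z
      have h8 := hadj y
      have h9 := hadj z
      grind
    rw [Function.update_of_ne hps]
    rcases eq_or_ne y x with rfl | hyx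
    · exact key p hps c hc d hd hne z hz hy
    rcases eq_or_ne z x with rfl | hzx
    · rw [G.adj_comm]
      exact key p hps d hd c hc (Ne.symm hne) y hy hz
    · obtain ⟨h1, h2, h3⟩ := hkid p hps c hc
      obtain ⟨k1, k2, k3⟩ := hkid p hps d hd
      have hne' : o c ≠ o d := fun h => hne (hinj p hps c hc d hd h)
      refine T.adj p (T.notMem_of_mem_kids h1).1 _ h1 _ k1 hne' y ?_ z ?_
      · have := (hL' c h2 h3 y).1 hy
        grind
      · have := (hL' d k2 k3 z).1 hz
        grind
  · intro c hc hcV hcr _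
    have := T.alt c
    have := T.par_mem c
    simp only [parAbove, Function.update_apply]
    grind

end IsCotree

end Cotree

/-! ### Splitting off a group of children. -/

namespace Cotree

variable {G : SimpleGraph ℕ} {r : ℕ} {N V X : Finset ℕ} {par ser : ℕ → ℕ} {L : ℕ → Finset ℕ}
  {e x u w : ℕ}

/-- The parent function after the children `X` of `u` have been moved to a new child `w`. -/
def parBelow (par : ℕ → ℕ) (X : Finset ℕ) (u w : ℕ) : ℕ → ℕ :=
  Function.update (fun c => if c ∈ X then w else par c) w u

/-- The parent function after the children `X` of `u` have been moved to a new parent `w` of `u`. -/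
def parOver (par : ℕ → ℕ) (X : Finset ℕ) (u w : ℕ) : ℕ → ℕ :=
  Function.update (Function.update (fun c => if c ∈ X then w else par c) w (par u)) u w

theorem kids_below (hw : w ∉ N) (hr : r ∈ N) (hu : u ∈ N) (hp : ∀ c ∈ N, par c ∈ N)
    (hX : X ⊆ kids r N par u) (q : ℕ) :
    kids r (insert w N) (parBelow par X u w) q =
      if q = w then X else if q = u then insert w (kids r N par u \ X) else kids r N par q := by
  ext c
  have h1 := @hX c
  have h2 := hp c
  rw [mem_kids] at h1
  split_ifs with h h' <;>
    simp only [mem_kids, Finset.mem_insert, Finset.mem_sdiff, parBelow,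
      Function.update_apply] <;> grind

theorem kids_over (hw : w ∉ N) (hr : r ∈ N) (hu : u ∈ N) (hur : u ≠ r)
    (hp : ∀ c ∈ N, par c ∈ N) (hpu : par u ≠ u)
    (hX : X ⊆ kids r N par u) (q : ℕ) :
    kids r (insert w N) (parOver par X u w) q =
      if q = w then insert u X else if q = u then kids r N par u \ X else
        if q = par u then insert w ((kids r N par q).erase u) else kids r N par q := by
  ext c
  have h1 := @hX c
  have h2 := hp c
  have h3 := hp u hu
  rw [mem_kids] at h1
  split_ifs with h h' h'' <;>
    simp only [mem_kids, Finset.mem_insert, Finset.mem_sdiff, Finset.mem_erase, parOver,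
      Function.update_apply] <;> grind

namespace IsCotree

theorem par_ne (T : IsCotree G r N V par ser L e) {c : ℕ} (hc : c ∈ N) (hr : c ≠ r) :
    par c ≠ c := by
  intro h
  have := T.card_lt_of_mem_kids (T.mem_kids_par hc hr)
  rw [h] at this
  exact lt_irrefl _ this

/-- Children of a node may be gathered under a new child of the same kind, since this changes no
adjacency. The alternation then fails at `w`, and `above`, applied at `w`, restores it while it
inserts `x`. The bounds on the size of `X` leave two children for both nodes. -/
theorem groupBelow (T : IsCotree G r N V par ser L r) (hw : w ∉ N) (hu : u ∈ N) (huV : u ∉ V)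
    (hX : X ⊆ kids r N par u) (h2 : 2 ≤ X.card) (hlt : X.card < (kids r N par u).card)
    (hf : Fits G r N par ser L x u)
    (hadj : ∀ d ∈ kids r N par u, d ∉ X → ∀ z ∈ L d, (G.Adj x z ↔ ser u = 1)) :
    ∃ L', IsCotree G r (insert w N) V (parBelow par X u w) (Function.update ser w (ser u)) L' w ∧
      Fits G r (insert w N) (parBelow par X u w) (Function.update ser w (ser u)) L' x w ∧
      ∀ y, y ∈ L' w ↔ ∃ c ∈ X, y ∈ L c := by
  have hwV : w ∉ V := fun h => hw (T.leaf_mem w h)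
  let L' : ℕ → Finset ℕ := Function.update L w (X.biUnion L)
  have hL'w : ∀ y, y ∈ L' w ↔ ∃ c ∈ X, y ∈ L c := by simp [L']
  have hL' : ∀ a, a ≠ w → L' a = L a := fun a h => Function.update_of_ne h _ _
  have hk := fun q => kids_below (q := q) hw T.root_mem hu T.par_mem hX
  have hN : ∀ {p c}, c ∈ kids r N par p → c ≠ w := fun h h' => hw (h' ▸ (mem_kids.1 h).1)
  have hrw : r ≠ w := fun h => hw (h ▸ T.root_mem)
  have huw : u ≠ w := fun h => hw (h ▸ hu)
  have hXd : ∀ d ∈ kids r N par u, d ∉ X → ∀ y, y ∈ L d → y ∉ L' w := by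
    intro d hd hdX y hy hy'
    obtain ⟨c, hc, hyc⟩ := (hL'w y).1 hy'
    exact hdX (T.mem_kids_unique hd (hX hc) hy hyc ▸ hc)
  have hXN : ∀ c ∈ X, c ≠ w := fun c hc => hN (hX hc)
  obtain ⟨a, ha, b, hb, hab⟩ := Finset.one_lt_card.1 h2
  refine ⟨L', ?_, ?_, hL'w⟩
  · constructor
    · simp [T.root_mem]
    · exact T.root_notMem
    · exact fun v hv => Finset.mem_insert_of_mem (T.leaf_mem v hv)
    · rw [Function.update_of_ne hrw, T.ser_root]
    · have := T.par_root
      have h1 := @hX r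
      rw [mem_kids] at h1
      simp only [parBelow, Function.update_apply]
      grind
    · intro p hp hpV
      have := T.ser_le p
      have := T.ser_le u hu huV
      simp only [Function.update_apply]
      grind
    · intro c hc
      have := T.par_mem c
      simp only [parBelow, Function.update_apply]
      grind
    · intro c hc
      have := T.par_notMem c
      simp only [parBelow, Function.update_apply]
      grind
    · intro p hp hpV
      rw [hk]
      split_ifs with h1 h3
      · exact h2
      · rw [Finset.card_insert_of_notMem (fun h => hN (Finset.mem_sdiff.1 h).1 rfl),
          Finset.card_sdiff_of_subset hX]
        omega
      · exact T.two_le p (by grind) hpV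
    · intro v hv
      rw [hL' v (by grind), T.L_leaf v hv]
    · intro p hp hpV y
      rw [hk]
      split_ifs with h1 h3
      · rw [h1, hL'w]
        exact exists_congr fun c => and_congr_right fun hc => by rw [hL' c (hXN c hc)]
      · rw [hL' p h1, h3, T.mem_L u hu huV]
        constructor
        · rintro ⟨c, hc, hy⟩
          by_cases hcX : c ∈ X
          · exact ⟨w, by simp, (hL'w y).2 ⟨c, hcX, hy⟩⟩
          · exact ⟨c, by simp [hc, hcX], by rwa [hL' c (hN hc)]⟩
        · rintro ⟨c, hc, hy⟩
          obtain rfl | hc := Finset.mem_insert.1 hc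
          · obtain ⟨d, hd, hy⟩ := (hL'w y).1 hy
            exact ⟨d, hX hd, hy⟩
          · have := (Finset.mem_sdiff.1 hc).1
            exact ⟨c, this, by rwa [hL' c (hN this)] at hy⟩
      · rw [hL' p h1, T.mem_L p (by grind) hpV]
        exact exists_congr fun c => and_congr_right fun hc => by rw [hL' c (hN hc)]
    · intro p hp
      rcases eq_or_ne p w with rfl | hpw
      · obtain ⟨y, hy⟩ := T.nonempty a (mem_kids.1 (hX ha)).1
        exact ⟨y, (hL'w y).2 ⟨a, ha, hy⟩⟩
      · rw [hL' p hpw]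
        exact T.nonempty p (by grind)
    · intro p hp c hc d hd hne y hyc hyd
      rw [hk] at hc hd
      have h1 := hXd c
      have h2 := hXd d
      have h3 := hL' c
      have h4 := hL' d
      have h5 := T.mem_kids_unique (p := p) (c := c) (d := d) (y := y)
      have h6 := T.mem_kids_unique (p := u) (c := c) (d := d) (y := y)
      have := @hX c
      have := @hX d
      have := @hN p c
      have := @hN p d
      have := hXN c
      have := hXN d
      grind
    · intro p hp c hc d hd hne y hy z hz
      rw [hk] at hc hd
      rw [Function.update_apply]
      split_ifs at hc hd with h1 h3
      · rw [if_pos h1]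
        rw [hL' c (hXN c hc)] at hy
        rw [hL' d (hXN d hd)] at hz
        exact T.adj u hu c (hX hc) d (hX hd) hne y hy z hz
      · subst h3
        rw [if_neg h1]
        obtain ⟨c', hc', hyc', hcc⟩ : ∃ c' ∈ kids r N par p, y ∈ L c' ∧
            (c' = c ∨ c' ∈ X ∧ c = w) := by
          obtain rfl | hc := Finset.mem_insert.1 hc
          · obtain ⟨d, hd, hy⟩ := (hL'w y).1 hy
            exact ⟨d, hX hd, hy, .inr ⟨hd, rfl⟩⟩
          · have := (Finset.mem_sdiff.1 hc).1
            exact ⟨c, this, by rwa [hL' c (hN this)] at hy, .inl rfl⟩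
        obtain ⟨d', hd', hzd', hdd⟩ : ∃ d' ∈ kids r N par p, z ∈ L d' ∧
            (d' = d ∨ d' ∈ X ∧ d = w) := by
          obtain rfl | hc := Finset.mem_insert.1 hd
          · obtain ⟨d, hd, hy⟩ := (hL'w z).1 hz
            exact ⟨d, hX hd, hy, .inr ⟨hd, rfl⟩⟩
          · have := (Finset.mem_sdiff.1 hc).1
            exact ⟨d, this, by rwa [hL' d (hN this)] at hz, .inl rfl⟩
        refine T.adj p hu c' hc' d' hd' ?_ y hyc' z hzd'
        grind
      · rw [if_neg h1]
        rw [hL' c (hN hc)] at hy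
        rw [hL' d (hN hd)] at hz
        exact T.adj p (by grind) c hc d hd hne y hy z hz
    · intro c hc hcV hcr hcw
      have h1 := T.alt c (by grind) hcV hcr hcr
      have h3 := T.par_mem c (by grind)
      have h4 := @hX c
      rw [mem_kids] at h4
      simp only [parBelow, Function.update_apply]
      grind
  · intro q hq c hc hs d hd hne z hz
    rw [hk] at hc hd
    rw [Function.update_apply]
    split_ifs at hc hd with h1 h3
    -- The leaves of `w` come from at least two children, so they do not all lie below the single
    -- child `c`.
    · exfalso
      obtain ⟨d, hd, hdc⟩ := Finset.exists_mem_ne h2 c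
      obtain ⟨y, hy⟩ := T.nonempty d (mem_kids.1 (hX hd)).1
      have := hs ((hL'w y).2 ⟨d, hd, hy⟩)
      rw [hL' c (hXN c hc)] at this
      exact hdc (T.mem_kids_unique (hX hd) (hX hc) hy this)
    · subst h3
      rw [if_neg h1]
      obtain rfl | hc := Finset.mem_insert.1 hc
      · have hd' : d ∈ kids r N par q ∧ d ∉ X := by
          have := (Finset.mem_insert.1 hd).resolve_left hne
          simpa using this
        exact hadj d hd'.1 hd'.2 z (by rwa [hL' d (hN hd'.1)] at hz)
      · exfalso
        obtain ⟨hc1, hc2⟩ := Finset.mem_sdiff.1 hc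
        obtain ⟨y, hy⟩ := T.nonempty a (mem_kids.1 (hX ha)).1
        have hyw := (hL'w y).2 ⟨a, ha, hy⟩
        have := hs hyw
        rw [hL' c (hN hc1)] at this
        exact hXd c hc1 hc2 y this hyw
    · rw [if_neg h1]
      rw [hL' c (hN hc)] at hs
      rw [hL' d (hN hd)] at hz
      have hsa : ∀ a ∈ X, L a ⊆ L c := fun a ha y hy => hs ((hL'w y).2 ⟨a, ha, hy⟩)
      exact hf q (by grind) c hc (T.subset_of_two_kids (mem_kids.1 hc).1 (hX ha) (hX hb) hab
        (hsa a ha) (hsa b hb)) d hd hne z hz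

/-- The dual of `groupBelow`: the children outside of `X` are to be separated, but only those in `X`
are available to the program. So `u` keeps the rest, and `X` moves to a new parent `w` of the same
kind. The alternation then fails at `u`, where `above` repairs it. -/
theorem groupOver (T : IsCotree G r N V par ser L r) (hw : w ∉ N) (hu : u ∈ N) (huV : u ∉ V)
    (hur : u ≠ r)
    (hX : X ⊆ kids r N par u) (h1X : X.Nonempty) (hlt : X.card + 2 ≤ (kids r N par u).card)
    (hf : Fits G r N par ser L x u)
    (hadj : ∀ d ∈ X, ∀ z ∈ L d, (G.Adj x z ↔ ser u = 1)) :
    ∃ L', IsCotree G r (insert w N) V (parOver par X u w) (Function.update ser w (ser u)) L' u ∧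
      Fits G r (insert w N) (parOver par X u w) (Function.update ser w (ser u)) L' x u ∧
      ∀ y, y ∈ L' u ↔ ∃ c ∈ kids r N par u \ X, y ∈ L c := by
  have hwV : w ∉ V := fun h => hw (T.leaf_mem w h)
  have huw : u ≠ w := fun h => hw (h ▸ hu)
  let L' : ℕ → Finset ℕ := Function.update (Function.update L w (L u)) u
    ((kids r N par u \ X).biUnion L)
  have hL'u : ∀ y, y ∈ L' u ↔ ∃ c ∈ kids r N par u \ X, y ∈ L c := by
    intro y
    simp only [L', Function.update_self, Finset.mem_biUnion]
  have hL'w : L' w = L u := by simp [L', huw.symm]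
  have hL' : ∀ a, a ≠ w → a ≠ u → L' a = L a := fun a h h' => by
    simp [L', h, h']
  have hk := fun q => kids_over (q := q) hw T.root_mem hu hur T.par_mem (T.par_ne hu hur) hX
  have hN : ∀ {p c}, c ∈ kids r N par p → c ≠ w := fun h h' => hw (h' ▸ (mem_kids.1 h).1)
  have hrw : r ≠ w := fun h => hw (h ▸ T.root_mem)
  have hku : ∀ c ∈ kids r N par u, c ≠ u := by
    rintro c hc rfl
    exact T.not_subset_of_mem_kids hc subset_rfl
  have hpu := T.par_ne hu hur
  have hpuN := T.par_mem u hu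
  have hkpu := T.mem_kids_par hu hur
  have hlt2 : 2 ≤ (kids r N par u \ X).card := by
    rw [Finset.card_sdiff_of_subset hX]
    omega
  have hXd : ∀ d ∈ X, ∀ y ∈ L d, y ∉ L' u := by
    intro d hd y hy hy'
    obtain ⟨c, hc, hyc⟩ := (hL'u y).1 hy'
    obtain ⟨hc, hcX⟩ := Finset.mem_sdiff.1 hc
    exact hcX (T.mem_kids_unique hc (hX hd) hyc hy ▸ hd)
  have hXN : ∀ c ∈ X, c ≠ w := fun c hc => hN (hX hc)
  obtain ⟨a, ha, b, hb, hab⟩ := Finset.one_lt_card.1 hlt2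
  -- the old counterpart of a child
  let o : ℕ → ℕ := fun c => if c = w then u else c
  have hLo : ∀ q, q ≠ w → q ≠ u → ∀ c ∈ kids r (insert w N) (parOver par X u w) q,
      o c ∈ kids r N par q ∧ L' c = L (o c) := by
    intro q hqw hqu c hc
    rw [hk, if_neg hqw, if_neg hqu] at hc
    have h1 := @hN q c
    have h2 := hL' c
    have h3 := @mem_kids r N par q c
    grind
  have hinj : ∀ q, q ≠ w → q ≠ u → ∀ c ∈ kids r (insert w N) (parOver par X u w) q,
      ∀ d ∈ kids r (insert w N) (parOver par X u w) q, o c = o d → c = d := by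
    intro q hqw hqu c hc d hd h
    rw [hk, if_neg hqw, if_neg hqu] at hc hd
    have h1 := @mem_kids r N par q c
    have h2 := @mem_kids r N par q d
    grind
  have hsurj : ∀ q, q ≠ w → q ≠ u → ∀ c ∈ kids r N par q,
      ∃ d ∈ kids r (insert w N) (parOver par X u w) q, o d = c := by
    intro q hqw hqu c hc
    have h1 := @mem_kids r N par q c
    have h2 := hN hc
    by_cases hcu : c = u
    · refine ⟨w, ?_, by simp [o, hcu]⟩
      rw [hk]
      grind
    · refine ⟨c, ?_, by simp [o, h2]⟩
      rw [hk]
      grind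
  refine ⟨L', ?_, ?_, hL'u⟩
  · constructor
    · simp [T.root_mem]
    · exact T.root_notMem
    · exact fun v hv => Finset.mem_insert_of_mem (T.leaf_mem v hv)
    · rw [Function.update_of_ne hrw, T.ser_root]
    · have := T.par_root
      have h1 := @hX r
      rw [mem_kids] at h1
      simp only [parOver, Function.update_apply]
      grind
    · intro p hp hpV
      have := T.ser_le p
      have := T.ser_le u hu huV
      simp only [Function.update_apply]
      grind
    · intro c hc
      have := T.par_mem c
      simp only [parOver, Function.update_apply]
      grind
    · intro c hc
      have := T.par_notMem c
      have := T.par_notMem u hu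
      simp only [parOver, Function.update_apply]
      grind
    · intro p hp hpV
      rw [hk]
      split_ifs with h1 h3 h4
      · rw [Finset.card_insert_of_notMem (fun h => hku u (hX h) rfl)]
        have := h1X.card_pos
        omega
      · exact hlt2
      · rw [Finset.card_insert_of_notMem (fun h => hN (Finset.mem_of_mem_erase h) rfl),
          Finset.card_erase_of_mem (h4 ▸ hkpu)]
        have := T.two_le p (by grind) hpV
        omega
      · exact T.two_le p (by grind) hpV
    · intro v hv
      rw [hL' v (by grind) (by grind), T.L_leaf v hv]
    · intro p hp hpV y
      rcases eq_or_ne p w with rfl | hpw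
      · rw [hk, if_pos rfl, hL'w, T.mem_L u hu huV]
        constructor
        · rintro ⟨c, hc, hy⟩
          by_cases hcX : c ∈ X
          · exact ⟨c, by simp [hcX], by rwa [hL' c (hN hc) (hku c hc)]⟩
          · exact ⟨u, by simp, (hL'u y).2 ⟨c, by simp [hc, hcX], hy⟩⟩
        · rintro ⟨c, hc, hy⟩
          obtain rfl | hc := Finset.mem_insert.1 hc
          · obtain ⟨d, hd, hy⟩ := (hL'u y).1 hy
            exact ⟨d, (Finset.mem_sdiff.1 hd).1, hy⟩
          · exact ⟨c, hX hc, by rwa [hL' c (hXN c hc) (hku c (hX hc))] at hy⟩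
      rcases eq_or_ne p u with rfl | hpu'
      · rw [hk, if_neg hpw, if_pos rfl, hL'u]
        refine exists_congr fun c => and_congr_right fun hc => ?_
        have := (Finset.mem_sdiff.1 hc).1
        rw [hL' c (hN this) (hku c this)]
      · rw [hL' p hpw hpu', T.mem_L p (by grind) hpV]
        constructor
        · rintro ⟨c, hc, hy⟩
          obtain ⟨d, hd, rfl⟩ := hsurj p hpw hpu' c hc
          exact ⟨d, hd, (hLo p hpw hpu' d hd).2 ▸ hy⟩
        · rintro ⟨c, hc, hy⟩
          obtain ⟨h1, h2⟩ := hLo p hpw hpu' c hc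
          exact ⟨_, h1, h2 ▸ hy⟩
    · intro p hp
      rcases eq_or_ne p u with rfl | hpu'
      · obtain ⟨y, hy⟩ := T.nonempty a (mem_kids.1 (Finset.mem_sdiff.1 ha).1).1
        exact ⟨y, (hL'u y).2 ⟨a, ha, hy⟩⟩
      rcases eq_or_ne p w with rfl | hpw
      · rw [hL'w]
        exact T.nonempty u hu
      · rw [hL' p hpw hpu']
        exact T.nonempty p (by grind)
    · intro p hp c hc d hd hne y hyc hyd
      rcases eq_or_ne p w with rfl | hpw
      · rw [hk, if_pos rfl] at hc hd
        have h1 := hXd c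
        have h2 := hXd d
        have h3 := hL' c
        have h4 := hL' d
        have h5 := T.mem_kids_unique (p := u) (c := c) (d := d) (y := y)
        have := @hX c
        have := @hX d
        have := hku c
        have := hku d
        have := hXN c
        have := hXN d
        grind
      rcases eq_or_ne p u with rfl | hpu'
      · rw [hk, if_neg hpw, if_pos rfl] at hc hd
        have hc' := (Finset.mem_sdiff.1 hc).1
        have hd' := (Finset.mem_sdiff.1 hd).1
        rw [hL' c (hN hc') (hku c hc')] at hyc
        rw [hL' d (hN hd') (hku d hd')] at hyd
        exact hne (T.mem_kids_unique hc' hd' hyc hyd)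
      · obtain ⟨h1, h2⟩ := hLo p hpw hpu' c hc
        obtain ⟨h3, h4⟩ := hLo p hpw hpu' d hd
        exact hne (hinj p hpw hpu' c hc d hd (T.mem_kids_unique h1 h3 (h2 ▸ hyc) (h4 ▸ hyd)))
    · intro p hp c hc d hd hne y hy z hz
      rcases eq_or_ne p w with rfl | hpw
      · rw [hk, if_pos rfl] at hc hd
        rw [Function.update_self]
        obtain ⟨c', hc', hyc', hcc⟩ : ∃ c' ∈ kids r N par u, y ∈ L c' ∧
            (c' = c ∧ c ∈ X ∨ c' ∉ X ∧ c = u) := by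
          obtain rfl | hc := Finset.mem_insert.1 hc
          · obtain ⟨d, hd, hy⟩ := (hL'u y).1 hy
            obtain ⟨hd, hdX⟩ := Finset.mem_sdiff.1 hd
            exact ⟨d, hd, hy, .inr ⟨hdX, rfl⟩⟩
          · exact ⟨c, hX hc, by rwa [hL' c (hXN c hc) (hku c (hX hc))] at hy, .inl ⟨rfl, hc⟩⟩
        obtain ⟨d', hd', hzd', hdd⟩ : ∃ d' ∈ kids r N par u, z ∈ L d' ∧
            (d' = d ∧ d ∈ X ∨ d' ∉ X ∧ d = u) := by
          obtain rfl | hc := Finset.mem_insert.1 hd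
          · obtain ⟨d, hd, hy⟩ := (hL'u z).1 hz
            obtain ⟨hd, hdX⟩ := Finset.mem_sdiff.1 hd
            exact ⟨d, hd, hy, .inr ⟨hdX, rfl⟩⟩
          · exact ⟨d, hX hc, by rwa [hL' d (hXN d hc) (hku d (hX hc))] at hz, .inl ⟨rfl, hc⟩⟩
        refine T.adj u hu c' hc' d' hd' ?_ y hyc' z hzd'
        grind
      rw [Function.update_of_ne hpw]
      rcases eq_or_ne p u with rfl | hpu'
      · rw [hk, if_neg hpw, if_pos rfl] at hc hd
        have hc' := (Finset.mem_sdiff.1 hc).1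
        have hd' := (Finset.mem_sdiff.1 hd).1
        rw [hL' c (hN hc') (hku c hc')] at hy
        rw [hL' d (hN hd') (hku d hd')] at hz
        exact T.adj p hu c hc' d hd' hne y hy z hz
      · obtain ⟨h1, h2⟩ := hLo p hpw hpu' c hc
        obtain ⟨h3, h4⟩ := hLo p hpw hpu' d hd
        exact T.adj p (T.notMem_of_mem_kids h1).1 _ h1 _ h3
          (fun h => hne (hinj p hpw hpu' c hc d hd h)) y (h2 ▸ hy) z (h4 ▸ hz)
    · intro c hc hcV hcr hcu
      have h1 := T.alt c
      have h2 := T.alt u hu huV hur hur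
      have h3 := T.par_mem c
      have h4 := @hX c
      rw [mem_kids] at h4
      simp only [parOver, Function.update_apply]
      grind
  · intro q hq c hc hs d hd hne z hz
    rcases eq_or_ne q w with rfl | hqw
    · rw [hk, if_pos rfl] at hc hd
      rw [Function.update_self]
      obtain rfl | hc := Finset.mem_insert.1 hc
      · have hd' := (Finset.mem_insert.1 hd).resolve_left hne
        exact hadj d hd' z (by rwa [hL' d (hXN d hd') hne] at hz)
      · exfalso
        obtain ⟨y, hy⟩ := T.nonempty a (mem_kids.1 (Finset.mem_sdiff.1 ha).1).1
        have hyw := (hL'u y).2 ⟨a, ha, hy⟩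
        have := hs hyw
        rw [hL' c (hXN c hc) (hku c (hX hc))] at this
        exact hXd c hc y this hyw
    rw [Function.update_of_ne hqw]
    have hsa : ∀ a ∈ kids r N par u \ X, L a ⊆ L' c := fun a ha y hy => hs ((hL'u y).2 ⟨a, ha, hy⟩)
    rcases eq_or_ne q u with rfl | hqu
    · exfalso
      rw [hk, if_neg hqw, if_pos rfl] at hc
      have hc' := (Finset.mem_sdiff.1 hc).1
      obtain ⟨d, hd, hdc⟩ := Finset.exists_mem_ne hlt2 c
      have hd' := (Finset.mem_sdiff.1 hd).1
      obtain ⟨y, hy⟩ := T.nonempty d (mem_kids.1 hd').1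
      have := hsa d hd hy
      rw [hL' c (hN hc') (hku c hc')] at this
      exact hdc (T.mem_kids_unique hd' hc' hy this)
    · obtain ⟨h1, h2⟩ := hLo q hqw hqu c hc
      obtain ⟨h3, h4⟩ := hLo q hqw hqu d hd
      rw [h2] at hsa
      exact hf q (T.notMem_of_mem_kids h1).1 _ h1 (T.subset_of_two_kids (mem_kids.1 h1).1
        (Finset.mem_sdiff.1 ha).1 (Finset.mem_sdiff.1 hb).1 hab (hsa a ha) (hsa b hb)) _ h3
        (fun h => hne (hinj q hqw hqu d hd c hc h)) z (h4 ▸ hz)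

end IsCotree

end Cotree

/-! ### The place of a new vertex. -/

namespace Cotree

/-- `G` has no induced path on four vertices. -/
def PathFree (G : SimpleGraph ℕ) : Prop :=
  ∀ a b c d, G.Adj a b → G.Adj b c → G.Adj c d → ¬ G.Adj a c → ¬ G.Adj a d → G.Adj b d

/-- The vertex `x` is adjacent to all leaves below `p`. -/
def Full (G : SimpleGraph ℕ) (x : ℕ) (L : ℕ → Finset ℕ) (p : ℕ) : Prop :=
  ∀ y ∈ L p, G.Adj x y

/-- The vertex `x` is adjacent to no leaf below `p`. -/
def Vacant (G : SimpleGraph ℕ) (x : ℕ) (L : ℕ → Finset ℕ) (p : ℕ) : Prop :=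
  ∀ y ∈ L p, ¬ G.Adj x y

/-- The vertex `x` is adjacent to some, but not all leaves below `p`. -/
def Mixed (G : SimpleGraph ℕ) (x : ℕ) (L : ℕ → Finset ℕ) (p : ℕ) : Prop :=
  ¬ Full G x L p ∧ ¬ Vacant G x L p

/-- The node `p` is not full, but has a full child. -/
def Touched (G : SimpleGraph ℕ) (r : ℕ) (N : Finset ℕ) (par : ℕ → ℕ) (L : ℕ → Finset ℕ)
    (x p : ℕ) : Prop :=
  ¬ Full G x L p ∧ ∃ c ∈ kids r N par p, Full G x L c

/-- The node `p` is the parent or the grandparent of a touched node. -/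
def OverTouched (G : SimpleGraph ℕ) (r : ℕ) (N : Finset ℕ) (par : ℕ → ℕ) (L : ℕ → Finset ℕ)
    (x p : ℕ) : Prop :=
  ∃ q, Touched G r N par L x q ∧ (p = par q ∨ p = par (par q))

/-- The new vertex `x` has to be inserted between `u` and its children. -/
structure IsPlace (G : SimpleGraph ℕ) (r : ℕ) (N V : Finset ℕ) (par ser : ℕ → ℕ)
    (L : ℕ → Finset ℕ) (x u : ℕ) : Prop where
  mem : u ∈ N
  notMem : u ∉ V
  fits : Fits G r N par ser L x u
  full_or_vacant : ∀ c ∈ kids r N par u, Full G x L c ∨ Vacant G x L c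
  not_full : ¬ Full G x L u
  eq_root : (∀ c ∈ kids r N par u, ¬ Full G x L c) → u = r

variable {G : SimpleGraph ℕ} {r : ℕ} {N V : Finset ℕ} {par ser : ℕ → ℕ} {L : ℕ → Finset ℕ}
  {x : ℕ}

theorem Mixed.mono {p q : ℕ} (h : Mixed G x L p) (hs : L p ⊆ L q) : Mixed G x L q :=
  ⟨fun h' => h.1 fun y hy => h' y (hs hy), fun h' => h.2 fun y hy => h' y (hs hy)⟩

namespace IsCotree

theorem full_iff {e : ℕ} (T : IsCotree G r N V par ser L e) {p : ℕ} (hp : p ∈ N) (hV : p ∉ V) :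
    Full G x L p ↔ ∀ c ∈ kids r N par p, Full G x L c := by
  constructor
  · exact fun h c hc y hy => h y (T.subset_of_mem_kids hc hy)
  · intro h y hy
    obtain ⟨c, hc, hy⟩ := (T.mem_L p hp hV y).1 hy
    exact h c hc y hy

theorem not_mixed_of_leaf {e : ℕ} (T : IsCotree G r N V par ser L e) {p : ℕ}
    (h : Mixed G x L p) : p ∉ V := by
  intro hp
  have := h.1
  have := h.2
  simp only [Full, Vacant, T.L_leaf p hp, Finset.mem_singleton] at *
  grind

variable (T : IsCotree G r N V par ser L r)

include T in
-- If the neighbor and the non-neighbor of `x` lie below the same child, then a leaf below another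
-- child is one or the other and can replace the corresponding one; leaves below distinct children
-- are adjacent according to the kind of `c`.
theorem exists_pair {c : ℕ} (hc : c ∈ N) (h : Mixed G x L c) :
    ∃ y ∈ L c, ∃ z ∈ L c, G.Adj x y ∧ ¬ G.Adj x z ∧ (G.Adj y z ↔ ser c = 1) := by
  have hcV := T.not_mixed_of_leaf h
  obtain ⟨h1, h2⟩ := h
  simp only [Full, Vacant] at h1 h2
  push Not at h1 h2
  obtain ⟨z, hz, hxz⟩ := h1
  obtain ⟨y, hy, hxy⟩ := h2
  obtain ⟨a, ha, hya⟩ := (T.mem_L c hc hcV y).1 hy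
  obtain ⟨b, hb, hzb⟩ := (T.mem_L c hc hcV z).1 hz
  by_cases hab : a = b
  · subst hab
    obtain ⟨d, hd, hda⟩ := T.exists_other_kid hc hcV a
    obtain ⟨t, ht⟩ := T.nonempty d (mem_kids.1 hd).1
    have htc := T.subset_of_mem_kids hd ht
    by_cases hxt : G.Adj x t
    · exact ⟨t, htc, z, hz, hxt, hxz, T.adj c hc d hd a ha hda t ht z hzb⟩
    · exact ⟨y, hy, t, htc, hxy, hxt, T.adj c hc a ha d hd hda.symm y hya t ht⟩
  · exact ⟨y, hy, z, hz, hxy, hxz, T.adj c hc a ha b hb hab y hya z hzb⟩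

include T in
-- The heart of the correctness proof, and where the absence of induced paths enters. The mixed
-- child `c` contains a neighbor `y` and a non-neighbor `w` of `x`, adjacent precisely if `c` is
-- series, that is, if `p` is parallel.
theorem adj_of_mixed (hG : PathFree G) {p c d z : ℕ} (hc : c ∈ kids r N par p)
    (h : Mixed G x L c) (hd : d ∈ kids r N par p) (hne : d ≠ c) (hz : z ∈ L d) :
    G.Adj x z ↔ ser p = 1 := by
  obtain ⟨hcN, hcr, hcp⟩ := mem_kids.1 hc
  obtain ⟨hp, hpV⟩ := T.notMem_of_mem_kids hc
  have halt := T.alt c hcN (T.not_mixed_of_leaf h) hcr hcr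
  rw [hcp] at halt
  obtain ⟨y, hy, w, hw, hxy, hxw, hyw⟩ := T.exists_pair hcN h
  have h1 := T.adj p hp d hd c hc hne z hz y hy
  have h2 := T.adj p hp d hd c hc hne z hz w hw
  constructor
  · intro hxz
    -- For parallel `p`, the vertices `z, x, y, w` would form an induced path.
    by_contra hs
    have hyw : G.Adj y w := hyw.2 (by omega)
    have := hG z x y w hxz.symm hxy hyw (fun h => hs (h1.1 h)) (fun h => hs (h2.1 h))
    exact hxw this
  · intro hs
    -- For series `p`, the vertices `x, y, z, w` would form an induced path.
    by_contra hxz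
    have hyw : ¬ G.Adj y w := fun h => by have := hyw.1 h; omega
    exact hyw (hG x y z w hxy (h1.2 hs).symm (h2.2 hs) hxz hxw)

include T in
-- The siblings of a mixed child are all full or all vacant, by `adj_of_mixed`.
theorem mixed_unique (hG : PathFree G) {p c d : ℕ} (hc : c ∈ kids r N par p)
    (h : Mixed G x L c) (hd : d ∈ kids r N par p) (h' : Mixed G x L d) : d = c := by
  by_contra hne
  have := fun z hz => T.adj_of_mixed hG (z := z) hc h hd hne hz
  by_cases hs : ser p = 1
  · exact h'.1 fun z hz => (this z hz).2 hs
  · exact h'.2 fun z hz hxz => hs ((this z hz).1 hxz)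

include T in
theorem fits_of_mixed (hG : PathFree G) {u : ℕ} (h : Mixed G x L u) :
    Fits G r N par ser L x u :=
  fun _ _ _ hc hs _ hd hne _ hz => T.adj_of_mixed hG hc (h.mono hs) hd hne hz

include T in
theorem fits_root : Fits G r N par ser L x r :=
  fun _ hp _ hc hs => absurd ((T.subset_root hp).trans hs) (T.not_subset_of_mem_kids hc)

include T in
-- At a common ancestor of `u` and `p`, both lie below the same mixed child by uniqueness, so the
-- descent continues until it meets `p`. It cannot stop at `u` first, because no child of `u` is
-- mixed.
theorem subset_of_mixed (hG : PathFree G) {u p : ℕ} (hu : u ∈ N) (hum : Mixed G x L u)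
    (hlow : ∀ c ∈ kids r N par u, ¬ Mixed G x L c) (hp : p ∈ N) (hpm : Mixed G x L p) :
    L u ⊆ L p := by
  have : ∀ a ∈ N, L u ⊆ L a → L p ⊆ L a → L u ⊆ L p := by
    refine T.kids_induction (fun v hv h _ => absurd hv (T.not_mixed_of_leaf (hum.mono h)))
      fun a ha haV ih hua hpa => ?_
    obtain rfl | ⟨c, hc, hpc⟩ := T.eq_or_exists_kid ha hp hpa
    · exact hua
    obtain rfl | ⟨d, hd, hud⟩ := T.eq_or_exists_kid ha hu hua
    · exact absurd (hpm.mono hpc) (hlow c hc)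
    · obtain rfl := T.mixed_unique hG hc (hpm.mono hpc) hd (hum.mono hud)
      exact ih d hd hud hpc
  exact this r T.root_mem (T.subset_root hu) (T.subset_root hp)

include T in
theorem exists_lowest {p : ℕ} (hp : p ∈ N) (h : Mixed G x L p) :
    ∃ u ∈ N, Mixed G x L u ∧ ∀ c ∈ kids r N par u, ¬ Mixed G x L c := by
  revert h
  refine T.kids_induction (P := fun p => Mixed G x L p → _) (fun v hv h => ?_)
    (fun p hp hV ih h => ?_) p hp
  · exact absurd hv (T.not_mixed_of_leaf h)
  · by_cases hc : ∃ c ∈ kids r N par p, Mixed G x L c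
    · obtain ⟨c, hc, hm⟩ := hc
      exact ih c hc hm
    · push Not at hc
      exact ⟨p, hp, h, hc⟩

include T in
theorem Touched.mixed {p : ℕ} (h : Touched G r N par L x p) : p ∈ N ∧ Mixed G x L p := by
  obtain ⟨h1, c, hc, hf⟩ := h
  refine ⟨(T.notMem_of_mem_kids hc).1, h1, fun h => ?_⟩
  obtain ⟨y, hy⟩ := T.nonempty c (mem_kids.1 hc).1
  exact h y (T.subset_of_mem_kids hc hy) (hf y hy)

include T in
-- The place `u` is the lowest mixed node, or the root if `x` has no neighbor in the tree. All
-- touched nodes are mixed, hence lie on the path from `u` to the root. A touched node above `u` is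
-- series, and the next series node on the path below it, or `u` if that comes earlier, is touched
-- too; so it is over a touched node. No touched node lies below `u`, so `u` itself is not over one,
-- except that the root is its own parent. This explains the exceptions for `r`.
theorem exists_place (hG : PathFree G) (hr : ¬ Full G x L r) :
    ∃ u, IsPlace G r N V par ser L x u ∧
      (∀ p, Touched G r N par L x p → p = u ∨ OverTouched G r N par L x p) ∧
      (OverTouched G r N par L x u → u = r) ∧ (¬ Touched G r N par L x u → u = r) := by
  by_cases hrv : Vacant G x L r
  · have hv : ∀ p ∈ N, Vacant G x L p := fun p hp y hy => hrv y (T.subset_root hp hy)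
    have ht : ∀ p, ¬ Touched G r N par L x p := fun p hp =>
      (Touched.mixed T hp).2.2 (hv p (Touched.mixed T hp).1)
    exact ⟨r, ⟨T.root_mem, T.root_notMem, T.fits_root, fun c hc => .inr (hv c (mem_kids.1 hc).1), hr,
      fun _ => rfl⟩, fun p hp => absurd hp (ht p), fun _ => rfl, fun _ => rfl⟩
  obtain ⟨u, hu, hum, hlow⟩ := T.exists_lowest T.root_mem ⟨hr, hrv⟩
  have huV := T.not_mixed_of_leaf hum
  have hfv : ∀ c ∈ kids r N par u, Full G x L c ∨ Vacant G x L c := by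
    intro c hc
    have := hlow c hc
    simp only [Mixed] at this
    tauto
  have hex : ∃ c ∈ kids r N par u, Full G x L c := by
    by_contra! h
    refine hum.2 fun y hy => ?_
    obtain ⟨c, hc, hy⟩ := (T.mem_L u hu huV y).1 hy
    exact (hfv c hc).resolve_left (h c hc) y hy
  have hut : Touched G r N par L x u := ⟨hum.1, hex⟩
  refine ⟨u, ⟨hu, huV, T.fits_of_mixed hG hum, hfv, hum.1, fun h => ?_⟩, fun p hp => ?_, ?_,
    fun h => absurd hut h⟩
  · obtain ⟨c, hc, hf⟩ := hex
    exact absurd hf (h c hc)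
  · obtain ⟨hpN, hpm⟩ := Touched.mixed T hp
    obtain rfl | ⟨c, hc, huc⟩ := T.eq_or_exists_kid hpN hu (T.subset_of_mixed hG hu hum hlow hpN hpm)
    · exact .inl rfl
    right
    have hcm := hum.mono huc
    obtain ⟨hcN, hcr, hcp⟩ := mem_kids.1 hc
    have hcV := T.not_mixed_of_leaf hcm
    -- A full child of `p` is a sibling of the mixed child `c`, so `adj_of_mixed` makes `p` series.
    have hsp : ser p = 1 := by
      obtain ⟨d, hd, hdf⟩ := hp.2
      obtain ⟨y, hy⟩ := T.nonempty d (mem_kids.1 hd).1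
      exact (T.adj_of_mixed hG hc hcm hd (by rintro rfl; exact hcm.1 hdf) hy).1 (hdf y hy)
    have hsc := T.alt c hcN hcV hcr hcr
    rw [hcp, hsp] at hsc
    obtain rfl | ⟨c', hc', huc'⟩ := T.eq_or_exists_kid hcN hu huc
    · exact ⟨u, hut, .inl hcp.symm⟩
    obtain ⟨hcN', hcr', hcp'⟩ := mem_kids.1 hc'
    have hpp : p = par (par c') := by rw [hcp', hcp]
    have hcm' := hum.mono huc'
    have hsc' := T.alt c' hcN' (T.not_mixed_of_leaf hcm') hcr' hcr'
    rw [hcp'] at hsc'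
    refine ⟨c', ⟨hcm'.1, ?_⟩, .inr hpp⟩
    obtain rfl | ⟨b, hb, hub⟩ := T.eq_or_exists_kid hcN' hu huc'
    · exact hex
    · obtain ⟨d, hd, hdb⟩ := T.exists_other_kid hcN' (T.not_mixed_of_leaf hcm') b
      -- `c'` is series, so the siblings of its mixed child are full, and `c'` is touched.
      exact ⟨d, hd, fun y hy => (T.adj_of_mixed hG hb (hum.mono hub) hd hdb hy).2 (by omega)⟩
  · rintro ⟨q, hq, hqu⟩
    obtain ⟨hqN, hqm⟩ := Touched.mixed T hq
    have hs := T.subset_of_mixed hG hu hum hlow hqN hqm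
    have h1 := T.subset_par hqN
    have hpN := T.par_mem q hqN
    have h2 := T.subset_par hpN
    by_contra hur
    obtain hqu | hqu := hqu
    · rw [← hqu] at h1
      have : u = q := T.eq_of_subset_of_subset hqN hu hs h1
      exact T.par_ne hu hur (this ▸ hqu.symm)
    · rw [← hqu] at h2
      have : u = q := T.eq_of_subset_of_subset hqN hu hs (h1.trans h2)
      have h3 : u = par q := T.eq_of_subset_of_subset hpN hu (hs.trans h1) h2
      exact T.par_ne hu hur (by rw [this] at h3 ⊢; exact h3.symm)

include T in
theorem fits_kid {u c : ℕ} (hf : Fits G r N par ser L x u) (hc : c ∈ kids r N par u)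
    (h : ∀ d ∈ kids r N par u, d ≠ c → ∀ z ∈ L d, (G.Adj x z ↔ ser u = 1)) :
    Fits G r N par ser L x c := by
  intro p hp a ha hs d hd hne z hz
  obtain ⟨hcN, hcr, hcu⟩ := mem_kids.1 hc
  obtain ⟨i, hi⟩ := T.exists_iterate_of_subset (mem_kids.1 ha).1 hcN hs
  obtain _ | i := i
  · have hi : c = a := hi
    subst hi
    have : u = p := hcu.symm.trans (mem_kids.1 ha).2.2
    subst this
    exact h d hd hne z hz
  · rw [Function.iterate_succ_apply, hcu] at hi
    exact hf p hp a ha (hi ▸ (T.subset_iterate (T.notMem_of_mem_kids hc).1 i).2) d hd hne z hz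

end IsCotree

/-! ### Insertion at the place. -/

section Insert

open scoped Classical in
/-- The full children of `u`. -/
noncomputable def fullKids (G : SimpleGraph ℕ) (r : ℕ) (N : Finset ℕ) (par : ℕ → ℕ)
    (L : ℕ → Finset ℕ) (x u : ℕ) : Finset ℕ :=
  (kids r N par u).filter fun c => Full G x L c

theorem mem_fullKids {u c : ℕ} :
    c ∈ fullKids G r N par L x u ↔ c ∈ kids r N par u ∧ Full G x L c := by
  simp [fullKids]

variable {u c s w : ℕ} (T : IsCotree G r N V par ser L r) (hx : x ∉ N)
  (hu : IsPlace G r N V par ser L x u)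

include hu in
theorem IsPlace.adj_iff {κ : ℕ} (hs : ser u = κ) {d z : ℕ} (hd : d ∈ kids r N par u) (hz : z ∈ L d)
    (h : d ∈ fullKids G r N par L x u ↔ κ = 1) : G.Adj x z ↔ ser u = 1 := by
  rw [hs, ← h, mem_fullKids]
  constructor
  · exact fun hxz => ⟨hd, (hu.full_or_vacant d hd).resolve_right fun hv => hv z hz hxz⟩
  · exact fun h => h.2 z hz

include T hu in
theorem IsPlace.card_lt : (fullKids G r N par L x u).card < (kids r N par u).card := by
  refine Finset.card_lt_card ⟨fun c hc => (mem_fullKids.1 hc).1, fun h => hu.not_full ?_⟩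
  exact (T.full_iff hu.mem hu.notMem).2 fun c hc => (mem_fullKids.1 (h hc)).2

include T hx hu in
-- At a parallel place without full children, `x` has no neighbor below `u` and is one more
-- component.
theorem IsPlace.insert_of_no_full (hs : ser u = 0) (hA : fullKids G r N par L x u = ∅) :
    ∃ L', IsCotree G r (insert x N) (insert x V) (Function.update par x u) ser L' r := by
  refine T.attach hx hu.mem hu.notMem hu.fits fun z hz => ?_
  obtain ⟨d, hd, hz⟩ := (T.mem_L u hu.mem hu.notMem z).1 hz
  exact hu.adj_iff hs hd hz (by simp [hA])

include T hx hu in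
/-- If the kind of exactly one child `c` is exceptional, then `x` becomes a child of `c`, or `c`
and `x` become children of a new node. -/
theorem IsPlace.insert_of_unique {κ : ℕ} (hs : ser u = κ) (hc : c ∈ kids r N par u)
    (hA : ∀ d ∈ kids r N par u, (d ∈ fullKids G r N par L x u ↔ κ = 1) ↔ d ≠ c) :
    (c ∉ V → ∃ L', IsCotree G r (insert x N) (insert x V) (Function.update par x c) ser L' r) ∧
    (c ∈ V → s ∉ N → s ≠ x → ∃ L', IsCotree G r (insert s (insert x N)) (insert x V)
      (parAbove par c s x) (Function.update ser s (1 - κ)) L' r) := by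
  obtain ⟨hcN, hcr, hcu⟩ := mem_kids.1 hc
  have hf := T.fits_kid hu.fits hc fun d hd hdc z hz => hu.adj_iff hs hd hz ((hA d hd).2 hdc)
  have hκ : κ ≤ 1 := hs ▸ T.ser_le u hu.mem hu.notMem
  have hadj : ∀ z ∈ L c, (G.Adj x z ↔ κ ≠ 1) := by
    intro z hz
    have h1 := hA c hc
    have h2 := hu.full_or_vacant c hc
    rw [mem_fullKids] at h1
    simp only [Full, Vacant] at h1 h2
    grind
  refine ⟨fun hcV => T.attach hx hcN hcV hf fun z hz => ?_, fun hcV hsN hsx =>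
    T.above hx hsN hsx hcN hcr hf (by omega) (fun z hz => ?_) (by rw [hcu, hs]; omega)
      (fun h => absurd hcV h) (.inl rfl)⟩
  · have := T.alt c hcN hcV hcr hcr
    rw [hcu, hs] at this
    rw [hadj z hz]
    omega
  · rw [hadj z hz]
    omega

include T hx hu in
-- Below a parallel place, the neighbors of `x` are the leaves of two or more full children. These
-- become one child `w`, and a new series node joins `w` with `x`.
theorem IsPlace.insert_below (hs : ser u = 0) (hA : 2 ≤ (fullKids G r N par L x u).card)
    (hw : w ∉ N) (hwx : w ≠ x) (hsN : s ∉ N) (hsw : s ≠ w) (hsx : s ≠ x) :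
    ∃ L', IsCotree G r (insert s (insert x (insert w N))) (insert x V)
      (parAbove (parBelow par (fullKids G r N par L x u) u w) w s x)
      (Function.update (Function.update ser w 0) s 1) L' r := by
  have hX : fullKids G r N par L x u ⊆ kids r N par u := fun c hc => (mem_fullKids.1 hc).1
  obtain ⟨L', T', hf, hL⟩ := T.groupBelow hw hu.mem hu.notMem hX hA (hu.card_lt T) hu.fits
    fun d hd hdX z hz => hu.adj_iff hs hd hz (by simp [hdX])
  rw [hs] at T' hf
  have hwr : w ≠ r := fun h => hw (h ▸ T.root_mem)
  have huw : u ≠ w := fun h => hw (h ▸ hu.mem)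
  refine T'.above (by simp [hx, hwx.symm]) (by simp [hsN, hsw]) hsx (by simp) hwr hf le_rfl
    (fun z hz => ?_) ?_ (fun _ => by simp) (.inr rfl)
  · obtain ⟨c, hc, hz⟩ := (hL z).1 hz
    simp [(mem_fullKids.1 hc).2 z hz]
  · simp [parBelow, Function.update_of_ne huw, hs]

include T hx hu in
-- Below a series place, the non-full children are vacant, and there are at least two of them. They
-- stay with `u`, the full children move up to `w`, and a new parallel node below `w` unites `u`
-- with `x`. A series place is not the root, hence has a full child by `eq_root`, so `w` has two
-- children.
theorem IsPlace.insert_over (hs : ser u = 1)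
    (hA : (fullKids G r N par L x u).card + 2 ≤ (kids r N par u).card)
    (hw : w ∉ N) (hwx : w ≠ x) (hsN : s ∉ N) (hsw : s ≠ w) (hsx : s ≠ x) :
    ∃ L', IsCotree G r (insert s (insert x (insert w N))) (insert x V)
      (parAbove (parOver par (fullKids G r N par L x u) u w) u s x)
      (Function.update (Function.update ser w 1) s 0) L' r := by
  have hX : fullKids G r N par L x u ⊆ kids r N par u := fun c hc => (mem_fullKids.1 hc).1
  have hur : u ≠ r := by
    rintro rfl
    have := T.ser_root
    omega
  have hne : (fullKids G r N par L x u).Nonempty := by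
    by_contra h
    rw [Finset.not_nonempty_iff_eq_empty] at h
    refine hur (hu.eq_root fun c hc hf => ?_)
    have := mem_fullKids.2 ⟨hc, hf⟩
    simp [h] at this
  obtain ⟨L', T', hf, hL⟩ := T.groupOver hw hu.mem hu.notMem hur hX hne hA hu.fits
    fun d hd z hz => hu.adj_iff hs (hX hd) hz (by simp [hd])
  rw [hs] at T' hf
  have huw : u ≠ w := fun h => hw (h ▸ hu.mem)
  refine T'.above (by simp [hx, hwx.symm]) (by simp [hsN, hsw]) hsx (by simp [hu.mem]) hur hf
    (Nat.zero_le _) (fun z hz => ?_) ?_ (fun _ => by simp [Function.update_of_ne huw, hs]) (.inr rfl)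
  · obtain ⟨c, hc, hz⟩ := (hL z).1 hz
    obtain ⟨hc, hcX⟩ := Finset.mem_sdiff.1 hc
    rw [mem_fullKids] at hcX
    have := (hu.full_or_vacant c hc).resolve_left (fun h => hcX ⟨hc, h⟩) z hz
    simp [this]
  · simp [parOver]

end Insert

end Cotree

/-! ### Reasoning about programs -/

namespace WordRAM

/-- The program `p`, started in `s`, halts after time at most `T` in a state that satisfies `Q`. -/
def Runs (B : ℕ) (p : Prog) (s : State) (T : ℕ) (Q : State → Prop) : Prop :=
  ∃ s' t, Exec B p s s' t ∧ t ≤ T ∧ Q s'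

variable {B : ℕ}

theorem Runs.mono {p : Prog} {s : State} {T T' : ℕ} {Q Q' : State → Prop} (h : Runs B p s T Q)
    (hT : T ≤ T') (hQ : ∀ s', Q s' → Q' s') : Runs B p s T' Q' := by
  obtain ⟨s', t, h1, h2, h3⟩ := h
  exact ⟨s', t, h1, h2.trans hT, hQ s' h3⟩

theorem Runs.seq {p q : Prog} {s : State} {T T₁ T₂ : ℕ} {Q R : State → Prop}
    (h : Runs B p s T₁ R) (h' : ∀ s', R s' → Runs B q s' T₂ Q) (hT : T₁ + T₂ ≤ T) :
    Runs B (.seq p q) s T Q := by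
  obtain ⟨s', t, h1, h2, h3⟩ := h
  obtain ⟨s'', t', h4, h5, h6⟩ := h' s' h3
  exact ⟨s'', t + t', .seq _ _ _ _ _ _ _ h1 h4, by omega, h6⟩

theorem Runs.ite {b : Test} {p q : Prog} {s : State} {T : ℕ} {Q : State → Prop}
    (h : b.holds s → Runs B p s T Q) (h' : ¬ b.holds s → Runs B q s T Q) :
    Runs B (.ite b p q) s (b.time + 1 + T) Q := by
  by_cases hb : b.holds s
  · obtain ⟨s', t, h1, h2, h3⟩ := h hb
    exact ⟨s', _, .iteTrue _ _ _ _ _ _ hb h1, by omega, h3⟩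
  · obtain ⟨s', t, h1, h2, h3⟩ := h' hb
    exact ⟨s', _, .iteFalse _ _ _ _ _ _ hb h1, by omega, h3⟩

theorem Runs.assign_seq {x : ℕ} {e : Expr} {q : Prog} {s : State} {T T' : ℕ} {Q : State → Prop}
    (he : e.eval s ≤ B) (h : Runs B q (s.setReg x (e.eval s)) T' Q) (hT : e.time + 1 + T' ≤ T) :
    Runs B (.seq (.assign x e) q) s T Q :=
  Runs.seq (R := fun s' => s' = s.setReg x (e.eval s)) ⟨_, _, .assign s x e he, le_rfl, rfl⟩
    (by rintro _ rfl; exact h) hT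

/-- A loop with invariant `I` whose running time is paid for by the potential `φ`. -/
theorem Runs.loop {b : Test} {p : Prog} (I : State → Prop) (φ : State → ℕ)
    (h : ∀ s, I s → b.holds s → ∃ T, Runs B p s T fun s' => I s' ∧ φ s' + T + b.time + 1 ≤ φ s)
    {s : State} (hs : I s) :
    Runs B (.loop b p) s (φ s + b.time + 1) fun s' => I s' ∧ ¬ b.holds s' := by
  have : ∀ m s, φ s = m → I s →
      Runs B (.loop b p) s (φ s + b.time + 1) fun s' => I s' ∧ ¬ b.holds s' := by
    intro m
    induction m using Nat.strong_induction_on with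
    | _ m ih =>
      rintro s rfl hs
      by_cases hb : b.holds s
      · obtain ⟨T, s', t, h1, h2, h3, h4⟩ := h s hs hb
        obtain ⟨s'', t', h5, h6, h7⟩ := ih (φ s') (by omega) s' rfl h3
        exact ⟨s'', _, .loopTrue _ _ _ _ _ _ _ hb h1 h5, by omega, h7⟩
      · exact ⟨s, _, .loopFalse _ _ _ hb, by omega, hs, hb⟩
  exact this _ s rfl hs

/-- A loop with a decreasing measure `μ` and a body of bounded running time. -/
theorem Runs.loop_of_measure {b : Test} {p : Prog} {K : ℕ} (I : State → Prop) (μ : State → ℕ)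
    (h : ∀ s, I s → b.holds s → Runs B p s K fun s' => I s' ∧ μ s' + 1 ≤ μ s)
    {s : State} (hs : I s) :
    Runs B (.loop b p) s ((μ s + 1) * (K + b.time + 1)) fun s' => I s' ∧ ¬ b.holds s' := by
  refine (Runs.loop I (fun s => μ s * (K + b.time + 1)) (fun s hs hb => ⟨K, ?_⟩) hs).mono ?_
    fun _ h => h
  · refine (h s hs hb).mono le_rfl fun s' hs' => ⟨hs'.1, ?_⟩
    have := Nat.mul_le_mul_right (K + b.time + 1) hs'.2
    rw [Nat.add_mul] at this
    omega
  · rw [Nat.add_mul]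
    omega

/-- An upper bound for the running time of a program without loops. -/
def Prog.maxTime : Prog → ℕ
  | .skip => 1
  | .assign _ e => e.time + 1
  | .store _ i e => i.time + e.time + 1
  | .seq p q => p.maxTime + q.maxTime
  | .ite b p q => b.time + 1 + (p.maxTime + q.maxTime)
  -- The value zero is harmless: `Prog.wp` of a loop is false, and `targetTime` adds the time of its
  -- loop separately.
  | .loop _ _ => 0

/-- The weakest precondition of a program without loops. -/
def Prog.wp (B : ℕ) : Prog → (State → Prop) → State → Prop
  | .skip, Q, s => Q s
  | .assign x e, Q, s => e.eval s ≤ B ∧ Q (s.setReg x (e.eval s))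
  | .store a i e, Q, s => e.eval s ≤ B ∧ Q (s.setArr a (i.eval s) (e.eval s))
  | .seq p q, Q, s => p.wp B (q.wp B Q) s
  | .ite b p q, Q, s => (b.holds s → p.wp B Q s) ∧ (¬ b.holds s → q.wp B Q s)
  | .loop _ _, _, _ => False

theorem Runs.of_wp {p : Prog} {Q : State → Prop} {s : State} (h : p.wp B Q s) :
    Runs B p s p.maxTime Q := by
  induction p generalizing s Q with
  | skip => exact ⟨s, 1, .skip s, le_rfl, h⟩
  | assign x e => exact ⟨_, _, .assign s x e h.1, le_rfl, h.2⟩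
  | store a i e => exact ⟨_, _, .store s a i e h.1, le_rfl, h.2⟩
  | seq p q ihp ihq => exact (ihp h).seq (fun s' hs' => ihq hs') le_rfl
  | ite b p q ihp ihq =>
    refine Runs.ite (fun hb => (ihp (h.1 hb)).mono ?_ fun _ h => h)
      (fun hb => (ihq (h.2 hb)).mono ?_ fun _ h => h) <;> omega
  | loop => exact h.elim

theorem State.reg_setReg (s : State) (x v y : ℕ) :
    (s.setReg x v).reg y = if y = x then v else s.reg y := by
  simp [State.setReg, Function.update_apply]

theorem State.arr_setReg (s : State) (x v : ℕ) : (s.setReg x v).arr = s.arr := rfl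

theorem State.reg_setArr (s : State) (a i v : ℕ) : (s.setArr a i v).reg = s.reg := rfl

theorem State.arr_setArr (s : State) (a i v b : ℕ) :
    (s.setArr a i v).arr b = if b = a then Function.update (s.arr a) i v else s.arr b := by
  simp [State.setArr, Function.update_apply]

end WordRAM

/-! ### Propagation of marks from leaves to full nodes. -/

namespace Cotree

/-- The state of the propagation of marks: the queue `q` of length `len` starts with `m` marked
leaves, all of which satisfy `D`; the first `i` entries have been processed, and `cnt p` of them
are children of `p`.  A node enters the queue as soon as all its `nch p` children have been
processed. -/
structure Marked (N V : Finset ℕ) (par nch : ℕ → ℕ) (D : ℕ → Prop) (L : ℕ → Finset ℕ)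
    (q cnt : ℕ → ℕ) (m i len : ℕ) : Prop where
  le : i ≤ len
  le_len : m ≤ len
  inj : ∀ j < len, ∀ j' < len, q j = q j' → j = j'
  mem : ∀ j < len, q j ∈ N
  full : ∀ j < len, ∀ y ∈ L (q j), D y
  leaf : ∀ v ∈ V, D v → ∃ j < len, q j = v
  notMem : ∀ j < len, m ≤ j → q j ∉ V
  cnt_eq : ∀ p, cnt p = ((Finset.range i).filter fun j => par (q j) = p).card
  pushed : ∀ p ∈ N, p ∉ V → ((∃ j < len, q j = p) ↔ cnt p = nch p)
  order : ∀ j < len, ∀ j' < len, par (q j) = q j' → j < j'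

namespace Marked

variable {G : SimpleGraph ℕ} {r e : ℕ} {N V : Finset ℕ} {par ser nch : ℕ → ℕ}
  {L : ℕ → Finset ℕ} {D : ℕ → Prop} {q cnt : ℕ → ℕ} {m i len : ℕ}

theorem of_leaves (T : IsCotree G r N V par ser L e)
    (hnch : ∀ p ∈ N, p ∉ V → nch p = (kids r N par p).card)
    (hinj : ∀ j < m, ∀ j' < m, q j = q j' → j = j') (hV : ∀ j < m, q j ∈ V)
    (hD : ∀ j < m, D (q j)) (hleaf : ∀ v ∈ V, D v → ∃ j < m, q j = v)
    (hcnt : ∀ p, cnt p = 0) : Marked N V par nch D L q cnt m 0 m where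
  le := Nat.zero_le _
  le_len := le_rfl
  inj := hinj
  mem j hj := T.leaf_mem _ (hV j hj)
  full j hj y hy := by
    rw [T.L_leaf _ (hV j hj), Finset.mem_singleton] at hy
    exact hy ▸ hD j hj
  leaf := hleaf
  notMem j hj hj' := by omega
  cnt_eq p := by simp [hcnt]
  pushed p hp hpV := by
    have := T.two_le p hp hpV
    rw [hcnt, hnch p hp hpV]
    constructor
    · rintro ⟨j, hj, rfl⟩
      exact absurd (hV j hj) hpV
    · omega
  order j hj j' hj' h := absurd (hV j' hj') (h ▸ T.par_notMem _ (T.leaf_mem _ (hV j hj)))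

variable (T : IsCotree G r N V par ser L e)
  (hnch : ∀ p ∈ N, p ∉ V → nch p = (kids r N par p).card)
  (hr : ¬ ∀ y ∈ L r, D y)
  (M : Marked N V par nch D L q cnt m i len)

include M hr in
theorem mem_kids_of_lt {j : ℕ} (hj : j < len) : q j ∈ kids r N par (par (q j)) :=
  mem_kids.2 ⟨M.mem j hj, fun h => hr (h ▸ M.full j hj), rfl⟩

include M hr in
theorem card_filter_le {p i' : ℕ} (hi : i' ≤ len) :
    ((Finset.range i').filter fun j => par (q j) = p).card ≤ (kids r N par p).card := by
  refine Finset.card_le_card_of_injOn q (fun j hj => ?_) fun j hj j' hj' h => ?_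
  · simp only [Finset.coe_filter, Finset.mem_range, Set.mem_ofPred_eq] at hj
    have := M.mem_kids_of_lt hr (hj.1.trans_le hi)
    rwa [hj.2] at this
  · simp only [Finset.coe_filter, Finset.mem_range, Set.mem_ofPred_eq] at hj hj'
    exact M.inj j (hj.1.trans_le hi) j' (hj'.1.trans_le hi) h

include M hr hnch in
-- The counted entries are distinct children of `p`; if they are as many as the children, they are
-- all the children.
theorem exists_of_cnt_eq {p : ℕ} (hp : p ∈ N) (hV : p ∉ V) (h : cnt p = nch p) {c : ℕ}
    (hc : c ∈ kids r N par p) : ∃ j < i, q j = c := by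
  have hsub : ((Finset.range i).filter fun j => par (q j) = p).image q ⊆ kids r N par p := by
    intro c hc
    simp only [Finset.mem_image, Finset.mem_filter, Finset.mem_range] at hc
    obtain ⟨j, ⟨hj, hj'⟩, rfl⟩ := hc
    have := M.mem_kids_of_lt hr (hj.trans_le M.le)
    rwa [hj'] at this
  have hcard : (((Finset.range i).filter fun j => par (q j) = p).image q).card = cnt p := by
    rw [M.cnt_eq, Finset.card_image_of_injOn]
    intro j hj j' hj' h
    simp only [Finset.coe_filter, Finset.mem_range, Set.mem_ofPred_eq] at hj hj'
    exact M.inj j (hj.1.trans_le M.le) j' (hj'.1.trans_le M.le) h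
  have := Finset.eq_of_subset_of_card_le hsub (by rw [hcard, h, hnch p hp hV])
  rw [← this] at hc
  simp only [Finset.mem_image, Finset.mem_filter, Finset.mem_range] at hc
  obtain ⟨j, ⟨hj, -⟩, hc⟩ := hc
  exact ⟨j, hj, hc⟩

include M in
theorem cnt_succ (p : ℕ) : Function.update cnt (par (q i)) (cnt (par (q i)) + 1) p =
    ((Finset.range (i + 1)).filter fun j => par (q j) = p).card := by
  rw [Finset.range_add_one, Finset.filter_insert, Function.update_apply, M.cnt_eq, M.cnt_eq]
  by_cases h : par (q i) = p
  · subst h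
    rw [if_pos rfl, if_pos rfl, Finset.card_insert_of_notMem (by simp)]
  · rw [if_neg h, if_neg (Ne.symm h)]

include M hr hnch T in
-- The entry `q i` is a child that has not been counted yet. Hence the parent is not in the queue
-- before its counter is raised.
theorem cnt_lt (hi : i < len) : cnt (par (q i)) < nch (par (q i)) := by
  have h1 := M.cnt_succ (par (q i))
  have h2 := M.card_filter_le hr (p := par (q i)) (i' := i + 1) hi
  rw [Function.update_self] at h1
  rw [hnch _ (T.par_mem _ (M.mem i hi)) (T.par_notMem _ (M.mem i hi))]
  omega

include M hr hnch T in
theorem step_of_ne (hi : i < len) (h : cnt (par (q i)) + 1 ≠ nch (par (q i))) :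
    Marked N V par nch D L q (Function.update cnt (par (q i)) (cnt (par (q i)) + 1)) m (i + 1)
      len where
  le := hi
  le_len := M.le_len
  inj := M.inj
  mem := M.mem
  full := M.full
  leaf := M.leaf
  notMem := M.notMem
  cnt_eq := M.cnt_succ
  pushed p hp hpV := by
    rw [M.pushed p hp hpV, Function.update_apply]
    have := M.cnt_lt T hnch hr hi
    split_ifs with h1
    · subst h1
      omega
    · rfl
  order := M.order

include M hr hnch T in
-- When the counter reaches the number of children, all children are in the queue, so the parent is
-- full; by `cnt_lt` it has not been entered before.
theorem step_of_eq (hi : i < len) (h : cnt (par (q i)) + 1 = nch (par (q i))) :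
    Marked N V par nch D L (Function.update q len (par (q i)))
      (Function.update cnt (par (q i)) (cnt (par (q i)) + 1)) m (i + 1) (len + 1) := by
  have hlt := M.cnt_lt T hnch hr hi
  have hpN := T.par_mem _ (M.mem i hi)
  have hpV := T.par_notMem _ (M.mem i hi)
  have hnot : ∀ j < len, q j ≠ par (q i) := by
    intro j hj hji
    have := (M.pushed _ hpN hpV).1 ⟨j, hj, hji⟩
    omega
  have hq : ∀ j, j ≠ len → Function.update q len (par (q i)) j = q j := fun j hj =>
    Function.update_of_ne hj _ _
  have hql : Function.update q len (par (q i)) len = par (q i) := Function.update_self ..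
  have hkids : ∀ c ∈ kids r N par (par (q i)), ∃ j < len, q j = c := by
    have hsub : ((Finset.range (i + 1)).filter fun j => par (q j) = par (q i)).image q ⊆
        kids r N par (par (q i)) := by
      intro c hc
      simp only [Finset.mem_image, Finset.mem_filter, Finset.mem_range] at hc
      obtain ⟨j, ⟨hj, hj'⟩, rfl⟩ := hc
      have := M.mem_kids_of_lt hr (show j < len by omega)
      rwa [hj'] at this
    have hcard : (((Finset.range (i + 1)).filter fun j => par (q j) = par (q i)).image q).card =
        cnt (par (q i)) + 1 := by
      rw [Finset.card_image_of_injOn, ← M.cnt_succ, Function.update_self]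
      intro j hj j' hj' h
      simp only [Finset.coe_filter, Finset.mem_range, Set.mem_ofPred_eq] at hj hj'
      exact M.inj j (by omega) j' (by omega) h
    have := Finset.eq_of_subset_of_card_le hsub (by rw [hcard, h, hnch _ hpN hpV])
    intro c hc
    rw [← this] at hc
    simp only [Finset.mem_image, Finset.mem_filter, Finset.mem_range] at hc
    obtain ⟨j, ⟨hj, -⟩, hc⟩ := hc
    exact ⟨j, by omega, hc⟩
  have hfull : ∀ y ∈ L (par (q i)), D y := by
    intro y hy
    obtain ⟨c, hc, hy⟩ := (T.mem_L _ hpN hpV y).1 hy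
    obtain ⟨j, hj, rfl⟩ := hkids c hc
    exact M.full j hj y hy
  constructor
  · omega
  · exact M.le_len.trans (Nat.le_succ _)
  · intro j hj j' hj' hjj
    have := M.inj j
    have := hnot j
    have := hnot j'
    grind
  · intro j hj
    have := M.mem j
    grind
  · intro j hj
    have := M.full j
    grind
  · intro v hv hDv
    obtain ⟨j, hj, hjv⟩ := M.leaf v hv hDv
    exact ⟨j, by omega, by rw [hq j (by omega), hjv]⟩
  · intro j hj hj'
    have := M.notMem j
    grind
  · intro p
    rw [M.cnt_succ p]
    congr 1
    refine Finset.filter_congr fun j hj => ?_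
    rw [Finset.mem_range] at hj
    rw [hq j (by omega)]
  · intro p hp hpV'
    have h1 := M.pushed p hp hpV'
    rw [Function.update_apply]
    constructor
    · rintro ⟨j, hj, hjp⟩
      have := hnot j
      by_cases hjl : j = len
      · subst hjl
        rw [hql] at hjp
        rw [if_pos hjp.symm, ← hjp, h]
      · rw [hq j hjl] at hjp
        have := h1.1 ⟨j, by omega, hjp⟩
        grind
    · split_ifs with h2
      · exact fun _ => ⟨len, by omega, by rw [hql, h2]⟩
      · intro h3
        obtain ⟨j, hj, hjp⟩ := h1.2 h3
        exact ⟨j, by omega, by rw [hq j (by omega), hjp]⟩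
  · intro j hj j' hj' hjj
    have hpr : par (q i) ≠ r := fun h => hr (h ▸ hfull)
    by_cases hjl : j = len
    · exfalso
      subst hjl
      rw [hql] at hjj
      by_cases hjl' : j' = j
      · subst hjl'
        rw [hql] at hjj
        exact T.par_ne hpN hpr hjj
      -- If the parent of the new entry were in the queue already, then all its children would have
      -- been processed, among them the new entry.
      · rw [hq j' hjl'] at hjj
        have hj'l : j' < j := by omega
        have hmem := M.mem j' hj'l
        have hV : q j' ∉ V := hjj ▸ T.par_notMem _ hpN
        have hcnt := (M.pushed _ hmem hV).1 ⟨j', hj'l, rfl⟩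
        obtain ⟨a, ha, hai⟩ := M.exists_of_cnt_eq hnch hr hmem hV hcnt
          (c := par (q i)) (mem_kids.2 ⟨hpN, hpr, hjj⟩)
        exact hnot a (ha.trans_le M.le) hai
    · rw [hq j hjl] at hjj
      by_cases hjl' : j' = len
      · omega
      · rw [hq j' hjl'] at hjj
        exact M.order j (by omega) j' (by omega) hjj

include M hnch T in
-- Each of the `len - m` inner nodes in the queue accounts for two or more of the `i` processed
-- entries, and distinct nodes for distinct ones. So `2 * (len - m) ≤ i ≤ len`.
theorem len_le : len ≤ 2 * m := by
  let P := (Finset.Ico m len).image q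
  have hP : P.card = len - m := by
    rw [Finset.card_image_of_injOn, Nat.card_Ico]
    intro j hj j' hj' h
    simp only [Finset.coe_Ico, Set.mem_Ico] at hj hj'
    exact M.inj j hj.2 j' hj'.2 h
  have h2 : ∀ p ∈ P, 2 ≤ ((Finset.range i).filter fun j => par (q j) = p).card := by
    intro p hp
    simp only [P, Finset.mem_image, Finset.mem_Ico] at hp
    obtain ⟨j, ⟨hj, hj'⟩, rfl⟩ := hp
    have h1 := M.notMem j hj' hj
    have h3 := M.mem j hj'
    rw [← M.cnt_eq, (M.pushed _ h3 h1).1 ⟨j, hj', rfl⟩, hnch _ h3 h1]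
    exact T.two_le _ h3 h1
  have h3 : P.card * 2 ≤ ∑ p ∈ P, ((Finset.range i).filter fun j => par (q j) = p).card := by
    have := Finset.sum_le_sum h2
    simpa using this
  have h4 : ∑ p ∈ P, ((Finset.range i).filter fun j => par (q j) = p).card ≤ i := by
    rw [← Finset.card_biUnion]
    · simpa using Finset.card_le_card (s := P.biUnion fun p =>
        (Finset.range i).filter fun j => par (q j) = p) (t := Finset.range i)
        (Finset.biUnion_subset.2 fun p _ => Finset.filter_subset _ _)
    · intro p _ p' _ hne
      exact Finset.disjoint_filter.2 fun j _ h h' => hne (h.symm.trans h')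
  have := M.le
  have := M.le_len
  omega

variable (M' : Marked N V par nch D L q cnt m len len)

include M' hnch T in
-- Once the queue is exhausted, induction from the leaves upwards shows that no full node has been
-- missed: the counter of a node whose children are all in the queue has reached its final value.
theorem full_iff_exists {c : ℕ} (hc : c ∈ N) : (∀ y ∈ L c, D y) ↔ ∃ j < len, q j = c := by
  constructor
  · refine T.kids_induction (P := fun c => (∀ y ∈ L c, D y) → ∃ j < len, q j = c)
      (fun v hv h => M'.leaf v hv (h v (by simp [T.L_leaf v hv]))) (fun p hp hV ih h => ?_) c hc
    have hk : ∀ c ∈ kids r N par p, ∃ j < len, q j = c := fun c hc =>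
      ih c hc fun y hy => h y (T.subset_of_mem_kids hc hy)
    rw [M'.pushed p hp hV, M'.cnt_eq]
    apply le_antisymm
    · by_cases hr : ∀ y ∈ L r, D y
      · rw [hnch p hp hV]
        refine Finset.card_le_card_of_injOn q (fun j hj => ?_) fun j hj j' hj' h => ?_
        · simp only [Finset.coe_filter, Finset.mem_range, Set.mem_ofPred_eq] at hj
          -- The root is its own parent, so `order` keeps it out of the queue.
          refine mem_kids.2 ⟨M'.mem j hj.1, fun hjr => ?_, hj.2⟩
          have hpr : p = r := by rw [← hj.2, hjr, T.par_root]
          have := M'.order j hj.1 j hj.1 (by rw [hj.2, hpr, hjr])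
          omega
        · simp only [Finset.coe_filter, Finset.mem_range, Set.mem_ofPred_eq] at hj hj'
          exact M'.inj j hj.1 j' hj'.1 h
      · exact (M'.card_filter_le hr le_rfl).trans (hnch p hp hV).ge
    · rw [hnch p hp hV]
      have : kids r N par p ⊆ ((Finset.range len).filter fun j => par (q j) = p).image q := by
        intro c hc
        obtain ⟨j, hj, rfl⟩ := hk c hc
        simp only [Finset.mem_image, Finset.mem_filter, Finset.mem_range]
        exact ⟨j, ⟨hj, (mem_kids.1 hc).2.2⟩, rfl⟩
      exact (Finset.card_le_card this).trans Finset.card_image_le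
  · rintro ⟨j, hj, rfl⟩
    exact M'.full j hj

end Marked

variable {G : SimpleGraph ℕ} {r e : ℕ} {N V : Finset ℕ} {par ser nch : ℕ → ℕ}
  {L : ℕ → Finset ℕ} {q cnt : ℕ → ℕ} {m len x : ℕ}

theorem Marked.image_eq_fullKids (T : IsCotree G r N V par ser L e)
    (hnch : ∀ p ∈ N, p ∉ V → nch p = (kids r N par p).card) (hr : ¬ Full G x L r)
    (M : Marked N V par nch (G.Adj x) L q cnt m len len) (p : ℕ) :
    ((Finset.range len).filter fun j => par (q j) = p).image q = fullKids G r N par L x p := by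
  ext c
  simp only [Finset.mem_image, Finset.mem_filter, Finset.mem_range, mem_fullKids]
  constructor
  · rintro ⟨j, ⟨hj, rfl⟩, rfl⟩
    exact ⟨M.mem_kids_of_lt hr hj, M.full j hj⟩
  · rintro ⟨h1, h2⟩
    obtain ⟨j, hj, rfl⟩ := (M.full_iff_exists T hnch (mem_kids.1 h1).1).1 h2
    exact ⟨j, ⟨hj, (mem_kids.1 h1).2.2⟩, rfl⟩

theorem Marked.cnt_eq_card_fullKids (T : IsCotree G r N V par ser L e)
    (hnch : ∀ p ∈ N, p ∉ V → nch p = (kids r N par p).card) (hr : ¬ Full G x L r)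
    (M : Marked N V par nch (G.Adj x) L q cnt m len len) (p : ℕ) :
    cnt p = (fullKids G r N par L x p).card := by
  rw [← M.image_eq_fullKids T hnch hr p, M.cnt_eq, Finset.card_image_of_injOn]
  intro j hj j' hj' h
  simp only [Finset.coe_filter, Finset.mem_range, Set.mem_ofPred_eq] at hj hj'
  exact M.inj j hj.1 j' hj'.1 h

end Cotree

/-! ### The program -/

namespace Algo

open WordRAM Cotree

/-- The registers outside of `R` and the arrays outside of `A` agree. -/
def Frame (R A : List ℕ) (s s' : State) : Prop :=
  (∀ y, y ∉ R → s'.reg y = s.reg y) ∧ ∀ a, a ∉ A → s'.arr a = s.arr a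

theorem Frame.refl (R A : List ℕ) (s : State) : Frame R A s s := ⟨fun _ _ => rfl, fun _ _ => rfl⟩

theorem Frame.trans {R A : List ℕ} {s s' s'' : State} (h : Frame R A s s') (h' : Frame R A s' s'') :
    Frame R A s s'' :=
  ⟨fun y hy => (h'.1 y hy).trans (h.1 y hy), fun a ha => (h'.2 a ha).trans (h.2 a ha)⟩

theorem Frame.mono {R R' A A' : List ℕ} {s s' : State} (h : Frame R A s s') (hR : R ⊆ R')
    (hA : A ⊆ A') : Frame R' A' s s' :=
  ⟨fun y hy => h.1 y fun h => hy (hR h), fun a ha => h.2 a fun h => ha (hA h)⟩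

theorem frame_setReg {R A : List ℕ} {s s' : State} {x v : ℕ} (hx : x ∈ R) :
    Frame R A s (s'.setReg x v) ↔ Frame R A s s' := by
  refine and_congr_left fun _ => forall₂_congr fun y hy => ?_
  rw [State.reg_setReg, if_neg (by rintro rfl; exact hy hx)]

theorem frame_setArr {R A : List ℕ} {s s' : State} {a i v : ℕ} (ha : a ∈ A) :
    Frame R A s (s'.setArr a i v) ↔ Frame R A s s' := by
  refine and_congr_right fun _ => forall₂_congr fun b hb => ?_
  rw [State.arr_setArr, if_neg (by rintro rfl; exact hb ha)]

/-- The body of the loop that propagates marks. -/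
def markBody : Prog :=
  .seq (.assign 5 (.read 8 (.reg 3))) <|
  .seq (.assign 6 (.read 2 (.reg 5))) <|
  .seq (.store 6 (.reg 6) (.add (.read 6 (.reg 6)) (.const 1))) <|
  .seq (.ite (.eq (.read 6 (.reg 6)) (.read 4 (.reg 6)))
    (.seq (.store 8 (.reg 4) (.reg 6)) (.assign 4 (.add (.reg 4) (.const 1)))) .skip) <|
  .assign 3 (.add (.reg 3) (.const 1))

/-- The memory layout of all programs below. Registers: 0 is `n` and finally the result, 1 is `k`, 2
the new vertex, 3 a loop index, 4 the length of the queue, 5, 6 and 15 scratch, 7 the place, 8, 9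
and 10 the number, the last and the sum of its full children, 11 the next fresh name, 12 the
modulus, 13 the root, 14 the split-off node, 16 the target of the insertion, 17 the kind of the new
node above it, 18 a flag that demands this node. Arrays: 0 and 1 the adjacency lists, 2 parents, 3
kinds, 4 numbers of children, 5 sums of children, 6 counters of full children, 7 stamps, 8 the
queue, 9 and 10 orders and rainbow numbers. -/
def markLoop : Prog := .loop (.lt (.reg 3) (.reg 4)) markBody

theorem runs_markLoop {B m : ℕ} {G : SimpleGraph ℕ} {r e : ℕ} {N V : Finset ℕ}
    {ser : ℕ → ℕ} {L : ℕ → Finset ℕ} {D : ℕ → Prop} {s : State}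
    (T : IsCotree G r N V (s.arr 2) ser L e)
    (hnch : ∀ p ∈ N, p ∉ V → s.arr 4 p = (kids r N (s.arr 2) p).card)
    (hr : ¬ ∀ y ∈ L r, D y)
    (M : Marked N V (s.arr 2) (s.arr 4) D L (s.arr 8) (s.arr 6) m 0 m)
    (hi : s.reg 3 = 0) (hlen : s.reg 4 = m) (hN : ∀ c ∈ N, c ≤ B) (hm : 2 * m ≤ B) :
    Runs B markLoop s ((2 * m + 1) * (markBody.maxTime + 3)) fun s' =>
      Frame [3, 4, 5, 6] [6, 8] s s' ∧
      Marked N V (s.arr 2) (s.arr 4) D L (s'.arr 8) (s'.arr 6) m (s'.reg 4) (s'.reg 4) := by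
  refine (Runs.loop_of_measure (K := markBody.maxTime) (fun s' => Frame [3, 4, 5, 6] [6, 8] s s' ∧
      Marked N V (s.arr 2) (s.arr 4) D L (s'.arr 8) (s'.arr 6) m (s'.reg 3) (s'.reg 4))
      -- The queue grows during the loop, but `Marked.len_le` bounds its length once and for all.
      (fun s' => 2 * m - s'.reg 3) ?_ ⟨Frame.refl _ _ _, ?_⟩).mono ?_ ?_
  · rintro s' ⟨hF, M'⟩ hb
    simp only [Test.holds, Expr.eval] at hb
    have hlen := M'.len_le T hnch
    have h2 : s'.arr 2 = s.arr 2 := hF.2 2 (by simp)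
    have h4 : s'.arr 4 = s.arr 4 := hF.2 4 (by simp)
    have hc := M'.mem _ hb
    have hp := T.par_mem _ hc
    have hcB := hN _ hc
    have hpB := hN _ hp
    have hcnt : s'.arr 6 (s.arr 2 (s'.arr 8 (s'.reg 3))) + 1 ≤ B := by
      have := (Finset.card_filter_le (Finset.range (s'.reg 3))
        fun j => s.arr 2 (s'.arr 8 j) = s.arr 2 (s'.arr 8 (s'.reg 3))).trans (Finset.card_range _).le
      rw [← M'.cnt_eq] at this
      omega
    refine Runs.of_wp ?_
    simp only [markBody, Prog.wp, Expr.eval, Test.holds, State.reg_setReg, State.arr_setReg,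
      State.reg_setArr, State.arr_setArr, h2, h4]
    simp only [Nat.reduceEqDiff, if_true, if_false, Function.update_self]
    refine ⟨hcB, hpB, hcnt, fun h => ?_, fun h => ?_⟩
    · have M'' := M'.step_of_eq T hnch hr hb h
      have := M''.len_le T hnch
      exact ⟨hpB, by omega, by omega, ⟨by simp [frame_setReg, frame_setArr, hF], M''⟩, by omega⟩
    · exact ⟨by omega, ⟨by simp [frame_setReg, frame_setArr, hF], M'.step_of_ne T hnch hr hb h⟩,
        by omega⟩
  · rw [hi, hlen]
    exact M
  · rw [hi]
    simp [Test.time, Expr.time]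
  · rintro s' ⟨⟨hF, M'⟩, hb⟩
    simp only [Test.holds, Expr.eval] at hb
    refine ⟨hF, ?_⟩
    have := M'.le
    have h : s'.reg 3 = s'.reg 4 := by omega
    rw [h] at M'
    assumption

/-- The body of the loop that finds out which nodes are above touched nodes. -/
def lowBody : Prog :=
  .seq (.assign 6 (.read 2 (.read 8 (.reg 3)))) <|
  .seq (.ite (.lt (.read 6 (.reg 6)) (.read 4 (.reg 6)))
    (.seq (.store 7 (.read 2 (.reg 6)) (.add (.reg 2) (.const 1)))
      (.store 7 (.read 2 (.read 2 (.reg 6))) (.add (.reg 2) (.const 1)))) .skip) <|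
  .assign 3 (.add (.reg 3) (.const 1))

def lowLoop : Prog := .loop (.lt (.reg 3) (.reg 4)) lowBody

/-- The parent of the `j`-th entry of the queue. -/
def qpar (s : State) (j : ℕ) : ℕ := s.arr 2 (s.arr 8 j)

/-- The stamp is the number of the vertex plus one. Stamps of earlier vertices are smaller, so array
7 need not be cleared between insertions. -/
theorem runs_lowLoop {B : ℕ} {s : State} (hi : s.reg 3 = 0) (hlen : s.reg 4 ≤ B)
    (hq : ∀ j < s.reg 4, qpar s j ≤ B) (hx : s.reg 2 + 1 ≤ B) (hlow : ∀ y, s.arr 7 y ≤ s.reg 2) :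
    Runs B lowLoop s ((s.reg 4 + 1) * (lowBody.maxTime + 3)) fun s' =>
      Frame [3, 6] [7] s s' ∧ (∀ y, s'.arr 7 y ≤ s.reg 2 + 1) ∧
      ∀ y, s'.arr 7 y = s.reg 2 + 1 ↔ ∃ j < s.reg 4,
        s.arr 6 (qpar s j) < s.arr 4 (qpar s j) ∧
          (y = s.arr 2 (qpar s j) ∨ y = s.arr 2 (s.arr 2 (qpar s j))) := by
  refine (Runs.loop_of_measure (K := lowBody.maxTime) (fun s' => Frame [3, 6] [7] s s' ∧
      s'.reg 3 ≤ s.reg 4 ∧ (∀ y, s'.arr 7 y ≤ s.reg 2 + 1) ∧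
      ∀ y, s'.arr 7 y = s.reg 2 + 1 ↔ ∃ j < s'.reg 3,
        s.arr 6 (qpar s j) < s.arr 4 (qpar s j) ∧
          (y = s.arr 2 (qpar s j) ∨ y = s.arr 2 (s.arr 2 (qpar s j))))
      (fun s' => s.reg 4 - s'.reg 3) ?_ ⟨Frame.refl _ _ _, ?_, ?_, ?_⟩).mono ?_ ?_
  · rintro s' ⟨hF, hle, hb, hs⟩ hlt
    have h2 : s'.arr 2 = s.arr 2 := hF.2 2 (by simp)
    have h4 : s'.arr 4 = s.arr 4 := hF.2 4 (by simp)
    have h6 : s'.arr 6 = s.arr 6 := hF.2 6 (by simp)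
    have h8 : s'.arr 8 = s.arr 8 := hF.2 8 (by simp)
    have hr2 : s'.reg 2 = s.reg 2 := hF.1 2 (by simp)
    have hr4 : s'.reg 4 = s.reg 4 := hF.1 4 (by simp)
    simp only [Test.holds, Expr.eval, hr4] at hlt
    have hqB := hq _ hlt
    refine Runs.of_wp ?_
    simp only [lowBody, Prog.wp, Expr.eval, Test.holds, State.reg_setReg, State.arr_setReg,
      State.reg_setArr, State.arr_setArr, h2, h4, h6, h8, hr2]
    simp only [Nat.reduceEqDiff, if_true, if_false]
    simp only [qpar] at *
    refine ⟨hqB, fun h => ⟨hx, hx, by omega, ⟨by simp [frame_setReg, frame_setArr, hF], by omega,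
      fun y => ?_, fun y => ?_⟩, by omega⟩, fun h => ⟨by omega,
      ⟨by simp [frame_setReg, hF], by omega, hb, fun y => ?_⟩, by omega⟩⟩
    · have := hb y
      simp only [Function.update_apply]
      grind
    · have := hs y
      simp only [Function.update_apply, Nat.lt_succ_iff_lt_or_eq, or_and_right, exists_or,
        exists_eq_left]
      grind
    · have := hs y
      simp only [Nat.lt_succ_iff_lt_or_eq, or_and_right, exists_or, exists_eq_left]
      grind
  · omega
  · exact fun y => (hlow y).trans (Nat.le_succ _)
  · intro y
    have := hlow y
    simp only [hi]
    constructor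
    · omega
    · rintro ⟨j, hj, -⟩
      omega
  · rw [hi]
    simp [Test.time, Expr.time]
  · rintro s' ⟨⟨hF, hle, hb, hs⟩, hlt⟩
    have hr4 : s'.reg 4 = s.reg 4 := hF.1 4 (by simp)
    simp only [Test.holds, Expr.eval, hr4] at hlt
    refine ⟨hF, hb, ?_⟩
    rwa [show s'.reg 3 = s.reg 4 by omega] at hs

/-- The body of the loop that finds the place of the new vertex. -/
def findBody : Prog :=
  .seq (.assign 6 (.read 2 (.read 8 (.reg 3)))) <|
  .seq (.ite (.lt (.read 6 (.reg 6)) (.read 4 (.reg 6)))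
    (.ite (.eq (.read 7 (.reg 6)) (.add (.reg 2) (.const 1))) .skip (.assign 7 (.reg 6))) .skip) <|
  .assign 3 (.add (.reg 3) (.const 1))

def findLoop : Prog := .loop (.lt (.reg 3) (.reg 4)) findBody

/-- The value of register 7 before the loop is the default. It will be the root, which is the place
whenever no touched node passes the test. -/
theorem runs_findLoop {B : ℕ} {s : State} (hi : s.reg 3 = 0) (hlen : s.reg 4 ≤ B)
    (hq : ∀ j < s.reg 4, qpar s j ≤ B) :
    Runs B findLoop s ((s.reg 4 + 1) * (findBody.maxTime + 3)) fun s' =>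
      Frame [3, 6, 7] [] s s' ∧
      ((s'.reg 7 = s.reg 7 ∧ ∀ j < s.reg 4, s.arr 6 (qpar s j) < s.arr 4 (qpar s j) →
        s.arr 7 (qpar s j) = s.reg 2 + 1) ∨
      ∃ j < s.reg 4, s.arr 6 (qpar s j) < s.arr 4 (qpar s j) ∧
        s.arr 7 (qpar s j) ≠ s.reg 2 + 1 ∧ s'.reg 7 = qpar s j) := by
  refine (Runs.loop_of_measure (K := findBody.maxTime) (fun s' => Frame [3, 6, 7] [] s s' ∧
      s'.reg 3 ≤ s.reg 4 ∧
      ((s'.reg 7 = s.reg 7 ∧ ∀ j < s'.reg 3, s.arr 6 (qpar s j) < s.arr 4 (qpar s j) →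
        s.arr 7 (qpar s j) = s.reg 2 + 1) ∨
      ∃ j < s'.reg 3, s.arr 6 (qpar s j) < s.arr 4 (qpar s j) ∧
        s.arr 7 (qpar s j) ≠ s.reg 2 + 1 ∧ s'.reg 7 = qpar s j))
      (fun s' => s.reg 4 - s'.reg 3) ?_ ⟨Frame.refl _ _ _, ?_, ?_⟩).mono ?_ ?_
  · rintro s' ⟨hF, hle, hs⟩ hlt
    have h2 : s'.arr 2 = s.arr 2 := hF.2 2 (by simp)
    have h4 : s'.arr 4 = s.arr 4 := hF.2 4 (by simp)
    have h6 : s'.arr 6 = s.arr 6 := hF.2 6 (by simp)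
    have h7 : s'.arr 7 = s.arr 7 := hF.2 7 (by simp)
    have h8 : s'.arr 8 = s.arr 8 := hF.2 8 (by simp)
    have hr2 : s'.reg 2 = s.reg 2 := hF.1 2 (by simp)
    have hr4 : s'.reg 4 = s.reg 4 := hF.1 4 (by simp)
    simp only [Test.holds, Expr.eval, hr4] at hlt
    have hqB := hq _ hlt
    refine Runs.of_wp ?_
    simp only [findBody, Prog.wp, Expr.eval, Test.holds, State.reg_setReg, State.arr_setReg,
      h2, h4, h6, h7, h8, hr2]
    simp only [Nat.reduceEqDiff, if_true, if_false]
    simp only [qpar] at *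
    refine ⟨hqB, fun h => ⟨fun h' => ⟨by omega, ⟨by simp [frame_setReg, hF], by omega, ?_⟩,
      by omega⟩, fun h' => ⟨hqB, by omega, ⟨by simp [frame_setReg, hF], by omega, ?_⟩,
      by omega⟩⟩, fun h => ⟨by omega, ⟨by simp [frame_setReg, hF], by omega, ?_⟩, by omega⟩⟩
    · simp only [Nat.lt_succ_iff_lt_or_eq, or_and_right, exists_or, exists_eq_left]
      grind
    · exact .inr ⟨_, Nat.lt_succ_self _, h, h', rfl⟩
    · simp only [Nat.lt_succ_iff_lt_or_eq, or_and_right, exists_or, exists_eq_left]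
      grind
  · omega
  · left
    simp only [hi, true_and]
    omega
  · rw [hi]
    simp [Test.time, Expr.time]
  · rintro s' ⟨⟨hF, hle, hs⟩, hlt⟩
    have hr4 : s'.reg 4 = s.reg 4 := hF.1 4 (by simp)
    simp only [Test.holds, Expr.eval, hr4] at hlt
    refine ⟨hF, ?_⟩
    rwa [show s'.reg 3 = s.reg 4 by omega] at hs

/-- Reduction of register 15 modulo register 12, for numbers below twice the modulus. -/
def reduce : Prog :=
  -- The idle assignment gives both branches a final state of the form `s.setReg 15 v`.
  .ite (.lt (.reg 15) (.reg 12)) (.assign 15 (.reg 15)) (.assign 15 (.sub (.reg 15) (.reg 12)))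

theorem wp_reduce {B M : ℕ} {s : State} {Q : State → Prop} (hM : s.reg 12 = M)
    (h : s.reg 15 < 2 * M) (hB : M ≤ B)
    (hQ : ∀ v, v < M → (v : ZMod M) = s.reg 15 → Q (s.setReg 15 v)) :
    reduce.wp B Q s := by
  subst hM
  simp only [reduce, Prog.wp, Expr.eval, Test.holds]
  refine ⟨fun h' => ⟨by omega, hQ _ h' rfl⟩, fun h' => ⟨by omega, hQ _ (by omega) ?_⟩⟩
  rw [Nat.cast_sub (by omega)]
  simp

/-- The body of the loop that clears the counters and collects the full children of the place. -/
def collectBody : Prog :=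
  .seq (.assign 5 (.read 8 (.reg 3))) <|
  .seq (.assign 6 (.read 2 (.reg 5))) <|
  .seq (.store 6 (.reg 6) (.const 0)) <|
  .seq (.assign 3 (.add (.reg 3) (.const 1))) <|
  .ite (.eq (.reg 6) (.reg 7))
    (.seq (.assign 9 (.reg 5)) <| .seq (.assign 15 (.add (.reg 10) (.reg 5))) <|
      .seq reduce <| .assign 10 (.reg 15)) .skip

def collectLoop : Prog := .loop (.lt (.reg 3) (.reg 4)) collectBody

/-- Only the cells at parents of queue entries are cleared. After the marking no other counter is
positive, so the counters are reset in time proportional to the queue instead of the tree. -/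
theorem runs_collectLoop {B : ℕ} {s : State} (hi : s.reg 3 = 0) (hlen : s.reg 4 ≤ B)
    (hq : ∀ j < s.reg 4, qpar s j ≤ B) (hqM : ∀ j < s.reg 4, s.arr 8 j < s.reg 12)
    (hM : 2 * s.reg 12 ≤ B) (hS : s.reg 10 = 0) (hM0 : 0 < s.reg 12) :
    Runs B collectLoop s ((s.reg 4 + 1) * (collectBody.maxTime + 3)) fun s' =>
      Frame [3, 5, 6, 9, 10, 15] [6] s s' ∧
      (∀ y, s'.arr 6 y = if ∃ j < s.reg 4, qpar s j = y then 0 else s.arr 6 y) ∧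
      s'.reg 10 < s.reg 12 ∧ (s'.reg 10 : ZMod (s.reg 12)) =
        ∑ j ∈ (Finset.range (s.reg 4)).filter fun j => qpar s j = s.reg 7, (s.arr 8 j : ZMod _) ∧
      ((∃ j < s.reg 4, qpar s j = s.reg 7) →
        ∃ j < s.reg 4, qpar s j = s.reg 7 ∧ s'.reg 9 = s.arr 8 j) := by
  refine (Runs.loop_of_measure (K := collectBody.maxTime) (fun s' =>
      Frame [3, 5, 6, 9, 10, 15] [6] s s' ∧ s'.reg 3 ≤ s.reg 4 ∧
      (∀ y, s'.arr 6 y = if ∃ j < s'.reg 3, qpar s j = y then 0 else s.arr 6 y) ∧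
      s'.reg 10 < s.reg 12 ∧ (s'.reg 10 : ZMod (s.reg 12)) =
        ∑ j ∈ (Finset.range (s'.reg 3)).filter fun j => qpar s j = s.reg 7, (s.arr 8 j : ZMod _) ∧
      ((∃ j < s'.reg 3, qpar s j = s.reg 7) →
        ∃ j < s'.reg 3, qpar s j = s.reg 7 ∧ s'.reg 9 = s.arr 8 j))
      (fun s' => s.reg 4 - s'.reg 3) ?_ ⟨Frame.refl _ _ _, ?_, ?_, ?_, ?_, ?_⟩).mono ?_ ?_
  · rintro s' ⟨hF, hle, h0, hSM, hsum, hC⟩ hlt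
    have h2 : s'.arr 2 = s.arr 2 := hF.2 2 (by simp)
    have h8 : s'.arr 8 = s.arr 8 := hF.2 8 (by simp)
    have hr4 : s'.reg 4 = s.reg 4 := hF.1 4 (by simp)
    have hr7 : s'.reg 7 = s.reg 7 := hF.1 7 (by simp)
    have hr12 : s'.reg 12 = s.reg 12 := hF.1 12 (by simp)
    simp only [Test.holds, Expr.eval, hr4] at hlt
    have hqB := hq _ hlt
    have hqMj := hqM _ hlt
    refine Runs.of_wp ?_
    have hcnt : ∀ y, Function.update (s'.arr 6) (qpar s (s'.reg 3)) 0 y =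
        if ∃ j < s'.reg 3 + 1, qpar s j = y then 0 else s.arr 6 y := by
      intro y
      have := h0 y
      simp only [Function.update_apply, Nat.lt_succ_iff_lt_or_eq, or_and_right, exists_or,
        exists_eq_left]
      grind
    simp only [collectBody, Prog.wp, Expr.eval, Test.holds, State.reg_setReg, State.arr_setReg,
      State.reg_setArr, State.arr_setArr, h2, h8, hr7]
    simp only [Nat.reduceEqDiff, if_true, if_false]
    refine ⟨by omega, hqB, by omega, by omega, fun h => ⟨by omega, by omega, ?_⟩, fun h => ?_⟩
    · refine wp_reduce (M := s.reg 12) ?_ ?_ (by omega) fun v hv hv' => ?_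
      · simp only [State.reg_setReg, State.reg_setArr, Nat.reduceEqDiff, if_false, hr12]
      · simp only [State.reg_setReg, State.reg_setArr, Nat.reduceEqDiff, if_true, if_false]
        omega
      simp only [State.reg_setReg, State.reg_setArr, Nat.reduceEqDiff, if_true, if_false] at hv'
      simp only [State.reg_setReg, State.arr_setReg,
        State.reg_setArr, State.arr_setArr]
      simp only [Nat.reduceEqDiff, if_true, if_false]
      refine ⟨by omega, ⟨by simp [frame_setReg, frame_setArr, hF], by omega, hcnt, hv, ?_, fun _ =>
        ⟨s'.reg 3, by omega, h, rfl⟩⟩, by omega⟩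
      rw [hv', Finset.range_add_one, Finset.filter_insert,
          if_pos (show qpar s (s'.reg 3) = s.reg 7 from h),
        Finset.sum_insert (by simp), ← hsum, Nat.cast_add, add_comm]
    · refine ⟨⟨by simp [frame_setReg, frame_setArr, hF], by omega, hcnt, hSM, ?_, ?_⟩, by omega⟩
      · rw [Finset.range_add_one, Finset.filter_insert,
          if_neg (show ¬ qpar s (s'.reg 3) = s.reg 7 from h), hsum]
      · change ¬ qpar s (s'.reg 3) = s.reg 7 at h
        simp only [Nat.lt_succ_iff_lt_or_eq, or_and_right, exists_or, exists_eq_left, h, or_false,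
          false_and]
        exact hC
  · omega
  · simp [hi]
  · omega
  · simp [hi, hS]
  · simp [hi]
  · rw [hi]
    simp [Test.time, Expr.time]
  · rintro s' ⟨⟨hF, hle, hs⟩, hlt⟩
    have hr4 : s'.reg 4 = s.reg 4 := hF.1 4 (by simp)
    simp only [Test.holds, Expr.eval, hr4] at hlt
    refine ⟨hF, ?_⟩
    rwa [show s'.reg 3 = s.reg 4 by omega] at hs

/-- The body of the loop that moves the full children of the place to register 14. -/
def moveBody : Prog :=
  .seq (.assign 5 (.read 8 (.reg 3))) <|
  .seq (.ite (.eq (.read 2 (.reg 5)) (.reg 7)) (.store 2 (.reg 5) (.reg 14)) .skip) <|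
  .assign 3 (.add (.reg 3) (.const 1))

def moveLoop : Prog := .loop (.lt (.reg 3) (.reg 4)) moveBody

theorem runs_moveLoop {B : ℕ} {s : State} (hi : s.reg 3 = 0) (hlen : s.reg 4 ≤ B)
    (hq : ∀ j < s.reg 4, s.arr 8 j ≤ B) (hw : s.reg 14 ≤ B) :
    Runs B moveLoop s ((s.reg 4 + 1) * (moveBody.maxTime + 3)) fun s' =>
      Frame [3, 5] [2] s s' ∧
      ∀ y, s'.arr 2 y = if ∃ j < s.reg 4, s.arr 8 j = y ∧ s.arr 2 y = s.reg 7 then s.reg 14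
        else s.arr 2 y := by
  refine (Runs.loop_of_measure (K := moveBody.maxTime) (fun s' => Frame [3, 5] [2] s s' ∧
      s'.reg 3 ≤ s.reg 4 ∧
      ∀ y, s'.arr 2 y = if ∃ j < s'.reg 3, s.arr 8 j = y ∧ s.arr 2 y = s.reg 7 then s.reg 14
        else s.arr 2 y)
      (fun s' => s.reg 4 - s'.reg 3) ?_ ⟨Frame.refl _ _ _, ?_, ?_⟩).mono ?_ ?_
  · rintro s' ⟨hF, hle, hs⟩ hlt
    have h8 : s'.arr 8 = s.arr 8 := hF.2 8 (by simp)
    have hr4 : s'.reg 4 = s.reg 4 := hF.1 4 (by simp)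
    have hr7 : s'.reg 7 = s.reg 7 := hF.1 7 (by simp)
    have hr14 : s'.reg 14 = s.reg 14 := hF.1 14 (by simp)
    simp only [Test.holds, Expr.eval, hr4] at hlt
    have hqB := hq _ hlt
    refine Runs.of_wp ?_
    simp only [moveBody, Prog.wp, Expr.eval, Test.holds, State.reg_setReg, State.arr_setReg,
      State.reg_setArr, State.arr_setArr, h8, hr7, hr14]
    simp only [Nat.reduceEqDiff, if_true, if_false]
    refine ⟨hqB, fun h => ⟨hw, by omega, ⟨by simp [frame_setReg, frame_setArr, hF], by omega,
      fun y => ?_⟩, by omega⟩, fun h => ⟨by omega, ⟨by simp [frame_setReg, hF], by omega,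
      fun y => ?_⟩, by omega⟩⟩
    · have := hs y
      simp only [Function.update_apply, Nat.lt_succ_iff_lt_or_eq, or_and_right, exists_or,
        exists_eq_left]
      grind
    · have h1 := hs y
      simp only [Nat.lt_succ_iff_lt_or_eq, or_and_right, exists_or, exists_eq_left]
      by_cases hy : ∃ j < s'.reg 3, s.arr 8 j = y ∧ s.arr 2 y = s.reg 7
      · rw [if_pos hy] at h1
        rw [if_pos (.inl hy), h1]
      · rw [if_neg hy] at h1
        rw [if_neg, h1]
        rintro (h2 | ⟨h2, h3⟩)
        · exact hy h2
        · rw [h2, h1] at h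
          exact h h3
  · omega
  · simp [hi]
  · rw [hi]
    simp [Test.time, Expr.time]
  · rintro s' ⟨⟨hF, hle, hs⟩, hlt⟩
    have hr4 : s'.reg 4 = s.reg 4 := hF.1 4 (by simp)
    simp only [Test.holds, Expr.eval, hr4] at hlt
    refine ⟨hF, ?_⟩
    rwa [show s'.reg 3 = s.reg 4 by omega] at hs

end Algo

/-! ### Numbers and sums of children under changes of the tree. -/

namespace Cotree

/-- The arrays `nch` and `csum` hold the numbers of children and the sums of the children modulo
`M` of the inner nodes. -/
def Counts (r M : ℕ) (N V : Finset ℕ) (par nch csum : ℕ → ℕ) : Prop :=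
  ∀ p ∈ N, p ∉ V → nch p = (kids r N par p).card ∧ csum p < M ∧
    (csum p : ZMod M) = ∑ c ∈ kids r N par p, (c : ZMod M)

namespace Counts

variable {r M : ℕ} {N V X : Finset ℕ} {par nch csum : ℕ → ℕ} {x t s u w v v₁ v₂ v₃ : ℕ}

theorem attach (C : Counts r M N V par nch csum) (hx : x ∉ N) (hr : r ∈ N) (ht : t ∈ N)
    (htV : t ∉ V) (hv : v < M) (hv' : (v : ZMod M) = csum t + x) :
    Counts r M (insert x N) (insert x V) (Function.update par x t)
      (Function.update nch t (nch t + 1)) (Function.update csum t v) := by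
  have hxr : x ≠ r := fun h => hx (h ▸ hr)
  intro p hp hpV
  have hpN : p ∈ N := by grind
  obtain ⟨h1, h2, h3⟩ := C p hpN (by grind)
  rw [kids_attach hx hxr, Function.update_apply, Function.update_apply]
  split_ifs with h
  · subst h
    have hxk : x ∉ kids r N par p := fun h => hx (mem_kids.1 h).1
    rw [Finset.card_insert_of_notMem hxk, Finset.sum_insert hxk, ← h3, h1, add_comm (x : ZMod M)]
    exact ⟨rfl, hv, hv'⟩
  · exact ⟨h1, h2, h3⟩

/-- Among the children of `par t`, the node `s` replaces `t`: their sum changes, their number does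
not. -/
theorem above (C : Counts r M N V par nch csum) (hx : x ∉ N) (hs : s ∉ N) (hsx : s ≠ x)
    (hr : r ∈ N) (ht : t ∈ N) (htr : t ≠ r) (hp : ∀ c ∈ N, par c ∈ N) (hpV : par t ∉ V)
    (hv₁ : v₁ < M) (hv₁' : (v₁ : ZMod M) = t + x) (hv₂ : v₂ < M)
    (hv₂' : (v₂ : ZMod M) = csum (par t) - t + s) :
    Counts r M (insert s (insert x N)) (insert x V) (parAbove par t s x)
      (Function.update nch s 2)
      (Function.update (Function.update csum s v₁) (par t) v₂) := by
  have htx : t ≠ x := fun h => hx (h ▸ ht)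
  have hps : par t ≠ s := fun h => hs (h ▸ hp t ht)
  have htk : t ∈ kids r N par (par t) := mem_kids.2 ⟨ht, htr, rfl⟩
  intro p hpN hpV'
  rw [kids_above hx hs hsx hr ht htr hp]
  split_ifs with h h'
  · subst h
    rw [Function.update_self, Function.update_of_ne hps.symm, Function.update_self,
      Finset.card_pair htx, Finset.sum_pair htx]
    exact ⟨rfl, hv₁, hv₁'⟩
  · subst h'
    obtain ⟨h1, h2, h3⟩ := C (par t) (hp t ht) hpV
    have hsk : s ∉ (kids r N par (par t)).erase t := fun h =>
      hs (mem_kids.1 (Finset.mem_of_mem_erase h)).1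
    rw [Function.update_of_ne h, Function.update_self, Finset.card_insert_of_notMem hsk,
      Finset.card_erase_of_mem htk, Finset.sum_insert hsk, Finset.sum_erase_eq_sub htk, ← h3, h1]
    have := Finset.card_pos.2 ⟨t, htk⟩
    exact ⟨by omega, hv₂, by rw [hv₂']; ring⟩
  · rw [Function.update_of_ne h, Function.update_of_ne h', Function.update_of_ne h]
    exact C p (by grind) (by grind)

theorem groupBelow (C : Counts r M N V par nch csum) (hw : w ∉ N) (hr : r ∈ N) (hu : u ∈ N)
    (huV : u ∉ V) (hp : ∀ c ∈ N, par c ∈ N) (hX : X ⊆ kids r N par u)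
    (hv₁ : v₁ < M) (hv₁' : (v₁ : ZMod M) = ∑ c ∈ X, (c : ZMod M)) (hv₂ : v₂ < M)
    (hv₂' : (v₂ : ZMod M) = csum u - v₁ + w) :
    Counts r M (insert w N) V (parBelow par X u w)
      (Function.update (Function.update nch w X.card) u (nch u - X.card + 1))
      (Function.update (Function.update csum w v₁) u v₂) := by
  have huw : u ≠ w := fun h => hw (h ▸ hu)
  intro p hpN hpV
  rw [kids_below hw hr hu hp hX]
  split_ifs with h h'
  · subst h
    rw [Function.update_of_ne huw.symm, Function.update_self, Function.update_of_ne huw.symm,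
      Function.update_self]
    exact ⟨rfl, hv₁, hv₁'⟩
  · subst h'
    obtain ⟨h1, h2, h3⟩ := C p hu huV
    have hwk : w ∉ kids r N par p \ X := fun h => hw (mem_kids.1 (Finset.mem_sdiff.1 h).1).1
    rw [Function.update_self, Function.update_self, Finset.card_insert_of_notMem hwk,
      Finset.card_sdiff_of_subset hX, Finset.sum_insert hwk, Finset.sum_sdiff_eq_sub hX, ← h3,
      ← hv₁', h1]
    exact ⟨rfl, hv₂, by rw [hv₂']; ring⟩
  · rw [Function.update_of_ne h', Function.update_of_ne h, Function.update_of_ne h',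
      Function.update_of_ne h]
    exact C p (by grind) hpV

/-- The sums change at `w`, `u` and `par u`. At `par u` the node `w` replaces `u`, so the number of
children is the same there. -/
theorem groupOver (C : Counts r M N V par nch csum) (hw : w ∉ N) (hr : r ∈ N) (hu : u ∈ N)
    (huV : u ∉ V) (hur : u ≠ r) (hp : ∀ c ∈ N, par c ∈ N) (hpV : par u ∉ V) (hpu : par u ≠ u)
    (hX : X ⊆ kids r N par u) (huX : u ∉ X)
    (hv₁ : v₁ < M) (hv₁' : (v₁ : ZMod M) = ∑ c ∈ X, (c : ZMod M) + u) (hv₂ : v₂ < M)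
    (hv₂' : (v₂ : ZMod M) = csum u - ∑ c ∈ X, (c : ZMod M)) (hv₃ : v₃ < M)
    (hv₃' : (v₃ : ZMod M) = csum (par u) - u + w) :
    Counts r M (insert w N) V (parOver par X u w)
      (Function.update (Function.update nch w (X.card + 1)) u (nch u - X.card))
      (Function.update (Function.update (Function.update csum w v₁) u v₂) (par u) v₃) := by
  have huw : u ≠ w := fun h => hw (h ▸ hu)
  have hpw : par u ≠ w := fun h => hw (h ▸ hp u hu)
  have huk : u ∈ kids r N par (par u) := mem_kids.2 ⟨hu, hur, rfl⟩
  intro p hpN hpV'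
  rw [kids_over hw hr hu hur hp hpu hX]
  split_ifs with h h' h''
  · subst h
    rw [Function.update_of_ne huw.symm, Function.update_self, Function.update_of_ne hpw.symm,
      Function.update_of_ne huw.symm, Function.update_self, Finset.card_insert_of_notMem huX,
      Finset.sum_insert huX]
    exact ⟨rfl, hv₁, by rw [hv₁', add_comm]⟩
  · subst h'
    obtain ⟨h1, h2, h3⟩ := C p hu huV
    rw [Function.update_self, Function.update_of_ne hpu.symm, Function.update_self,
      Finset.card_sdiff_of_subset hX, Finset.sum_sdiff_eq_sub hX, ← h3, h1]
    exact ⟨rfl, hv₂, hv₂'⟩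
  · subst h''
    obtain ⟨h1, h2, h3⟩ := C (par u) (hp u hu) hpV
    have hwk : w ∉ (kids r N par (par u)).erase u := fun h =>
      hw (mem_kids.1 (Finset.mem_of_mem_erase h)).1
    rw [Function.update_of_ne h', Function.update_of_ne h, Function.update_self,
      Finset.card_insert_of_notMem hwk, Finset.card_erase_of_mem huk, Finset.sum_insert hwk,
      Finset.sum_erase_eq_sub huk, ← h3, h1]
    have := Finset.card_pos.2 ⟨u, huk⟩
    exact ⟨by omega, hv₃, by rw [hv₃']; ring⟩
  · rw [Function.update_of_ne h', Function.update_of_ne h, Function.update_of_ne h'',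
      Function.update_of_ne h', Function.update_of_ne h]
    exact C p (by grind) hpV'

end Counts

end Cotree

/-! ### Programs that modify the tree. -/

namespace Algo

open WordRAM Cotree

/-- Add the vertex in register 2 to the children of the node in register 16. -/
def attachProg : Prog :=
  .seq (.store 2 (.reg 2) (.reg 16)) <|
  .seq (.store 4 (.reg 16) (.add (.read 4 (.reg 16)) (.const 1))) <|
  .seq (.assign 15 (.add (.read 5 (.reg 16)) (.reg 2))) <|
  .seq reduce <|
  .store 5 (.reg 16) (.reg 15)

theorem runs_attachProg {B M : ℕ} {s : State} (hM : s.reg 12 = M) (hB : 2 * M ≤ B)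
    (hx : s.reg 2 < M) (ht : s.reg 16 < M) (hnch : s.arr 4 (s.reg 16) + 1 ≤ B)
    (hcsum : s.arr 5 (s.reg 16) < M) :
    Runs B attachProg s attachProg.maxTime fun s' => Frame [15] [2, 4, 5] s s' ∧
      s'.arr 2 = Function.update (s.arr 2) (s.reg 2) (s.reg 16) ∧
      s'.arr 4 = Function.update (s.arr 4) (s.reg 16) (s.arr 4 (s.reg 16) + 1) ∧
      ∃ v < M, (v : ZMod M) = s.arr 5 (s.reg 16) + s.reg 2 ∧
        s'.arr 5 = Function.update (s.arr 5) (s.reg 16) v := by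
  refine Runs.of_wp ?_
  simp only [attachProg, Prog.wp, Expr.eval, State.reg_setReg, State.arr_setReg,
      State.reg_setArr, State.arr_setArr, Nat.reduceEqDiff, if_false]
  refine ⟨by omega, hnch, by omega, wp_reduce (M := M) ?_ ?_ (by omega) fun v hv hv' => ?_⟩ <;>
  simp only [State.reg_setReg, State.arr_setReg,
      State.reg_setArr, State.arr_setArr, Nat.reduceEqDiff, if_true, if_false] at *
  · exact hM
  · omega
  · refine ⟨by omega, by simp [frame_setReg, frame_setArr, Frame.refl], trivial, trivial, v, hv,
      ?_, rfl⟩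
    rw [hv', Nat.cast_add]

/-- Insert a new node of the kind in register 17 above the node in register 16, with the vertex in
register 2 as its second child. -/
def aboveProg : Prog :=
  .seq (.assign 6 (.read 2 (.reg 16))) <|
  .seq (.store 2 (.reg 11) (.reg 6)) <|
  .seq (.store 2 (.reg 16) (.reg 11)) <|
  .seq (.store 2 (.reg 2) (.reg 11)) <|
  .seq (.store 3 (.reg 11) (.reg 17)) <|
  .seq (.store 4 (.reg 11) (.const 2)) <|
  .seq (.assign 15 (.add (.reg 16) (.reg 2))) <|
  .seq reduce <|
  .seq (.store 5 (.reg 11) (.reg 15)) <|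
  -- Modulo `M`, adding `M - t` subtracts `t` without truncation. A reduction after every addition
  -- keeps the numbers below `2 * M`, as `reduce` requires.
  .seq (.assign 15 (.add (.read 5 (.reg 6)) (.sub (.reg 12) (.reg 16)))) <|
  .seq reduce <|
  .seq (.assign 15 (.add (.reg 15) (.reg 11))) <|
  .seq reduce <|
  .seq (.store 5 (.reg 6) (.reg 15)) <|
  .assign 11 (.add (.reg 11) (.const 1))

theorem runs_aboveProg {B M : ℕ} {s : State} (hM : s.reg 12 = M) (hB : 2 * M ≤ B)
    (_ : 2 ≤ M)
    (hx : s.reg 2 < M) (ht : s.reg 16 < M) (hs : s.reg 11 < M) (hκ : s.reg 17 ≤ 1)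
    (hp : s.arr 2 (s.reg 16) < M) (hps : s.arr 2 (s.reg 16) ≠ s.reg 11)
    (hcsum : s.arr 5 (s.arr 2 (s.reg 16)) < M) :
    Runs B aboveProg s aboveProg.maxTime fun s' => Frame [6, 11, 15] [2, 3, 4, 5] s s' ∧
      s'.reg 11 = s.reg 11 + 1 ∧
      s'.arr 2 = parAbove (s.arr 2) (s.reg 16) (s.reg 11) (s.reg 2) ∧
      s'.arr 3 = Function.update (s.arr 3) (s.reg 11) (s.reg 17) ∧
      s'.arr 4 = Function.update (s.arr 4) (s.reg 11) 2 ∧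
      ∃ v₁ < M, (v₁ : ZMod M) = s.reg 16 + s.reg 2 ∧
      ∃ v₂ < M, (v₂ : ZMod M) = s.arr 5 (s.arr 2 (s.reg 16)) - s.reg 16 + s.reg 11 ∧
        s'.arr 5 = Function.update (Function.update (s.arr 5) (s.reg 11) v₁)
          (s.arr 2 (s.reg 16)) v₂ := by
  refine Runs.of_wp ?_
  simp only [aboveProg, Prog.wp, Expr.eval, State.reg_setReg, State.arr_setReg,
      State.reg_setArr, State.arr_setArr, Nat.reduceEqDiff, if_true, if_false]
  refine ⟨by omega, by omega, by omega, by omega, by omega, by omega, by omega,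
    wp_reduce (M := M) ?_ ?_ (by omega) fun v₁ hv₁ hv₁' => ?_⟩ <;>
  simp only [State.reg_setReg, State.arr_setReg,
      State.reg_setArr, State.arr_setArr, Nat.reduceEqDiff, if_true, if_false,
      Function.update_of_ne hps] at *
  · exact hM
  · omega
  refine ⟨by omega, by omega, wp_reduce (M := M) ?_ ?_ (by omega) fun v₂ hv₂ hv₂' => ?_⟩ <;>
  simp only [State.reg_setReg, State.arr_setReg,
      State.reg_setArr, State.arr_setArr, Nat.reduceEqDiff, if_true, if_false] at *
  · exact hM
  · omega
  refine ⟨by omega, wp_reduce (M := M) ?_ ?_ (by omega) fun v₃ hv₃ hv₃' => ?_⟩ <;>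
  simp only [State.reg_setReg, State.arr_setReg,
      State.reg_setArr, State.arr_setArr, Nat.reduceEqDiff, if_true, if_false] at *
  · exact hM
  · omega
  refine ⟨by omega, by omega, by simp [frame_setReg, frame_setArr, Frame.refl], trivial, rfl, trivial, trivial,
    v₁, hv₁, ?_, v₃, hv₃, ?_, rfl⟩
  · rw [hv₁', Nat.cast_add]
  · rw [hv₃', Nat.cast_add, hv₂', Nat.cast_add, hM, Nat.cast_sub ht.le]
    simp [sub_eq_add_neg]

/-- The updates after the full children of the node in register 7 have been moved to a new
child. -/
def belowProg : Prog :=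
  .seq (.store 2 (.reg 14) (.reg 7)) <|
  .seq (.store 3 (.reg 14) (.const 0)) <|
  .seq (.store 4 (.reg 14) (.reg 8)) <|
  .seq (.store 4 (.reg 7) (.add (.sub (.read 4 (.reg 7)) (.reg 8)) (.const 1))) <|
  .seq (.store 5 (.reg 14) (.reg 10)) <|
  .seq (.assign 15 (.add (.read 5 (.reg 7)) (.sub (.reg 12) (.reg 10)))) <|
  .seq reduce <|
  .seq (.assign 15 (.add (.reg 15) (.reg 14))) <|
  .seq reduce <|
  .seq (.store 5 (.reg 7) (.reg 15)) <|
  -- Next, a new series node is to be inserted above `w`; the flag in register 18 is needed because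
  -- `w` is not a leaf.
  .seq (.assign 16 (.reg 14)) <|
  .seq (.assign 17 (.const 1)) <|
  .assign 18 (.const 1)

theorem runs_belowProg {B M : ℕ} {s : State} (hM : s.reg 12 = M) (hB : 2 * M ≤ B)
    (hu : s.reg 7 < M) (hw : s.reg 14 < M) (huw : s.reg 7 ≠ s.reg 14) (ha : s.reg 8 ≤ B)
    (hnch : s.arr 4 (s.reg 7) + 1 ≤ B) (hS : s.reg 10 < M) (hcsum : s.arr 5 (s.reg 7) < M) :
    Runs B belowProg s belowProg.maxTime fun s' => Frame [15, 16, 17, 18] [2, 3, 4, 5] s s' ∧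
      s'.reg 16 = s.reg 14 ∧ s'.reg 17 = 1 ∧ s'.reg 18 = 1 ∧
      s'.arr 2 = Function.update (s.arr 2) (s.reg 14) (s.reg 7) ∧
      s'.arr 3 = Function.update (s.arr 3) (s.reg 14) 0 ∧
      s'.arr 4 = Function.update (Function.update (s.arr 4) (s.reg 14) (s.reg 8)) (s.reg 7)
        (s.arr 4 (s.reg 7) - s.reg 8 + 1) ∧
      ∃ v < M, (v : ZMod M) = s.arr 5 (s.reg 7) - s.reg 10 + s.reg 14 ∧
        s'.arr 5 = Function.update (Function.update (s.arr 5) (s.reg 14) (s.reg 10)) (s.reg 7) v := by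
  refine Runs.of_wp ?_
  simp only [belowProg, Prog.wp, Expr.eval, State.reg_setReg, State.arr_setReg,
      State.reg_setArr, State.arr_setArr, Nat.reduceEqDiff, if_true, if_false,
      Function.update_of_ne huw]
  refine ⟨by omega, by omega, by omega, by omega, by omega, by omega,
    wp_reduce (M := M) ?_ ?_ (by omega) fun v₂ hv₂ hv₂' => ?_⟩ <;>
  simp only [State.reg_setReg, State.arr_setReg,
      State.reg_setArr, State.arr_setArr, Nat.reduceEqDiff, if_true, if_false] at *
  · exact hM
  · omega
  refine ⟨by omega, wp_reduce (M := M) ?_ ?_ (by omega) fun v₃ hv₃ hv₃' => ?_⟩ <;>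
  simp only [State.reg_setReg, State.arr_setReg,
      State.reg_setArr, State.arr_setArr, Nat.reduceEqDiff, if_true, if_false] at *
  · exact hM
  · omega
  refine ⟨by omega, by omega, by omega, by omega, by simp [frame_setReg, frame_setArr, Frame.refl],
    trivial, trivial, trivial, trivial, trivial, trivial, v₃, hv₃, ?_, rfl⟩
  rw [hv₃', Nat.cast_add, hv₂', Nat.cast_add, hM, Nat.cast_sub hS.le]
  simp [sub_eq_add_neg]

/-- The updates after the full children of the node in register 7 have been moved to a new
parent. -/
def overProg : Prog :=
  .seq (.assign 6 (.read 2 (.reg 7))) <|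
  .seq (.store 2 (.reg 14) (.reg 6)) <|
  .seq (.store 2 (.reg 7) (.reg 14)) <|
  .seq (.store 3 (.reg 14) (.const 1)) <|
  .seq (.store 4 (.reg 14) (.add (.reg 8) (.const 1))) <|
  .seq (.store 4 (.reg 7) (.sub (.read 4 (.reg 7)) (.reg 8))) <|
  .seq (.assign 15 (.add (.reg 10) (.reg 7))) <|
  .seq reduce <|
  .seq (.store 5 (.reg 14) (.reg 15)) <|
  .seq (.assign 15 (.add (.read 5 (.reg 7)) (.sub (.reg 12) (.reg 10)))) <|
  .seq reduce <|
  .seq (.store 5 (.reg 7) (.reg 15)) <|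
  .seq (.assign 15 (.add (.read 5 (.reg 6)) (.sub (.reg 12) (.reg 7)))) <|
  .seq reduce <|
  .seq (.assign 15 (.add (.reg 15) (.reg 14))) <|
  .seq reduce <|
  .seq (.store 5 (.reg 6) (.reg 15)) <|
  .seq (.assign 16 (.reg 7)) <|
  .seq (.assign 17 (.const 0)) <|
  .assign 18 (.const 1)

theorem runs_overProg {B M : ℕ} {s : State} (hM : s.reg 12 = M) (hB : 2 * M ≤ B) (_ : 1 ≤ M)
    (hu : s.reg 7 < M) (hw : s.reg 14 < M) (huw : s.reg 7 ≠ s.reg 14) (ha : s.reg 8 + 1 ≤ B)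
    (hp : s.arr 2 (s.reg 7) < M) (hpw : s.arr 2 (s.reg 7) ≠ s.reg 14)
    (hpu : s.arr 2 (s.reg 7) ≠ s.reg 7)
    (hnch : s.arr 4 (s.reg 7) ≤ B) (hS : s.reg 10 < M) (hcsum : s.arr 5 (s.reg 7) < M)
    (hcsum' : s.arr 5 (s.arr 2 (s.reg 7)) < M) :
    Runs B overProg s overProg.maxTime fun s' => Frame [6, 15, 16, 17, 18] [2, 3, 4, 5] s s' ∧
      s'.reg 16 = s.reg 7 ∧ s'.reg 17 = 0 ∧ s'.reg 18 = 1 ∧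
      s'.arr 2 = Function.update (Function.update (s.arr 2) (s.reg 14) (s.arr 2 (s.reg 7)))
        (s.reg 7) (s.reg 14) ∧
      s'.arr 3 = Function.update (s.arr 3) (s.reg 14) 1 ∧
      s'.arr 4 = Function.update (Function.update (s.arr 4) (s.reg 14) (s.reg 8 + 1)) (s.reg 7)
        (s.arr 4 (s.reg 7) - s.reg 8) ∧
      ∃ v₁ < M, (v₁ : ZMod M) = s.reg 10 + s.reg 7 ∧
      ∃ v₂ < M, (v₂ : ZMod M) = s.arr 5 (s.reg 7) - s.reg 10 ∧
      ∃ v₃ < M, (v₃ : ZMod M) = s.arr 5 (s.arr 2 (s.reg 7)) - s.reg 7 + s.reg 14 ∧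
        s'.arr 5 = Function.update (Function.update (Function.update (s.arr 5) (s.reg 14) v₁)
          (s.reg 7) v₂) (s.arr 2 (s.reg 7)) v₃ := by
  refine Runs.of_wp ?_
  simp only [overProg, Prog.wp, Expr.eval, State.reg_setReg, State.arr_setReg,
      State.reg_setArr, State.arr_setArr, Nat.reduceEqDiff, if_true, if_false,
      Function.update_of_ne huw]
  refine ⟨by omega, by omega, by omega, by omega, by omega, by omega, by omega,
    wp_reduce (M := M) ?_ ?_ (by omega) fun v₁ hv₁ hv₁' => ?_⟩ <;>
  simp only [State.reg_setReg, State.arr_setReg, Function.update_of_ne huw,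
      State.reg_setArr, State.arr_setArr, Nat.reduceEqDiff, if_true, if_false] at *
  · exact hM
  · omega
  refine ⟨by omega, by omega, wp_reduce (M := M) ?_ ?_ (by omega) fun v₂ hv₂ hv₂' => ?_⟩ <;>
  simp only [State.reg_setReg, State.arr_setReg, Function.update_of_ne hpu,
      Function.update_of_ne hpw,
      State.reg_setArr, State.arr_setArr, Nat.reduceEqDiff, if_true, if_false] at *
  · exact hM
  · omega
  refine ⟨by omega, by omega, wp_reduce (M := M) ?_ ?_ (by omega) fun v₃ hv₃ hv₃' => ?_⟩ <;>
  simp only [State.reg_setReg, State.arr_setReg,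
      State.reg_setArr, State.arr_setArr, Nat.reduceEqDiff, if_true, if_false] at *
  · exact hM
  · omega
  refine ⟨by omega, wp_reduce (M := M) ?_ ?_ (by omega) fun v₄ hv₄ hv₄' => ?_⟩ <;>
  simp only [State.reg_setReg, State.arr_setReg,
      State.reg_setArr, State.arr_setArr, Nat.reduceEqDiff, if_true, if_false] at *
  · exact hM
  · omega
  refine ⟨by omega, by omega, by omega, by omega, by simp [frame_setReg, frame_setArr, Frame.refl],
    trivial, trivial, trivial, trivial, trivial, trivial, v₁, hv₁, ?_, v₂, hv₂, ?_, v₄, hv₄, ?_,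
    rfl⟩
  · rw [hv₁', Nat.cast_add]
  · rw [hv₂', Nat.cast_add, hM, Nat.cast_sub hS.le]
    simp [sub_eq_add_neg]
  · rw [hv₄', Nat.cast_add, hv₃', Nat.cast_add, hM, Nat.cast_sub hu.le]
    simp [sub_eq_add_neg]

end Algo

/-! ### Locating the place. -/

namespace Algo

open WordRAM Cotree

/-- The program that marks the full nodes and finds the place of the new vertex. -/
def locateProg : Prog :=
  .seq (.assign 3 (.const 0)) <| .seq markLoop <|
  .seq (.assign 3 (.const 0)) <| .seq lowLoop <|
  .seq (.assign 7 (.reg 13)) <| .seq (.assign 3 (.const 0)) <| .seq findLoop <|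
  .seq (.assign 8 (.read 6 (.reg 7))) <| .seq (.assign 10 (.const 0)) <|
  .seq (.assign 3 (.const 0)) collectLoop

def locateTime (m : ℕ) : ℕ :=
  (2 * m + 1) * (markBody.maxTime + 3) + (2 * m + 1) * (lowBody.maxTime + 3) +
    (2 * m + 1) * (findBody.maxTime + 3) + (2 * m + 1) * (collectBody.maxTime + 3) + 20

/-- The state after the program has found the place `u` of the vertex `x`. -/
structure Located (G : SimpleGraph ℕ) (r : ℕ) (N V : Finset ℕ) (L : ℕ → Finset ℕ) (m M : ℕ)
    (s s' : State) (u : ℕ) : Prop where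
  frame : Frame [3, 4, 5, 6, 7, 8, 9, 10, 15] [6, 7, 8] s s'
  place : IsPlace G r N V (s.arr 2) (s.arr 3) L (s.reg 2) u
  reg_u : s'.reg 7 = u
  reg_a : s'.reg 8 = (fullKids G r N (s.arr 2) L (s.reg 2) u).card
  cnt : ∀ y, s'.arr 6 y = 0
  low : ∀ y, s'.arr 7 y ≤ s.reg 2 + 1
  len : s'.reg 4 ≤ 2 * m
  queue_mem : ∀ j < s'.reg 4, s'.arr 8 j ∈ N
  mem_fullKids : ∀ c, c ∈ fullKids G r N (s.arr 2) L (s.reg 2) u ↔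
    ∃ j < s'.reg 4, s'.arr 8 j = c ∧ s.arr 2 c = u
  sum_lt : s'.reg 10 < M
  sum_eq : (s'.reg 10 : ZMod M) = ∑ c ∈ fullKids G r N (s.arr 2) L (s.reg 2) u, (c : ZMod M)
  last : (fullKids G r N (s.arr 2) L (s.reg 2) u).Nonempty →
    s'.reg 9 ∈ fullKids G r N (s.arr 2) L (s.reg 2) u

/-- After the marking, the counter of a node is its number of full children. This turns the notions
of `exists_place` into tests on the arrays, performed only at parents of queue entries, in time
linear in the number of marked leaves. -/
theorem runs_locateProg {B m M : ℕ} {G : SimpleGraph ℕ} {r : ℕ} {N V : Finset ℕ}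
    {L : ℕ → Finset ℕ} {s : State} (hG : PathFree G)
    (T : IsCotree G r N V (s.arr 2) (s.arr 3) L r)
    (hnch : ∀ p ∈ N, p ∉ V → s.arr 4 p = (kids r N (s.arr 2) p).card)
    (hr : ¬ Full G (s.reg 2) L r)
    (hM : Marked N V (s.arr 2) (s.arr 4) (G.Adj (s.reg 2)) L (s.arr 8) (s.arr 6) m 0 m)
    (hlen : s.reg 4 = m) (hN : ∀ c ∈ N, c < M) (hB : 2 * M ≤ B) (hm : 2 * m ≤ B)
    (hx : s.reg 2 + 1 ≤ B) (hlow : ∀ y, s.arr 7 y ≤ s.reg 2) (h12 : s.reg 12 = M)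
    (h13 : s.reg 13 = r) (h0 : 0 < M) :
    Runs B locateProg s (locateTime m) fun s' => ∃ u, Located G r N V L m M s s' u := by
  obtain ⟨u, hu, hu1, hu2, hu3⟩ := T.exists_place hG hr
  have hrM := hN r T.root_mem
  refine Runs.assign_seq (Nat.zero_le _) (T' := locateTime m - 2) ?_ (by
    simp only [locateTime, Expr.time]; omega)
  refine Runs.seq (T₁ := (2 * m + 1) * (markBody.maxTime + 3))
    (T₂ := locateTime m - 2 - (2 * m + 1) * (markBody.maxTime + 3))
    (runs_markLoop (s := s.setReg 3 0) T hnch hr hM rfl hlen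
      (fun c hc => by have := hN c hc; omega) hm) ?_ (by simp only [locateTime]; omega)
  rintro s₁ ⟨hF₁, hM₁⟩
  replace hM₁ : Marked N V (s.arr 2) (s.arr 4) (G.Adj (s.reg 2)) L (s₁.arr 8) (s₁.arr 6) m
    (s₁.reg 4) (s₁.reg 4) := hM₁
  have hlen₁ := hM₁.len_le T hnch
  have h12' : s₁.arr 2 = s.arr 2 := hF₁.2 2 (by simp)
  have h14 : s₁.arr 4 = s.arr 4 := hF₁.2 4 (by simp)
  have h17 : s₁.arr 7 = s.arr 7 := hF₁.2 7 (by simp)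
  have h1r2 : s₁.reg 2 = s.reg 2 := hF₁.1 2 (by simp)
  have h1r12 : s₁.reg 12 = M := (hF₁.1 12 (by simp)).trans h12
  have h1r13 : s₁.reg 13 = r := (hF₁.1 13 (by simp)).trans h13
  have hcnt := hM₁.cnt_eq_card_fullKids T hnch hr
  have hqmem : ∀ j < s₁.reg 4, s₁.arr 8 j ∈ N := hM₁.mem
  have hqN : ∀ j < s₁.reg 4, qpar s₁ j ∈ N := fun j hj => by
    rw [qpar, h12']
    exact T.par_mem _ (hqmem j hj)
  have hqB : ∀ j < s₁.reg 4, qpar s₁ j ≤ B := fun j hj => by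
    have := hN _ (hqN j hj)
    omega
  have hqV : ∀ j < s₁.reg 4, qpar s₁ j ∉ V := fun j hj => by
    rw [qpar, h12']
    exact T.par_notMem _ (hqmem j hj)
  have hkid : ∀ p c, c ∈ fullKids G r N (s.arr 2) L (s.reg 2) p ↔
      ∃ j < s₁.reg 4, s₁.arr 8 j = c ∧ s.arr 2 c = p := by
    intro p c
    rw [← hM₁.image_eq_fullKids T hnch hr]
    simp only [Finset.mem_image, Finset.mem_filter, Finset.mem_range]
    constructor
    · rintro ⟨j, ⟨hj, rfl⟩, rfl⟩
      exact ⟨j, hj, rfl, rfl⟩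
    · rintro ⟨j, hj, rfl, rfl⟩
      exact ⟨j, ⟨hj, rfl⟩, rfl⟩
  -- A node has a full child if it is the parent of a queue entry, and it is not full if its counter
  -- has not reached its number of children.
  have htouch : ∀ p, Touched G r N (s.arr 2) L (s.reg 2) p ↔
      ∃ j < s₁.reg 4, s₁.arr 6 p < s₁.arr 4 p ∧ qpar s₁ j = p := by
    intro p
    have h1 : (∃ c ∈ kids r N (s.arr 2) p, Full G (s.reg 2) L c) ↔
        ∃ j < s₁.reg 4, qpar s₁ j = p := by
      have : (∃ c ∈ kids r N (s.arr 2) p, Full G (s.reg 2) L c) ↔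
          ∃ c, c ∈ fullKids G r N (s.arr 2) L (s.reg 2) p := by simp [mem_fullKids]
      rw [this]
      simp only [hkid, qpar, h12']
      constructor
      · rintro ⟨_, j, hj, rfl, h⟩
        exact ⟨j, hj, h⟩
      · rintro ⟨j, hj, h⟩
        exact ⟨_, j, hj, rfl, h⟩
    rw [Touched, h1]
    constructor
    · rintro ⟨hf, j, hj, rfl⟩
      refine ⟨j, hj, ?_, rfl⟩
      rw [T.full_iff (hqN j hj) (hqV j hj)] at hf
      rw [hcnt, h14, hnch _ (hqN j hj) (hqV j hj)]
      refine Finset.card_lt_card ⟨fun c hc => (mem_fullKids.1 hc).1, fun h => hf fun c hc => ?_⟩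
      exact (mem_fullKids.1 (h hc)).2
    · rintro ⟨j, hj, hlt, rfl⟩
      refine ⟨fun hf => ?_, j, hj, rfl⟩
      rw [T.full_iff (hqN j hj) (hqV j hj)] at hf
      rw [hcnt, h14, hnch _ (hqN j hj) (hqV j hj)] at hlt
      have : kids r N (s.arr 2) (qpar s₁ j) ⊆ fullKids G r N (s.arr 2) L (s.reg 2) (qpar s₁ j) :=
        fun c hc => mem_fullKids.2 ⟨hc, hf c hc⟩
      have := Finset.card_le_card this
      omega
  have hover : ∀ y, OverTouched G r N (s.arr 2) L (s.reg 2) y ↔ ∃ j < s₁.reg 4,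
      s₁.arr 6 (qpar s₁ j) < s₁.arr 4 (qpar s₁ j) ∧
        (y = s₁.arr 2 (qpar s₁ j) ∨ y = s₁.arr 2 (s₁.arr 2 (qpar s₁ j))) := by
    intro y
    simp only [OverTouched, htouch, h12']
    constructor
    · rintro ⟨_, ⟨j, hj, hlt, rfl⟩, h⟩
      exact ⟨j, hj, hlt, h⟩
    · rintro ⟨j, hj, hlt, h⟩
      exact ⟨_, ⟨j, hj, hlt, rfl⟩, h⟩
  have hle : ∀ K, (s₁.reg 4 + 1) * K ≤ (2 * m + 1) * K := fun K =>
    Nat.mul_le_mul_right _ (by omega)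
  -- nodes above touched nodes
  refine Runs.assign_seq (Nat.zero_le _)
    (T' := locateTime m - 4 - (2 * m + 1) * (markBody.maxTime + 3)) ?_ (by
    simp only [locateTime, Expr.time]; omega)
  refine Runs.seq (T₁ := (2 * m + 1) * (lowBody.maxTime + 3))
    (T₂ := (2 * m + 1) * (findBody.maxTime + 3) + (2 * m + 1) * (collectBody.maxTime + 3) + 16)
    ((runs_lowLoop (B := B) (s := s₁.setReg 3 0) rfl (by
      change s₁.reg 4 ≤ B
      omega) hqB (by
      change s₁.reg 2 + 1 ≤ B
      omega) (by
      intro y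
      change s₁.arr 7 y ≤ s₁.reg 2
      rw [h17, h1r2]
      exact hlow y)).mono (hle _) fun _ h => h) ?_ (by simp only [locateTime]; omega)
  rintro s₂ ⟨hF₂, hlow₂, hs₂⟩
  replace hlow₂ : ∀ y, s₂.arr 7 y ≤ s₁.reg 2 + 1 := hlow₂
  replace hs₂ : ∀ y, s₂.arr 7 y = s₁.reg 2 + 1 ↔ _ := fun y => (hs₂ y).trans (hover y).symm
  have h22 : s₂.arr 2 = s₁.arr 2 := hF₂.2 2 (by simp)
  have h24 : s₂.arr 4 = s₁.arr 4 := hF₂.2 4 (by simp)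
  have h26 : s₂.arr 6 = s₁.arr 6 := hF₂.2 6 (by simp)
  have h28 : s₂.arr 8 = s₁.arr 8 := hF₂.2 8 (by simp)
  have h2r2 : s₂.reg 2 = s₁.reg 2 := hF₂.1 2 (by simp)
  have h2r4 : s₂.reg 4 = s₁.reg 4 := hF₂.1 4 (by simp)
  have h2r12 : s₂.reg 12 = M := (hF₂.1 12 (by simp)).trans h1r12
  have h2r13 : s₂.reg 13 = r := (hF₂.1 13 (by simp)).trans h1r13
  have hqpar₂ : qpar s₂ = qpar s₁ := by
    funext j
    rw [qpar, qpar, h22, h28]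
  -- the place
  refine Runs.assign_seq (by simp only [Expr.eval]; omega)
    (T' := (2 * m + 1) * (findBody.maxTime + 3) + (2 * m + 1) * (collectBody.maxTime + 3) + 14) ?_
    (by simp only [Expr.time]; omega)
  refine Runs.assign_seq (Nat.zero_le _)
    (T' := (2 * m + 1) * (findBody.maxTime + 3) + (2 * m + 1) * (collectBody.maxTime + 3) + 12) ?_
    (by simp only [Expr.time]; omega)
  simp only [Expr.eval, h2r13]
  refine Runs.seq (T₁ := (2 * m + 1) * (findBody.maxTime + 3))
    (T₂ := (2 * m + 1) * (collectBody.maxTime + 3) + 12)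
    ((runs_findLoop (B := B) (s := (s₂.setReg 7 r).setReg 3 0) rfl (by
      change s₂.reg 4 ≤ B
      omega) (by
      intro j hj
      change j < s₂.reg 4 at hj
      change qpar s₂ j ≤ B
      rw [hqpar₂]
      exact hqB j (by omega))).mono (by
      change (s₂.reg 4 + 1) * _ ≤ _
      rw [h2r4]
      exact hle _) fun _ h => h) ?_ (by omega)
  rintro s₃ ⟨hF₃, hs₃⟩
  have h32 : s₃.arr 2 = s₁.arr 2 := (hF₃.2 2 (by simp)).trans h22
  have h36 : s₃.arr 6 = s₁.arr 6 := (hF₃.2 6 (by simp)).trans h26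
  have h37 : s₃.arr 7 = s₂.arr 7 := hF₃.2 7 (by simp)
  have h38 : s₃.arr 8 = s₁.arr 8 := (hF₃.2 8 (by simp)).trans h28
  have h3r4 : s₃.reg 4 = s₁.reg 4 := (hF₃.1 4 (by simp)).trans h2r4
  have h3r12 : s₃.reg 12 = M := (hF₃.1 12 (by simp)).trans h2r12
  have hqpar₃ : qpar s₃ = qpar s₁ := by
    funext j
    rw [qpar, qpar, h32, h38]
  -- A touched node that is not over a touched node is `u`. If the loop meets none, then `u` is
  -- untouched or over a touched node; in both cases it is the root, the default.
  have hu' : s₃.reg 7 = u := by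
    change (s₃.reg 7 = r ∧ ∀ j < s₂.reg 4, s₂.arr 6 (qpar s₂ j) < s₂.arr 4 (qpar s₂ j) →
        s₂.arr 7 (qpar s₂ j) = s₂.reg 2 + 1) ∨
      ∃ j < s₂.reg 4, s₂.arr 6 (qpar s₂ j) < s₂.arr 4 (qpar s₂ j) ∧
        s₂.arr 7 (qpar s₂ j) ≠ s₂.reg 2 + 1 ∧ s₃.reg 7 = qpar s₂ j at hs₃
    rw [h2r4, h26, h24, hqpar₂, h2r2] at hs₃
    simp only [ne_eq, hs₂] at hs₃
    obtain ⟨h, hall⟩ | ⟨j, hj, hlt, hno, h⟩ := hs₃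
    · rw [h]
      by_cases ht : Touched G r N (s.arr 2) L (s.reg 2) u
      · obtain ⟨j, hj, hlt, rfl⟩ := (htouch u).1 ht
        exact (hu2 (hall j hj hlt)).symm
      · exact (hu3 ht).symm
    · rw [h]
      exact (hu1 _ ((htouch _).2 ⟨j, hj, hlt, rfl⟩)).resolve_right hno
  -- the full children of the place
  refine Runs.assign_seq (T' := (2 * m + 1) * (collectBody.maxTime + 3) + 6) ?_ ?_
    (by simp only [Expr.time]; omega)
  · simp only [Expr.eval, hu', h36, hcnt]
    have h1 := hu.card_lt T
    have h2 := Finset.card_le_card (s := kids r N (s.arr 2) u) (t := Finset.range M) fun c hc =>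
      Finset.mem_range.2 (hN c (mem_kids.1 hc).1)
    rw [Finset.card_range] at h2
    omega
  refine Runs.assign_seq (Nat.zero_le _) (T' := (2 * m + 1) * (collectBody.maxTime + 3) + 4) ?_
    (by simp only [Expr.time]; omega)
  refine Runs.assign_seq (Nat.zero_le _) (T' := (2 * m + 1) * (collectBody.maxTime + 3)) ?_
    (by simp only [Expr.time]; omega)
  simp only [Expr.eval]
  set s₄ := ((s₃.setReg 8 (s₃.arr 6 (s₃.reg 7))).setReg 10 0).setReg 3 0 with hs₄
  have h4r4 : s₄.reg 4 = s₁.reg 4 := h3r4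
  have h4r7 : s₄.reg 7 = u := hu'
  have h4r12 : s₄.reg 12 = M := h3r12
  have hqpar₄ : qpar s₄ = qpar s₁ := hqpar₃
  have h46 : s₄.arr 6 = s₁.arr 6 := h36
  have h48 : s₄.arr 8 = s₁.arr 8 := h38
  refine (runs_collectLoop (B := B) (s := s₄) rfl ?_ ?_ ?_ ?_ rfl ?_).mono ?_ ?_
  · omega
  · intro j hj
    rw [hqpar₄]
    exact hqB j (by omega)
  · intro j hj
    rw [h48, h4r12]
    exact hN _ (hqmem j (by omega))
  · omega
  · omega
  · rw [h4r4]
    exact hle _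
  rintro s₅ ⟨hF₅, hc₅, hlt₅, hsum₅, hlast₅⟩
  rw [h4r4, h4r7, hqpar₄, h48] at hlast₅
  rw [h4r4, h4r7, hqpar₄, h48, h4r12] at hsum₅
  rw [h4r12] at hlt₅
  simp only [h4r4, hqpar₄] at hc₅
  have h52 : s₅.reg 4 = s₁.reg 4 := (hF₅.1 4 (by simp)).trans h4r4
  have h58 : s₅.arr 8 = s₁.arr 8 := (hF₅.2 8 (by simp)).trans h48
  have h57 : s₅.arr 7 = s₂.arr 7 := (hF₅.2 7 (by simp)).trans h37
  refine ⟨u, ?_, hu, ?_, ?_, ?_, ?_, ?_, ?_, ?_, hlt₅, ?_, ?_⟩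
  · have e₁ : Frame [3, 4, 5, 6, 7, 8, 9, 10, 15] [6, 7, 8] s s₁ :=
      Frame.trans (by simp [frame_setReg, Frame.refl]) (hF₁.mono (by simp) (by simp))
    have e₂ : Frame [3, 4, 5, 6, 7, 8, 9, 10, 15] [6, 7, 8] s₁ s₂ :=
      Frame.trans (by simp [frame_setReg, Frame.refl]) (hF₂.mono (by simp) (by simp))
    have e₃ : Frame [3, 4, 5, 6, 7, 8, 9, 10, 15] [6, 7, 8] s₂ s₃ :=
      Frame.trans (by simp [frame_setReg, Frame.refl]) (hF₃.mono (by simp) (by simp))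
    have e₄ : Frame [3, 4, 5, 6, 7, 8, 9, 10, 15] [6, 7, 8] s₃ s₅ :=
      Frame.trans (by simp [hs₄, frame_setReg, Frame.refl]) (hF₅.mono (by simp) (by simp))
    exact ((e₁.trans e₂).trans e₃).trans e₄
  · exact (hF₅.1 7 (by simp)).trans hu'
  · have : s₅.reg 8 = s₃.arr 6 (s₃.reg 7) := hF₅.1 8 (by simp)
    rw [this, h36, hu', hcnt]
  · intro y
    rw [hc₅, h46]
    split_ifs with h
    · rfl
    -- A counter that was not cleared belongs to a node without children in the queue, so it was
    -- zero already.
    · rw [hM₁.cnt_eq, Finset.card_eq_zero, Finset.filter_eq_empty_iff]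
      intro j hj hjy
      refine h ⟨j, Finset.mem_range.1 hj, ?_⟩
      rw [qpar, h12', hjy]
  · intro y
    rw [h57, ← h1r2]
    exact hlow₂ y
  · rw [h52]
    exact hlen₁
  · rw [h52, h58]
    exact hqmem
  · intro c
    rw [hkid, h52, h58]
  · rw [hsum₅, ← hM₁.image_eq_fullKids T hnch hr, Finset.sum_image]
    · simp only [qpar, h12']
    · intro j hj j' hj' h
      simp only [Finset.coe_filter, Finset.mem_range, Set.mem_ofPred_eq] at hj hj'
      exact hM₁.inj j hj.1 j' hj'.1 h
  · rintro ⟨c, hc⟩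
    obtain ⟨j, hj, rfl, hjc⟩ := (hkid u c).1 hc
    obtain ⟨j', hj', h1, h2⟩ := hlast₅ ⟨j, hj, by rw [qpar, h12', hjc]⟩
    rw [hkid, h2]
    exact ⟨j', hj', rfl, by rw [← h1, qpar, h12']⟩

end Algo

/-! ### Choice of the target and insertion. -/

namespace Algo

open WordRAM Cotree

/-- The memory holds a cotree with the nodes `N` and the leaves `V`. -/
def Holds (G : SimpleGraph ℕ) (r M : ℕ) (N V : Finset ℕ) (s : State) : Prop :=
  (∃ L, IsCotree G r N V (s.arr 2) (s.arr 3) L r) ∧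
    Counts r M N V (s.arr 2) (s.arr 4) (s.arr 5)

/-- The memory holds a cotree with the new leaf `x` and at most two new inner nodes, the first of
them `f`. -/
def Grown (G : SimpleGraph ℕ) (r M : ℕ) (N V : Finset ℕ) (x f : ℕ) (s : State) : Prop :=
  ∃ N', Holds G r M N' (insert x V) s ∧ f ≤ s.reg 11 ∧ s.reg 11 ≤ f + 2 ∧
    ∀ c ∈ N', c ∈ N ∨ c = x ∨ (f ≤ c ∧ c < s.reg 11)

section Finish

variable {B r M f : ℕ} {G : SimpleGraph ℕ} {N V : Finset ℕ} {s : State}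

theorem grown_attachProg (C : Counts r M N V (s.arr 2) (s.arr 4) (s.arr 5))
    (hT : ∃ L, IsCotree G r (insert (s.reg 2) N) (insert (s.reg 2) V)
      (Function.update (s.arr 2) (s.reg 2) (s.reg 16)) (s.arr 3) L r)
    (hr : r ∈ N) (ht : s.reg 16 ∈ N) (htV : s.reg 16 ∉ V) (hx : s.reg 2 ∉ N) (hM : s.reg 12 = M)
    (hB : 2 * M ≤ B) (hxM : s.reg 2 < M) (hN : ∀ c ∈ N, c < M) :
    Runs B attachProg s attachProg.maxTime fun s' =>
      Frame [15] [2, 4, 5] s s' ∧ Grown G r M N V (s.reg 2) (s.reg 11) s' := by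
  obtain ⟨h1, h2, h3⟩ := C _ ht htV
  have hc := Finset.card_le_card (s := kids r N (s.arr 2) (s.reg 16)) (t := Finset.range M)
    fun c hc => Finset.mem_range.2 (hN c (mem_kids.1 hc).1)
  rw [Finset.card_range] at hc
  have htM := hN _ ht
  refine (runs_attachProg hM hB hxM htM (by omega) h2).mono le_rfl ?_
  rintro s' ⟨hF, e2, e4, v, hv, hv', e5⟩
  have e3 : s'.arr 3 = s.arr 3 := hF.2 3 (by simp)
  have e11 : s'.reg 11 = s.reg 11 := hF.1 11 (by simp)
  refine ⟨hF, insert (s.reg 2) N, ⟨?_, ?_⟩, e11.ge, by omega, fun c hc => ?_⟩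
  · rw [e2, e3]
    exact hT
  · rw [e2, e4, e5]
    exact C.attach hx hr ht htV hv hv'
  · rcases Finset.mem_insert.1 hc with rfl | hc
    · exact .inr (.inl rfl)
    · exact .inl hc

theorem grown_aboveProg (C : Counts r M N V (s.arr 2) (s.arr 4) (s.arr 5))
    (hT : ∃ L, IsCotree G r (insert (s.reg 11) (insert (s.reg 2) N)) (insert (s.reg 2) V)
      (parAbove (s.arr 2) (s.reg 16) (s.reg 11) (s.reg 2))
      (Function.update (s.arr 3) (s.reg 11) (s.reg 17)) L r)
    (hr : r ∈ N) (ht : s.reg 16 ∈ N) (htr : s.reg 16 ≠ r) (hp : ∀ c ∈ N, s.arr 2 c ∈ N)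
    (hpV : ∀ c ∈ N, s.arr 2 c ∉ V) (hκ : s.reg 17 ≤ 1)
    (hx : s.reg 2 ∉ N) (hM : s.reg 12 = M)
    (hB : 2 * M ≤ B) (hxf : s.reg 2 < s.reg 11) (hf : s.reg 11 < M) (hN : ∀ c ∈ N, c < s.reg 11) :
    Runs B aboveProg s aboveProg.maxTime fun s' =>
      Frame [6, 11, 15] [2, 3, 4, 5] s s' ∧ s'.reg 11 = s.reg 11 + 1 ∧
      ∃ N', Holds G r M N' (insert (s.reg 2) V) s' ∧
        ∀ c ∈ N', c ∈ N ∨ c = s.reg 2 ∨ c = s.reg 11 := by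
  have hpt := hp _ ht
  have hptf := hN _ hpt
  have htf := hN _ ht
  refine (runs_aboveProg hM hB (by omega) (by omega) (by omega) hf hκ (by omega) (by omega)
    (C _ hpt (hpV _ ht)).2.1).mono le_rfl ?_
  rintro s' ⟨hF, e11, e2, e3, e4, v₁, hv₁, hv₁', v₂, hv₂, hv₂', e5⟩
  refine ⟨hF, e11, insert (s.reg 11) (insert (s.reg 2) N), ⟨?_, ?_⟩, fun c hc => ?_⟩
  · rw [e2, e3]
    exact hT
  · rw [e2, e4, e5]
    exact C.above hx (fun h => (hN _ h).false) (by omega) hr ht htr hp (hpV _ ht) hv₁ hv₁' hv₂ hv₂'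
  · simp only [Finset.mem_insert] at hc
    tauto

end Finish

/-- The place `u` of the vertex `x` and its full children are known. -/
structure Placed (G : SimpleGraph ℕ) (r M : ℕ) (N V : Finset ℕ) (L : ℕ → Finset ℕ) (x u : ℕ)
    (A : Finset ℕ) (s : State) : Prop where
  tree : IsCotree G r N V (s.arr 2) (s.arr 3) L r
  counts : Counts r M N V (s.arr 2) (s.arr 4) (s.arr 5)
  place : IsPlace G r N V (s.arr 2) (s.arr 3) L x u
  reg_x : s.reg 2 = x
  notMem : x ∉ N
  reg_u : s.reg 7 = u
  fullKids_eq : fullKids G r N (s.arr 2) L x u = A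
  reg_a : s.reg 8 = A.card
  mem_fullKids : ∀ c, c ∈ A ↔ ∃ j < s.reg 4, s.arr 8 j = c ∧ s.arr 2 c = u
  queue_mem : ∀ j < s.reg 4, s.arr 8 j ∈ N
  sum_lt : s.reg 10 < M
  sum_eq : (s.reg 10 : ZMod M) = ∑ c ∈ A, (c : ZMod M)
  last : A.Nonempty → s.reg 9 ∈ A
  reg_M : s.reg 12 = M
  reg_r : s.reg 13 = r
  lt_root : ∀ c ∈ N, c < r ↔ c ∈ V
  root_lt : r < s.reg 11
  lt_fresh : ∀ c ∈ N, c < s.reg 11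
  fresh_lt : s.reg 11 + 1 < M
  x_lt : x < r

/-- Move the full children of the place to a new node. -/
def regroupProg : Prog :=
  .seq (.assign 14 (.reg 11)) <| .seq (.assign 11 (.add (.reg 11) (.const 1))) <|
  .seq (.assign 3 (.const 0)) moveLoop

/-- Find the node that gets a new sibling or child. -/
def targetProg : Prog :=
  .seq (.assign 18 (.const 0)) <|
  .ite (.eq (.read 3 (.reg 7)) (.const 0))
    (.ite (.eq (.reg 8) (.const 0)) (.assign 16 (.reg 7))
      (.ite (.eq (.reg 8) (.const 1)) (.seq (.assign 16 (.reg 9)) (.assign 17 (.const 1)))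
        (.seq regroupProg belowProg)))
    (.ite (.eq (.read 4 (.reg 7)) (.add (.reg 8) (.const 1)))
      -- All children but one are full. The exceptional one is not in the queue; it is the sum of
      -- all children minus the sum of the full ones, modulo `M`.
      (.seq (.assign 15 (.add (.read 5 (.reg 7)) (.sub (.reg 12) (.reg 10)))) <|
        .seq reduce <| .seq (.assign 16 (.reg 15)) (.assign 17 (.const 0)))
      (.seq regroupProg overProg))

/-- Insert the vertex at the node that has been found. -/
def finishProg : Prog :=
  -- Leaves are the nodes with names below that of the root. A leaf cannot get a child, so it needs
  -- a new parent shared with `x`; an inner target needs one only after a regrouping.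
  .ite (.lt (.reg 16) (.reg 13)) aboveProg (.ite (.eq (.reg 18) (.const 1)) aboveProg attachProg)

/-- Insert the vertex in register 2 after its place has been found. -/
def insertProg : Prog := .seq targetProg finishProg

def targetTime (m : ℕ) : ℕ := (2 * m + 1) * (moveBody.maxTime + 3) + targetProg.maxTime

/-- The registers and arrays that are modified in the search for the target. -/
abbrev TargetFrame (s s' : State) : Prop :=
  Frame [3, 5, 6, 11, 14, 15, 16, 17, 18] [2, 3, 4, 5] s s'

section Target

variable {B r M m x u : ℕ} {G : SimpleGraph ℕ} {N V A : Finset ℕ} {L : ℕ → Finset ℕ} {s : State}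

theorem runs_regroupProg (P : Placed G r M N V L x u A s) (hB : 2 * M ≤ B) (hm : s.reg 4 ≤ 2 * m)
    (hmB : 2 * m ≤ B) :
    Runs B regroupProg s ((2 * m + 1) * (moveBody.maxTime + 3) + 8) fun s' =>
      Frame [3, 5, 11, 14] [2] s s' ∧ s'.reg 14 = s.reg 11 ∧ s'.reg 11 = s.reg 11 + 1 ∧
      s'.arr 2 = fun c => if c ∈ A then s.reg 11 else s.arr 2 c := by
  have h1 := P.fresh_lt
  refine Runs.assign_seq (T' := (2 * m + 1) * (moveBody.maxTime + 3) + 6)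
    (by simp only [Expr.eval]; omega) ?_ (by simp only [Expr.time]; omega)
  refine Runs.assign_seq (T' := (2 * m + 1) * (moveBody.maxTime + 3) + 2) ?_ ?_
    (by simp only [Expr.time]; omega)
  · simp only [Expr.eval, State.reg_setReg, Nat.reduceEqDiff, if_false]
    omega
  refine Runs.assign_seq (T' := (2 * m + 1) * (moveBody.maxTime + 3)) (Nat.zero_le _) ?_
    (by simp only [Expr.time]; omega)
  simp only [Expr.eval, State.reg_setReg, Nat.reduceEqDiff, if_false]
  refine (runs_moveLoop ?_ ?_ ?_ ?_).mono ?_ ?_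
  · simp [State.reg_setReg]
  · simp [State.reg_setReg]
    omega
  · simp only [State.reg_setReg, State.arr_setReg, Nat.reduceEqDiff, if_false]
    intro j hj
    have := P.lt_fresh _ (P.queue_mem j hj)
    omega
  · simp only [State.reg_setReg, State.arr_setReg, Nat.reduceEqDiff, if_false, if_true]
    omega
  · simp only [State.reg_setReg, State.arr_setReg, Nat.reduceEqDiff, if_false, if_true]
    exact Nat.mul_le_mul_right _ (by omega)
  · rintro s' ⟨hF, h⟩
    simp only [State.reg_setReg, State.arr_setReg, Nat.reduceEqDiff, if_false, if_true] at h
    refine ⟨Frame.trans (by simp [frame_setReg, Frame.refl]) (hF.mono (by simp) (by simp)),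
      hF.1 14 (by simp), hF.1 11 (by simp), ?_⟩
    funext y
    rw [h, P.reg_u]
    exact if_congr (P.mem_fullKids y).symm rfl rfl

/-- The last part of the program inserts the vertex. -/
def Finishes (B : ℕ) (G : SimpleGraph ℕ) (r M : ℕ) (N V : Finset ℕ) (x f : ℕ) (s : State) : Prop :=
  Runs B finishProg s finishProg.maxTime fun s' =>
    TargetFrame s s' ∧ Grown G r M N V x f s'

theorem Placed.finishes_attach (P : Placed G r M N V L x u A s) (hB : 2 * M ≤ B) {t : ℕ}
    {s' : State} (hF : Frame [15, 16, 17, 18] [] s s') (h18 : s'.reg 18 = 0)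
    (h16 : s'.reg 16 = t) (ht : t ∈ N) (htV : t ∉ V)
    (hT : ∃ L, IsCotree G r (insert x N) (insert x V)
      (Function.update (s.arr 2) x t) (s.arr 3) L r) :
    Finishes B G r M N V x (s.reg 11) s' := by
  have h2 : s'.arr 2 = s.arr 2 := hF.2 2 (by simp)
  have h3 : s'.arr 3 = s.arr 3 := hF.2 3 (by simp)
  have h4 : s'.arr 4 = s.arr 4 := hF.2 4 (by simp)
  have h5 : s'.arr 5 = s.arr 5 := hF.2 5 (by simp)
  have e2 : s'.reg 2 = x := (hF.1 2 (by simp)).trans P.reg_x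
  have e11 : s'.reg 11 = s.reg 11 := hF.1 11 (by simp)
  have e12 : s'.reg 12 = M := (hF.1 12 (by simp)).trans P.reg_M
  have e13 : s'.reg 13 = r := (hF.1 13 (by simp)).trans P.reg_r
  have hb := P.fresh_lt
  have hc := P.root_lt
  have hd := P.x_lt
  refine Runs.ite (fun h => ?_) fun _ => (Runs.ite (T := aboveProg.maxTime + attachProg.maxTime)
    (fun h => ?_) fun _ => ?_).mono (by simp only [Prog.maxTime]; omega) fun _ h => h
  · simp only [Test.holds, Expr.eval, h16, e13] at h
    exact absurd ((P.lt_root t ht).1 h) htV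
  · simp only [Test.holds, Expr.eval, h18] at h
    omega
  · subst h16 e2
    rw [← e11]
    refine (grown_attachProg (B := B) (N := N) (V := V) ?_ ?_ P.tree.root_mem ht htV P.notMem e12 hB (by omega)
      fun c hc => ?_).mono (by omega) fun s'' hs => ⟨hs.1.mono (by simp) (by simp), hs.2⟩
    · rw [h2, h4, h5]
      exact P.counts
    · rw [h2, h3]
      exact hT
    · have := P.lt_fresh c hc
      omega

/-- The nodes `N₁` are those of the old tree and possibly the split-off node, which has taken the
fresh name `f`. So the node inserted now is named `f` or `f + 1`. -/
theorem finishes_above {N₁ : Finset ℕ} {f : ℕ} (C : Counts r M N₁ V (s.arr 2) (s.arr 4) (s.arr 5))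
    (h18 : s.reg 16 < s.reg 13 ∨ s.reg 18 = 1)
    (hT : ∃ L, IsCotree G r (insert (s.reg 11) (insert (s.reg 2) N₁)) (insert (s.reg 2) V)
      (parAbove (s.arr 2) (s.reg 16) (s.reg 11) (s.reg 2))
      (Function.update (s.arr 3) (s.reg 11) (s.reg 17)) L r)
    (hr : r ∈ N₁) (ht : s.reg 16 ∈ N₁) (htr : s.reg 16 ≠ r) (hp : ∀ c ∈ N₁, s.arr 2 c ∈ N₁)
    (hpV : ∀ c ∈ N₁, s.arr 2 c ∉ V) (hκ : s.reg 17 ≤ 1)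
    (hx : s.reg 2 ∉ N₁) (hM : s.reg 12 = M)
    (hB : 2 * M ≤ B) (hxf : s.reg 2 < s.reg 11) (hf : s.reg 11 < M) (hN : ∀ c ∈ N₁, c < s.reg 11)
    (hN₁ : ∀ c ∈ N₁, c ∈ N ∨ (c = f ∧ f < s.reg 11)) (hf₁ : f ≤ s.reg 11) (hf₂ : s.reg 11 ≤ f + 1) :
    Finishes B G r M N V (s.reg 2) f s := by
  have key : Runs B aboveProg s aboveProg.maxTime fun s' =>
      TargetFrame s s' ∧ Grown G r M N V (s.reg 2) f s' := by
    refine (grown_aboveProg (B := B) C hT hr ht htr hp hpV hκ hx hM hB hxf hf hN).mono le_rfl ?_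
    rintro s' ⟨hF, h11, N', hN', h⟩
    refine ⟨hF.mono (by simp) (by simp), N', hN', by omega, by omega, fun c hc => ?_⟩
    rcases h c hc with h | h | h
    · rcases hN₁ c h with h | h
      · exact .inl h
      · exact .inr (.inr (by omega))
    · exact .inr (.inl h)
    · exact .inr (.inr (by omega))
  refine Runs.ite (fun h => key.mono (by omega) fun _ h => h) fun h =>
    (Runs.ite (T := aboveProg.maxTime + attachProg.maxTime) (fun _ => key.mono (by omega)
      fun _ h => h) fun h' => ?_).mono (by simp only [Prog.maxTime]; omega) fun _ h => h
  simp only [Test.holds, Expr.eval] at h h'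
  omega

/-- If the kind of exactly one child of the place is exceptional, then it is the target. -/
theorem Placed.finishes_unique (P : Placed G r M N V L x u A s) (hB : 2 * M ≤ B) {t : ℕ}
    {s' : State} {κ : ℕ} (hs : s.arr 3 u = κ) (hF : Frame [15, 16, 17, 18] [] s s')
    (h18 : s'.reg 18 = 0) (h16 : s'.reg 16 = t) (h17 : s'.reg 17 = 1 - κ)
    (ht : t ∈ kids r N (s.arr 2) u)
    (hA : ∀ d ∈ kids r N (s.arr 2) u, (d ∈ A ↔ κ = 1) ↔ d ≠ t) :
    Finishes B G r M N V x (s.reg 11) s' := by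
  obtain ⟨htN, htr, -⟩ := mem_kids.1 ht
  have hb := P.fresh_lt
  have hc := P.root_lt
  have hd := P.x_lt
  have hsx : s.reg 11 ≠ x := by omega
  rw [← P.fullKids_eq] at hA
  obtain ⟨k1, k2⟩ := P.place.insert_of_unique P.tree P.notMem (s := s.reg 11) hs ht hA
  by_cases htV : t ∈ V
  · have h2 : s'.arr 2 = s.arr 2 := hF.2 2 (by simp)
    have h3 : s'.arr 3 = s.arr 3 := hF.2 3 (by simp)
    have h4 : s'.arr 4 = s.arr 4 := hF.2 4 (by simp)
    have h5 : s'.arr 5 = s.arr 5 := hF.2 5 (by simp)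
    have e2 : s'.reg 2 = x := (hF.1 2 (by simp)).trans P.reg_x
    have e11 : s'.reg 11 = s.reg 11 := hF.1 11 (by simp)
    have e12 : s'.reg 12 = M := (hF.1 12 (by simp)).trans P.reg_M
    have e13 : s'.reg 13 = r := (hF.1 13 (by simp)).trans P.reg_r
    obtain ⟨L', hL'⟩ := k2 htV (fun h => (P.lt_fresh _ h).false) hsx
    rw [← e2, ← e11]
    refine finishes_above (N₁ := N) ?_ (.inl ?_) ?_ P.tree.root_mem ?_ ?_ ?_ ?_ ?_ ?_ e12 hB ?_ ?_ ?_
      (fun c hc => .inl hc) le_rfl (by omega)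
    · rw [h2, h4, h5]
      exact P.counts
    · rw [h16, e13]
      exact (P.lt_root t htN).2 htV
    · rw [h2, h3, e2, e11, h16, h17]
      exact ⟨L', hL'⟩
    · rwa [h16]
    · rwa [h16]
    · rw [h2]
      exact P.tree.par_mem
    · rw [h2]
      exact P.tree.par_notMem
    · omega
    · rw [e2]
      exact P.notMem
    · omega
    · omega
    · rw [e11]
      exact P.lt_fresh
  · exact P.finishes_attach hB hF h18 h16 htN htV (k1 htV)

theorem Placed.subset_kids (P : Placed G r M N V L x u A s) : A ⊆ kids r N (s.arr 2) u := by
  rw [← P.fullKids_eq]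
  exact fun c hc => (Cotree.mem_fullKids.1 hc).1

theorem Placed.counts_u (P : Placed G r M N V L x u A s) :
    s.arr 4 u = (kids r N (s.arr 2) u).card ∧ A.card < (kids r N (s.arr 2) u).card ∧
      (kids r N (s.arr 2) u).card ≤ M ∧ s.arr 5 u < M := by
  obtain ⟨h1, h2, h3⟩ := P.counts u P.place.mem P.place.notMem
  have hc := Finset.card_le_card (s := kids r N (s.arr 2) u) (t := Finset.range M)
    fun c hc => Finset.mem_range.2 (by
      have := P.lt_fresh c (mem_kids.1 hc).1
      have := P.fresh_lt
      omega)
  rw [Finset.card_range] at hc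
  have := P.place.card_lt P.tree
  rw [P.fullKids_eq] at this
  exact ⟨h1, this, hc, h2⟩

theorem Placed.runs_below (P : Placed G r M N V L x u A s) (hB : 2 * M ≤ B) (hm : s.reg 4 ≤ 2 * m)
    (hmB : 2 * m ≤ B) (hs : s.arr 3 u = 0) (hA : 2 ≤ A.card) :
    Runs B (.seq regroupProg belowProg) s
      ((2 * m + 1) * (moveBody.maxTime + 3) + 8 + belowProg.maxTime) fun s' =>
      TargetFrame s s' ∧ Finishes B G r M N V x (s.reg 11) s' := by
  have hb := P.fresh_lt
  have hc := P.root_lt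
  have hd := P.x_lt
  have hw : s.reg 11 ∉ N := fun h => (P.lt_fresh _ h).false
  have hw' : s.reg 11 + 1 ∉ N := fun h => by have := P.lt_fresh _ h; omega
  have huN := P.place.mem
  have huf := P.lt_fresh u huN
  obtain ⟨n1, n2, n3, n4⟩ := P.counts_u
  have hAk := P.subset_kids
  refine (runs_regroupProg P hB hm hmB).seq ?_ le_rfl
  rintro s₁ ⟨hF₁, h14, h11, h2⟩
  have e7 : s₁.reg 7 = u := (hF₁.1 7 (by simp)).trans P.reg_u
  have e8 : s₁.reg 8 = A.card := (hF₁.1 8 (by simp)).trans P.reg_a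
  have e10 : s₁.reg 10 = s.reg 10 := hF₁.1 10 (by simp)
  have e12 : s₁.reg 12 = M := (hF₁.1 12 (by simp)).trans P.reg_M
  have e3 : s₁.arr 3 = s.arr 3 := hF₁.2 3 (by simp)
  have e4 : s₁.arr 4 = s.arr 4 := hF₁.2 4 (by simp)
  have e5 : s₁.arr 5 = s.arr 5 := hF₁.2 5 (by simp)
  have hS := P.sum_lt
  refine (runs_belowProg e12 hB ?_ ?_ ?_ ?_ ?_ ?_ ?_).mono le_rfl ?_
  · omega
  · omega
  · omega
  · omega
  · rw [e4, e7]
    omega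
  · omega
  · rwa [e5, e7]
  rintro s₂ ⟨hF₂, f16, f17, f18, f2, f3, f4, v, hv, hv', f5⟩
  rw [h14] at f16 f2 f3 f4 f5 hv'
  rw [e7, h2] at f2
  rw [e3] at f3
  rw [e4, e7, e8] at f4
  rw [e5, e7, e10] at f5 hv'
  have g2 : s₂.reg 2 = x := ((hF₂.1 2 (by simp)).trans (hF₁.1 2 (by simp))).trans P.reg_x
  have g11 : s₂.reg 11 = s.reg 11 + 1 := (hF₂.1 11 (by simp)).trans h11
  have g12 : s₂.reg 12 = M := (hF₂.1 12 (by simp)).trans e12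
  have hpar : ∀ c, s₂.arr 2 c = if c = s.reg 11 then u else if c ∈ A then s.reg 11 else s.arr 2 c := by
    intro c
    rw [f2, Function.update_apply]
  obtain ⟨L', hL'⟩ := P.place.insert_below P.tree P.notMem (w := s.reg 11) (s := s.reg 11 + 1) hs
    (by rwa [P.fullKids_eq]) hw (by omega) hw' (by omega) (by omega)
  rw [P.fullKids_eq] at hL'
  refine ⟨(hF₁.mono (by simp) (by simp)).trans (hF₂.mono (by simp) (by simp)), ?_⟩
  rw [← g2]
  refine finishes_above (N₁ := insert (s.reg 11) N) ?_ (.inr f18) ?_ ?_ ?_ ?_ ?_ ?_ ?_ ?_ g12 hB ?_ ?_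
    ?_ ?_ ?_ ?_
  · rw [f2, f4, f5]
    exact P.counts.groupBelow hw P.tree.root_mem huN P.place.notMem P.tree.par_mem hAk hS P.sum_eq
      hv hv'
  · rw [f2, f3, f16, f17, g2, g11]
    exact ⟨L', hL'⟩
  · exact Finset.mem_insert_of_mem P.tree.root_mem
  · rw [f16]
    exact Finset.mem_insert_self _ _
  · omega
  · intro c hc
    rw [hpar]
    have := P.tree.par_mem c
    grind
  · intro c hc
    rw [hpar]
    have := P.tree.par_notMem c
    have := P.place.notMem
    have := P.tree.leaf_mem
    grind
  · omega
  · rw [g2, Finset.mem_insert, not_or]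
    exact ⟨by omega, P.notMem⟩
  · omega
  · omega
  · intro c hc
    rcases Finset.mem_insert.1 hc with rfl | hc
    · omega
    · have := P.lt_fresh c hc
      omega
  · intro c hc
    rcases Finset.mem_insert.1 hc with rfl | hc
    · exact .inr ⟨rfl, by omega⟩
    · exact .inl hc
  · omega
  · omega

theorem Placed.runs_over (P : Placed G r M N V L x u A s) (hB : 2 * M ≤ B) (hm : s.reg 4 ≤ 2 * m)
    (hmB : 2 * m ≤ B) (hs : s.arr 3 u = 1) (hA : A.card + 2 ≤ (kids r N (s.arr 2) u).card) :
    Runs B (.seq regroupProg overProg) s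
      ((2 * m + 1) * (moveBody.maxTime + 3) + 8 + overProg.maxTime) fun s' =>
      TargetFrame s s' ∧ Finishes B G r M N V x (s.reg 11) s' := by
  have hb := P.fresh_lt
  have hc := P.root_lt
  have hd := P.x_lt
  have hw : s.reg 11 ∉ N := fun h => (P.lt_fresh _ h).false
  have hw' : s.reg 11 + 1 ∉ N := fun h => by have := P.lt_fresh _ h; omega
  have huN := P.place.mem
  have huf := P.lt_fresh u huN
  have hur : u ≠ r := by
    rintro rfl
    have := P.tree.ser_root
    omega
  have hpu := P.tree.par_ne huN hur
  have hpN := P.tree.par_mem u huN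
  have hpV := P.tree.par_notMem u huN
  have hpf := P.lt_fresh _ hpN
  obtain ⟨n1, n2, n3, n4⟩ := P.counts_u
  have n5 := (P.counts _ hpN hpV).2.1
  have hAk := P.subset_kids
  have huA : u ∉ A := fun h => hpu (mem_kids.1 (hAk h)).2.2
  refine (runs_regroupProg P hB hm hmB).seq ?_ le_rfl
  rintro s₁ ⟨hF₁, h14, h11, h2⟩
  have e7 : s₁.reg 7 = u := (hF₁.1 7 (by simp)).trans P.reg_u
  have e8 : s₁.reg 8 = A.card := (hF₁.1 8 (by simp)).trans P.reg_a
  have e10 : s₁.reg 10 = s.reg 10 := hF₁.1 10 (by simp)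
  have e12 : s₁.reg 12 = M := (hF₁.1 12 (by simp)).trans P.reg_M
  have e3 : s₁.arr 3 = s.arr 3 := hF₁.2 3 (by simp)
  have e4 : s₁.arr 4 = s.arr 4 := hF₁.2 4 (by simp)
  have e5 : s₁.arr 5 = s.arr 5 := hF₁.2 5 (by simp)
  have e2 : s₁.arr 2 u = s.arr 2 u := by rw [h2]; exact if_neg huA
  have hS := P.sum_lt
  refine (runs_overProg e12 hB ?_ ?_ ?_ ?_ ?_ ?_ ?_ ?_ ?_ ?_ ?_ ?_).mono le_rfl ?_
  · omega
  · omega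
  · omega
  · omega
  · omega
  · rw [e7, e2]
    omega
  · rw [e7, e2]
    omega
  · rwa [e7, e2]
  · rw [e4, e7]
    omega
  · omega
  · rwa [e5, e7]
  · rwa [e5, e7, e2]
  rintro s₂ ⟨hF₂, f16, f17, f18, f2, f3, f4, v₁, hv₁, hv₁', v₂, hv₂, hv₂', v₃, hv₃, hv₃', f5⟩
  rw [h14] at f2 f3 f4 f5 hv₃'
  rw [e7] at f16 f2 f4 f5 hv₁' hv₂' hv₃'
  rw [e2] at f2 f5 hv₃'
  rw [h2] at f2
  rw [e3] at f3
  rw [e4, e8] at f4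
  rw [e5] at f5 hv₂' hv₃'
  rw [e10, P.sum_eq] at hv₁' hv₂'
  have g2 : s₂.reg 2 = x := ((hF₂.1 2 (by simp)).trans (hF₁.1 2 (by simp))).trans P.reg_x
  have g11 : s₂.reg 11 = s.reg 11 + 1 := (hF₂.1 11 (by simp)).trans h11
  have g12 : s₂.reg 12 = M := (hF₂.1 12 (by simp)).trans e12
  have hpar : ∀ c, s₂.arr 2 c = if c = u then s.reg 11 else if c = s.reg 11 then s.arr 2 u else
      if c ∈ A then s.reg 11 else s.arr 2 c := by
    intro c
    rw [f2, Function.update_apply, Function.update_apply]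
  obtain ⟨L', hL'⟩ := P.place.insert_over P.tree P.notMem (w := s.reg 11) (s := s.reg 11 + 1) hs
    (by rwa [P.fullKids_eq]) hw (by omega) hw' (by omega) (by omega)
  rw [P.fullKids_eq] at hL'
  refine ⟨(hF₁.mono (by simp) (by simp)).trans (hF₂.mono (by simp) (by simp)), ?_⟩
  rw [← g2]
  refine finishes_above (N₁ := insert (s.reg 11) N) ?_ (.inr f18) ?_ ?_ ?_ ?_ ?_ ?_ ?_ ?_ g12 hB ?_ ?_
    ?_ ?_ ?_ ?_
  · rw [f2, f4, f5]
    exact P.counts.groupOver hw P.tree.root_mem huN P.place.notMem hur P.tree.par_mem hpV hpu hAk huA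
      hv₁ hv₁' hv₂ hv₂' hv₃ hv₃'
  · rw [f2, f3, f16, f17, g2, g11]
    exact ⟨L', hL'⟩
  · exact Finset.mem_insert_of_mem P.tree.root_mem
  · rw [f16]
    exact Finset.mem_insert_of_mem huN
  · omega
  · intro c hc
    rw [hpar]
    have := P.tree.par_mem c
    grind
  · intro c hc
    rw [hpar]
    have := P.tree.par_notMem c
    have := P.place.notMem
    have := P.tree.leaf_mem
    grind
  · omega
  · rw [g2, Finset.mem_insert, not_or]
    exact ⟨by omega, P.notMem⟩
  · omega
  · omega
  · intro c hc
    rcases Finset.mem_insert.1 hc with rfl | hc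
    · omega
    · have := P.lt_fresh c hc
      omega
  · intro c hc
    rcases Finset.mem_insert.1 hc with rfl | hc
    · exact .inr ⟨rfl, by omega⟩
    · exact .inl hc
  · omega
  · omega

/-- If all children of the place but one are full, then the exceptional one is known from the sum of
the children. -/
theorem Placed.exists_eq_sum (P : Placed G r M N V L x u A s)
    (hA : (kids r N (s.arr 2) u).card = A.card + 1) : ∃ t ∈ kids r N (s.arr 2) u,
      (∀ d ∈ kids r N (s.arr 2) u, d ∈ A ↔ d ≠ t) ∧
      ∀ v < M, (v : ZMod M) = s.arr 5 u - s.reg 10 → v = t := by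
  obtain ⟨-, -, h3⟩ := P.counts u P.place.mem P.place.notMem
  have hAk := P.subset_kids
  have h1 : (kids r N (s.arr 2) u \ A).card = 1 := by
    rw [Finset.card_sdiff_of_subset hAk]
    omega
  obtain ⟨t, ht⟩ := Finset.card_eq_one.1 h1
  have htk := Finset.mem_sdiff.1 (ht ▸ Finset.mem_singleton_self t)
  refine ⟨t, htk.1, fun d hd => ?_, fun v hv hv' => ?_⟩
  · have := Finset.ext_iff.1 ht d
    rw [Finset.mem_sdiff, Finset.mem_singleton] at this
    tauto
  · rw [h3, P.sum_eq, ← Finset.sum_sdiff_eq_sub hAk, ht, Finset.sum_singleton,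
      ZMod.natCast_eq_natCast_iff'] at hv'
    have htM : t < M := by
      have := P.lt_fresh t (mem_kids.1 htk.1).1
      have := P.fresh_lt
      omega
    rwa [Nat.mod_eq_of_lt hv, Nat.mod_eq_of_lt htM] at hv'

theorem Placed.setReg (P : Placed G r M N V L x u A s) {y v : ℕ}
    (hy : y ∉ [2, 4, 7, 8, 9, 10, 11, 12, 13]) : Placed G r M N V L x u A (s.setReg y v) := by
  have h : ∀ z ∈ [2, 4, 7, 8, 9, 10, 11, 12, 13], (s.setReg y v).reg z = s.reg z := by
    intro z hz
    rw [State.reg_setReg, if_neg (by rintro rfl; exact hy hz)]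
  obtain ⟨h1, h2, h3, h4, h5, h6, h7, h8, h9, h10, h11, h12, h13, h14, h15, h16, h17, h18, h19,
    h20⟩ := P
  constructor <;> (try simp only [State.arr_setReg]) <;> (try rw [h _ (by simp)]) <;> assumption

theorem Placed.runs_targetProg (P : Placed G r M N V L x u A s) (hB : 2 * M ≤ B)
    (hm : s.reg 4 ≤ 2 * m) (hmB : 2 * m ≤ B) :
    Runs B targetProg s (targetTime m) fun s' =>
      TargetFrame s s' ∧ Finishes B G r M N V x (s.reg 11) s' := by
  have hb := P.fresh_lt
  have hc := P.root_lt
  have hd := P.x_lt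
  obtain ⟨n1, n2, n3, n4⟩ := P.counts_u
  have hAk := P.subset_kids
  have huM := P.lt_fresh u P.place.mem
  refine Runs.assign_seq (Nat.zero_le _) (T' := targetTime m - 2) ?_
    (by simp only [targetTime, targetProg, Prog.maxTime, Expr.time]; omega)
  simp only [Expr.eval]
  set s₀ := s.setReg 18 0 with hs₀
  have P₀ : Placed G r M N V L x u A s₀ := P.setReg (by simp)
  have hF₀ : ∀ {s'}, TargetFrame s₀ s' → TargetFrame s s' := fun h =>
    Frame.trans (by simp [hs₀, frame_setReg, Frame.refl]) h
  have h18 : s₀.reg 18 = 0 := rfl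
  have hs := P.tree.ser_le u P.place.mem P.place.notMem
  -- The surplus of 40 pays for the tests on the way to the regrouping branches; the differences
  -- `targetTime m - c` below are what remains after the tests.
  have hTt : (2 * m + 1) * (moveBody.maxTime + 3) + 8 + (belowProg.maxTime + overProg.maxTime) + 40 ≤
    targetTime m := by
    simp only [targetTime, targetProg, Prog.maxTime, Expr.time, Test.time, reduce, regroupProg]
    omega
  refine (Runs.ite (T := targetTime m - 10) (fun h => ?_) fun h => ?_).mono
    (by simp only [Test.time, Expr.time]; omega) fun _ h => h <;>
  simp only [Test.holds, Expr.eval, P₀.reg_u] at h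
  · refine (Runs.ite (T := targetTime m - 16) (fun h' => ?_) fun h' => ?_).mono
      (by simp only [Test.time, Expr.time]; omega) fun _ h => h <;>
    simp only [Test.holds, Expr.eval, P₀.reg_a] at h'
    · refine (Runs.of_wp ?_).mono (T := Prog.maxTime (.assign 16 (.reg 7)))
        (by simp only [Prog.maxTime, Expr.time]; omega) fun _ h => h
      simp only [Prog.wp, Expr.eval, P₀.reg_u]
      refine ⟨by omega, by simp [hs₀, frame_setReg, Frame.refl], ?_⟩
      refine P₀.finishes_attach hB (by simp [frame_setReg, Frame.refl]) rfl rfl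
        P.place.mem P.place.notMem (P.place.insert_of_no_full P.tree P.notMem h ?_)
      exact P.fullKids_eq.trans (Finset.card_eq_zero.1 h')
    · refine (Runs.ite (T := targetTime m - 22) (fun h'' => ?_) fun h'' => ?_).mono
        (by simp only [Test.time, Expr.time]; omega) fun _ h => h <;>
      simp only [Test.holds, Expr.eval, P₀.reg_a] at h''
      · obtain ⟨t, rfl⟩ := Finset.card_eq_one.1 h''
        have ht : s.reg 9 = t := Finset.mem_singleton.1 (P.last (by simp))
        have htM := P.lt_fresh t (mem_kids.1 (hAk (by simp))).1
        refine (Runs.of_wp ?_).mono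
          (T := Prog.maxTime (.seq (.assign 16 (.reg 9)) (.assign 17 (.const 1))))
          (by simp only [Prog.maxTime, Expr.time]; omega) fun _ h => h
        simp only [Prog.wp, Expr.eval, hs₀, State.reg_setReg, Nat.reduceEqDiff, if_false]
        refine ⟨by omega, by omega, by simp [frame_setReg, Frame.refl], ?_⟩
        refine P₀.finishes_unique hB (t := t) h (by simp [hs₀, frame_setReg, Frame.refl]) rfl ht rfl
          (hAk (by simp)) fun d _ => by simp
      · exact (P₀.runs_below hB hm hmB h (by omega)).mono (by omega) fun _ h => ⟨hF₀ h.1, h.2⟩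
  · replace h : s.arr 3 u = 1 := by
      change ¬ s.arr 3 u = 0 at h
      omega
    refine (Runs.ite (T := targetTime m - 20) (fun h' => ?_) fun h' => ?_).mono
      (by simp only [Test.time, Expr.time]; omega) fun _ h => h <;>
    simp only [Test.holds, Expr.eval, P₀.reg_a, P₀.reg_u] at h'
    · obtain ⟨t, htk, ht, hv⟩ := P.exists_eq_sum (n1.symm.trans h')
      refine (Runs.of_wp ?_).mono
        (T := Prog.maxTime (.seq (.assign 15 (.add (.read 5 (.reg 7)) (.sub (.reg 12) (.reg 10)))) <|
          .seq reduce <| .seq (.assign 16 (.reg 15)) (.assign 17 (.const 0))))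
        (by simp only [targetTime, targetProg, Prog.maxTime, Expr.time, Test.time, reduce]; omega)
        fun _ h => h
      have hS := P.sum_lt
      have e12 := P.reg_M
      have e7 := P.reg_u
      simp only [Prog.wp, Expr.eval, hs₀, State.reg_setReg, State.arr_setReg, Nat.reduceEqDiff,
        if_false, e7]
      refine ⟨by omega, wp_reduce (M := M) e12 ?_ (by omega) fun v hvM hv' => ?_⟩ <;>
      simp only [State.reg_setReg, State.arr_setReg, Nat.reduceEqDiff, if_false, if_true] at *
      · omega
      · refine ⟨by omega, by omega, by simp [frame_setReg, Frame.refl], ?_⟩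
        refine P₀.finishes_unique hB (t := t) h (by simp [hs₀, frame_setReg, Frame.refl]) rfl
          (hv v hvM ?_) rfl htk fun d hd => by simp [ht d hd]
        rw [hv', Nat.cast_add, e12, Nat.cast_sub hS.le]
        simp [sub_eq_add_neg]
    · change ¬ s.arr 4 u = A.card + 1 at h'
      exact (P₀.runs_over hB hm hmB h (by change _ ≤ (kids r N (s.arr 2) u).card; omega)).mono (by omega) fun _ h => ⟨hF₀ h.1, h.2⟩

theorem Placed.runs_insertProg (P : Placed G r M N V L x u A s) (hB : 2 * M ≤ B)
    (hm : s.reg 4 ≤ 2 * m) (hmB : 2 * m ≤ B) :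
    Runs B insertProg s (targetTime m + finishProg.maxTime) fun s' =>
      TargetFrame s s' ∧ Grown G r M N V x (s.reg 11) s' :=
  (P.runs_targetProg hB hm hmB).seq (fun _ h => h.2.mono le_rfl fun _ h' => ⟨h.1.trans h'.1, h'.2⟩)
    le_rfl

end Target

end Algo

/-! ### Insertion of one vertex. -/

namespace Algo

open WordRAM Cotree

/-- The body of the loop that collects the neighbors that are already in the tree. -/
def seedBody : Prog :=
  .seq (.assign 5 (.read 1 (.reg 3))) <|
  .seq (.ite (.lt (.reg 5) (.reg 2))
    (.seq (.store 8 (.reg 4) (.reg 5)) (.assign 4 (.add (.reg 4) (.const 1)))) .skip) <|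
  .assign 3 (.add (.reg 3) (.const 1))

def seedLoop : Prog := .loop (.lt (.reg 3) (.reg 15)) seedBody

theorem runs_seedLoop {B lo hi : ℕ} {s : State} (hlo : s.reg 3 = lo) (hhi : s.reg 15 = hi)
    (hle : lo ≤ hi) (h0 : s.reg 4 = 0) (hinj : Set.InjOn (s.arr 1) (Set.Ico lo hi)) (hB : hi ≤ B)
    (hadj : ∀ i ∈ Set.Ico lo hi, s.arr 1 i ≤ B) :
    Runs B seedLoop s ((hi - lo + 1) * (seedBody.maxTime + 3)) fun s' =>
      Frame [3, 4, 5] [8] s s' ∧ s'.reg 4 ≤ hi - lo ∧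
      (∀ j < s'.reg 4, ∀ j' < s'.reg 4, s'.arr 8 j = s'.arr 8 j' → j = j') ∧
      ∀ y, (∃ j < s'.reg 4, s'.arr 8 j = y) ↔ y < s.reg 2 ∧ ∃ i ∈ Set.Ico lo hi, s.arr 1 i = y := by
  refine (Runs.loop_of_measure (K := seedBody.maxTime) (fun s' => Frame [3, 4, 5] [8] s s' ∧
      lo ≤ s'.reg 3 ∧ s'.reg 3 ≤ hi ∧ s'.reg 4 ≤ s'.reg 3 - lo ∧
      (∀ j < s'.reg 4, ∀ j' < s'.reg 4, s'.arr 8 j = s'.arr 8 j' → j = j') ∧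
      ∀ y, (∃ j < s'.reg 4, s'.arr 8 j = y) ↔
        y < s.reg 2 ∧ ∃ i ∈ Set.Ico lo (s'.reg 3), s.arr 1 i = y)
      (fun s' => hi - s'.reg 3) ?_ ⟨Frame.refl _ _ _, ?_, ?_, ?_, ?_, ?_⟩).mono ?_ ?_
  · rintro s' ⟨hF, h1, h2, h3, h4, h5⟩ hlt
    have e1 : s'.arr 1 = s.arr 1 := hF.2 1 (by simp)
    have e2 : s'.reg 2 = s.reg 2 := hF.1 2 (by simp)
    have e15 : s'.reg 15 = hi := (hF.1 15 (by simp)).trans hhi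
    simp only [Test.holds, Expr.eval, e15] at hlt
    have hmem : s'.reg 3 ∈ Set.Ico lo hi := ⟨h1, hlt⟩
    have hIco : Set.Ico lo (s'.reg 3 + 1) = insert (s'.reg 3) (Set.Ico lo (s'.reg 3)) := by
      ext i
      simp only [Set.mem_Ico, Set.mem_insert_iff]
      omega
    have hnew : ∀ i ∈ Set.Ico lo (s'.reg 3), s.arr 1 i ≠ s.arr 1 (s'.reg 3) := by
      intro i hi' h
      have := hinj ⟨hi'.1, hi'.2.trans hlt⟩ hmem h
      exact hi'.2.ne this
    have hq : ∀ j < s'.reg 4, s'.arr 8 j ≠ s.arr 1 (s'.reg 3) := by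
      intro j hj h
      obtain ⟨-, i, hi', h'⟩ := (h5 _).1 ⟨j, hj, rfl⟩
      exact hnew i hi' (h'.trans h)
    have hb := hadj _ hmem
    refine Runs.of_wp ?_
    simp only [seedBody, Prog.wp, Expr.eval, Test.holds, State.reg_setReg, State.arr_setReg,
      State.reg_setArr, State.arr_setArr, e1, e2]
    simp only [Nat.reduceEqDiff, if_true, if_false]
    refine ⟨hb, fun h => ⟨hb, by omega, by omega, ⟨by simp [frame_setReg, frame_setArr, hF],
      by omega, by omega, by omega, ?_, fun y => ?_⟩, by omega⟩, fun h => ⟨by omega,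
      ⟨by simp [frame_setReg, frame_setArr, hF], by omega, by omega, by omega, h4, fun y => ?_⟩,
      by omega⟩⟩
    · intro j hj j' hj'
      have := h4 j
      simp only [Function.update_apply]
      grind
    · have hy := h5 y
      have hupd : (∃ j < s'.reg 4 + 1, Function.update (s'.arr 8) (s'.reg 4) (s.arr 1 (s'.reg 3)) j = y)
          ↔ (∃ j < s'.reg 4, s'.arr 8 j = y) ∨ s.arr 1 (s'.reg 3) = y := by
        simp only [Nat.lt_succ_iff_lt_or_eq, or_and_right, exists_or, exists_eq_left,
          Function.update_self]
        refine or_congr_left (exists_congr fun j => and_congr_right fun hj => ?_)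
        rw [Function.update_of_ne hj.ne]
      rw [hupd, hy, hIco]
      simp only [Set.mem_insert_iff, or_and_right, exists_or, exists_eq_left]
      constructor
      · rintro (h | rfl)
        · exact ⟨h.1, .inr h.2⟩
        · exact ⟨h, .inl rfl⟩
      · rintro ⟨h, h' | h'⟩
        · exact .inr h'
        · exact .inl ⟨h, h'⟩
    · rw [h5, hIco]
      simp only [Set.mem_insert_iff, or_and_right, exists_or, exists_eq_left]
      constructor
      · exact fun h => ⟨h.1, .inr h.2⟩
      · rintro ⟨h', rfl | h''⟩
        · exact absurd h' h
        · exact ⟨h', h''⟩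
  · omega
  · omega
  · omega
  · omega
  · simp [h0, hlo]
  · rw [hlo]
    simp [Test.time, Expr.time]
  · rintro s' ⟨⟨hF, h1, h2, h3, h4, h5⟩, hlt⟩
    have e15 : s'.reg 15 = hi := (hF.1 15 (by simp)).trans hhi
    simp only [Test.holds, Expr.eval, e15] at hlt
    have : s'.reg 3 = hi := by omega
    rw [this] at h3 h5
    exact ⟨hF, h3, h4, h5⟩

/-- The part of the program that inserts the vertex in register 2 into the cotree. -/
def vertexProg : Prog :=
  .seq (.assign 3 (.read 0 (.reg 2))) <|
  .seq (.assign 15 (.read 0 (.add (.reg 2) (.const 1)))) <|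
  .seq (.assign 4 (.const 0)) <|
  .seq seedLoop <| .seq locateProg <| .seq insertProg <| .assign 2 (.add (.reg 2) (.const 1))

/-- A bound for the running time of `vertexProg` in units of the degree plus one. -/
def vertexConst : ℕ :=
  (seedBody.maxTime + 3) + locateTime 1 + targetTime 1 + finishProg.maxTime + 30

/-- The arrays `off` and `adj` hold the adjacency lists of a graph on `0, …, n - 1`. -/
structure Lists (G : SimpleGraph ℕ) (n : ℕ) (off adj : ℕ → ℕ) : Prop where
  off_le : ∀ v < n, off v ≤ off (v + 1)
  bijOn : ∀ v < n, Set.BijOn adj (Set.Ico (off v) (off (v + 1))) (G.neighborSet v)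
  lt : ∀ v w, G.Adj v w → v < n

/-- The vertices below `x` and two isolated dummies. -/
def leaves (n x : ℕ) : Finset ℕ := insert n (insert (n + 1) (Finset.range x))

theorem mem_leaves {n x y : ℕ} : y ∈ leaves n x ↔ y = n ∨ y = n + 1 ∨ y < x := by
  simp [leaves]

theorem leaves_succ (n x : ℕ) : leaves n (x + 1) = insert x (leaves n x) := by
  ext y
  simp only [Finset.mem_insert, mem_leaves]
  omega

/-- The state of the program after the vertices below the one in register 2 have been inserted. -/
structure Inserted (G : SimpleGraph ℕ) (n k : ℕ) (off adj : ℕ → ℕ) (N : Finset ℕ) (s : State) :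
    Prop where
  holds : Holds G (n + 2) (3 * n + 4) N (leaves n (s.reg 2)) s
  le : s.reg 2 ≤ n
  lt_root : ∀ c ∈ N, c < n + 2 ↔ c ∈ leaves n (s.reg 2)
  root_lt : n + 2 < s.reg 11
  lt_fresh : ∀ c ∈ N, c < s.reg 11
  fresh_le : s.reg 11 ≤ n + 3 + 2 * s.reg 2
  reg_n : s.reg 0 = n
  reg_k : s.reg 1 = k
  reg_M : s.reg 12 = 3 * n + 4
  reg_r : s.reg 13 = n + 2
  off : s.arr 0 = off
  adj : s.arr 1 = adj
  cnt : ∀ y, s.arr 6 y = 0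
  low : ∀ y, s.arr 7 y ≤ s.reg 2
  sz : s.arr 9 = fun _ => 0
  g : s.arr 10 = fun _ => 0

theorem locateTime_le (d : ℕ) : locateTime d ≤ locateTime 1 * (d + 1) := by
  simp only [locateTime]
  nlinarith [Nat.zero_le (d * markBody.maxTime), Nat.zero_le (d * lowBody.maxTime),
    Nat.zero_le (d * findBody.maxTime), Nat.zero_le (d * collectBody.maxTime),
    Nat.zero_le markBody.maxTime, Nat.zero_le lowBody.maxTime,
    Nat.zero_le findBody.maxTime, Nat.zero_le collectBody.maxTime]

theorem targetTime_le (d : ℕ) : targetTime d ≤ targetTime 1 * (d + 1) := by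
  simp only [targetTime]
  nlinarith [Nat.zero_le (d * moveBody.maxTime), Nat.zero_le (d * targetProg.maxTime),
    Nat.zero_le moveBody.maxTime]

/-- The queue starts with those neighbors of `x` that are already in the tree. It never exceeds
twice the degree, and every loop runs over the adjacency list or over the queue. -/
theorem runs_vertexProg {B n k x : ℕ} {G : SimpleGraph ℕ} {off adj : ℕ → ℕ} {N : Finset ℕ} {s : State}
    (hG : PathFree G) (hA : Lists G n off adj) (hB : 2 * (3 * n + 4) ≤ B)
    (hoff : ∀ v ≤ n, 2 * off v ≤ B) (I : Inserted G n k off adj N s) (hx : s.reg 2 = x)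
    (hxn : x < n) :
    Runs B vertexProg s (vertexConst * (off (x + 1) - off x + 1)) fun s' =>
      s'.reg 2 = x + 1 ∧ ∃ N', Inserted G n k off adj N' s' := by
  have hle := hA.off_le x hxn
  obtain ⟨b1, b2, b3⟩ := hA.bijOn x hxn
  have hox := hoff x hxn.le
  have hox' := hoff (x + 1) hxn
  have hlt : ∀ y, G.Adj x y → y < n := fun y h => hA.lt y x h.symm
  have hroot := I.root_lt
  have hfresh := I.fresh_le
  set d := off (x + 1) - off x with hd
  have ht1 := locateTime_le d
  have ht2 := targetTime_le d
  have hT : 10 + ((d + 1) * (seedBody.maxTime + 3) + (locateTime d +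
      (targetTime d + finishProg.maxTime + 4))) ≤ vertexConst * (d + 1) := by
    have h1 := Nat.zero_le (d * finishProg.maxTime)
    simp only [vertexConst]
    nlinarith
  refine Runs.assign_seq (T' := vertexConst * (d + 1) - 3) ?_ ?_ (by simp only [Expr.time]; omega)
  · simp only [Expr.eval, I.off, hx]
    omega
  refine Runs.assign_seq (T' := vertexConst * (d + 1) - 8) ?_ ?_ (by simp only [Expr.time]; omega)
  · simp only [Expr.eval, State.reg_setReg, State.arr_setReg, Nat.reduceEqDiff, if_false, I.off, hx]
    omega
  refine Runs.assign_seq (T' := vertexConst * (d + 1) - 10) (Nat.zero_le _) ?_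
    (by simp only [Expr.time]; omega)
  simp only [Expr.eval, State.reg_setReg, State.arr_setReg, Nat.reduceEqDiff, if_false, I.off, hx]
  set s₀ := ((s.setReg 3 (off x)).setReg 15 (off (x + 1))).setReg 4 0 with hs₀
  have hF₀ : Frame [3, 4, 15] [] s s₀ := by simp [hs₀, frame_setReg, Frame.refl]
  have h1 : s₀.arr 1 = adj := I.adj
  have h2 : s₀.reg 2 = x := hx
  refine Runs.seq (runs_seedLoop (B := B) (lo := off x) (hi := off (x + 1)) (s := s₀) rfl rfl hle rfl (h1 ▸ b2) (by omega)
    fun i hi => ?_) (T₂ := locateTime d + (targetTime d + finishProg.maxTime + 4)) ?_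
    (by rw [← hd]; omega)
  · rw [h1]
    have := hlt _ (b1 hi)
    omega
  rintro s₁ ⟨hF₁, hm, hinj, hq⟩
  have hF₁' : Frame [3, 4, 5, 15] [8] s s₁ :=
    (hF₀.mono (by simp) (by simp)).trans (hF₁.mono (by simp) (by simp))
  have hq' : ∀ y, (∃ j < s₁.reg 4, s₁.arr 8 j = y) ↔ y < x ∧ G.Adj x y := by
    intro y
    rw [hq, h2, h1]
    refine and_congr_right fun _ => ⟨?_, fun h => ?_⟩
    · rintro ⟨i, hi, rfl⟩
      exact b1 hi
    · obtain ⟨i, hi, h⟩ := b3 (show y ∈ G.neighborSet x from h)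
      exact ⟨i, hi, h⟩
  obtain ⟨⟨L, T⟩, C⟩ := I.holds
  have e2 : s₁.reg 2 = x := (hF₁'.1 2 (by simp)).trans hx
  have e11 : s₁.reg 11 = s.reg 11 := hF₁'.1 11 (by simp)
  have e12 : s₁.reg 12 = 3 * n + 4 := (hF₁'.1 12 (by simp)).trans I.reg_M
  have e13 : s₁.reg 13 = n + 2 := (hF₁'.1 13 (by simp)).trans I.reg_r
  have f2 : s₁.arr 2 = s.arr 2 := hF₁'.2 2 (by simp)
  have f3 : s₁.arr 3 = s.arr 3 := hF₁'.2 3 (by simp)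
  have f4 : s₁.arr 4 = s.arr 4 := hF₁'.2 4 (by simp)
  have f5 : s₁.arr 5 = s.arr 5 := hF₁'.2 5 (by simp)
  have f6 : s₁.arr 6 = s.arr 6 := hF₁'.2 6 (by simp)
  have f7 : s₁.arr 7 = s.arr 7 := hF₁'.2 7 (by simp)
  rw [hx] at T C
  have hlr := I.lt_root
  rw [hx] at hlr hfresh
  rw [← f2, ← f3] at T
  rw [← f2, ← f4, ← f5] at C
  have hxN : x ∉ N := by
    intro h
    have := (hlr x h).1 (by omega)
    rw [mem_leaves] at this
    omega
  have hnch : ∀ p ∈ N, p ∉ leaves n x → s₁.arr 4 p = (kids (n + 2) N (s₁.arr 2) p).card :=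
    fun p hp hV => (C p hp hV).1
  refine (runs_locateProg (B := B) (m := s₁.reg 4) (M := 3 * n + 4) (s := s₁) hG T hnch ?_
    (.of_leaves T hnch hinj ?_ ?_ ?_ ?_) rfl ?_ hB (by omega) (by omega) ?_ e12 e13 (by omega)).mono
    (T' := locateTime d) ?_ (fun _ h => h)
    |>.seq (T₂ := targetTime d + finishProg.maxTime + 4) ?_ le_rfl
  -- The dummy `n` is a leaf below the root and not a neighbor of `x`, so the root is not full.
  · rw [e2, Full, T.L_root]
    intro h
    have := hlt _ (h n (mem_leaves.2 (.inl rfl)))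
    exact this.false
  · intro j hj
    exact mem_leaves.2 (.inr (.inr ((hq' _).1 ⟨j, hj, rfl⟩).1))
  · intro j hj
    rw [e2]
    exact ((hq' _).1 ⟨j, hj, rfl⟩).2
  · intro v hv hxv
    rw [e2] at hxv
    have := hlt v hxv
    rw [mem_leaves] at hv
    exact (hq' v).2 ⟨by omega, hxv⟩
  · rw [f6]
    exact I.cnt
  · intro c hc
    have := I.lt_fresh c hc
    omega
  · intro y
    rw [f7, e2, ← hx]
    exact I.low y
  · simp only [locateTime]
    gcongr
  rintro s₂ ⟨u, W⟩
  have g2 : s₂.arr 2 = s₁.arr 2 := W.frame.2 2 (by simp)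
  have g3 : s₂.arr 3 = s₁.arr 3 := W.frame.2 3 (by simp)
  have g4 : s₂.arr 4 = s₁.arr 4 := W.frame.2 4 (by simp)
  have g5 : s₂.arr 5 = s₁.arr 5 := W.frame.2 5 (by simp)
  have r2 : s₂.reg 2 = x := (W.frame.1 2 (by simp)).trans e2
  have r11 : s₂.reg 11 = s.reg 11 := (W.frame.1 11 (by simp)).trans e11
  have P : Placed G (n + 2) (3 * n + 4) N (leaves n x) L x u
      (fullKids G (n + 2) N (s₁.arr 2) L x u) s₂ := by
    refine ⟨?_, ?_, ?_, r2, hxN, W.reg_u, ?_, ?_, ?_, W.queue_mem, W.sum_lt, ?_, ?_,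
      (W.frame.1 12 (by simp)).trans e12, (W.frame.1 13 (by simp)).trans e13, hlr, by omega, ?_,
      by omega, by omega⟩
    · rwa [g2, g3]
    · rwa [g2, g4, g5]
    · have := W.place
      rw [e2] at this
      rwa [g2, g3]
    · rw [g2]
    · rw [← e2]
      exact W.reg_a
    · rw [← e2, g2]
      exact W.mem_fullKids
    · rw [← e2]
      exact W.sum_eq
    · rw [← e2]
      exact W.last
    · rw [r11]
      exact I.lt_fresh
  have hlen := W.len
  refine (P.runs_insertProg hB (m := d) (by omega) (by omega)).seq (T₂ := 4) ?_ (by omega)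
  rintro s₃ ⟨hF₃, N', hN', t1, t2, t3⟩
  have z2 : s₃.reg 2 = x := (hF₃.1 2 (by simp)).trans r2
  have hframe : Frame [3, 4, 5, 6, 7, 8, 9, 10, 11, 14, 15, 16, 17, 18] [2, 3, 4, 5, 6, 7, 8] s s₃ :=
    ((hF₁'.mono (by simp) (by simp)).trans (W.frame.mono (by simp) (by simp))).trans
      (hF₃.mono (by simp) (by simp))
  refine (Runs.of_wp ?_).mono (by simp [Prog.maxTime, Expr.time]) fun _ h => h
  simp only [Prog.wp, Expr.eval, z2]
  refine ⟨by omega, rfl, N', ?_⟩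
  refine ⟨?_, ?_, ?_, ?_, ?_, ?_, (hframe.1 0 (by simp)).trans I.reg_n,
    (hframe.1 1 (by simp)).trans I.reg_k, (hframe.1 12 (by simp)).trans I.reg_M,
    (hframe.1 13 (by simp)).trans I.reg_r, (hframe.2 0 (by simp)).trans I.off,
    (hframe.2 1 (by simp)).trans I.adj, ?_, ?_, (hframe.2 9 (by simp)).trans I.sz,
    (hframe.2 10 (by simp)).trans I.g⟩ <;>
  simp only [State.reg_setReg, State.arr_setReg, Nat.reduceEqDiff, if_false, if_true]
  · rw [leaves_succ]
    exact hN'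
  · omega
  · intro c hc
    rw [leaves_succ, Finset.mem_insert]
    rcases t3 c hc with h | h | h
    · rw [hlr c h]
      exact ⟨.inr, fun h' => h'.resolve_left (by rintro rfl; exact hxN h)⟩
    · exact ⟨fun _ => .inl h, fun _ => by omega⟩
    · rw [mem_leaves]
      omega
  · omega
  · intro c hc
    rcases t3 c hc with h | h | h
    · have := I.lt_fresh c h
      omega
    · omega
    · exact h.2
  · omega
  · intro y
    rw [hF₃.2 6 (by simp)]
    exact W.cnt y
  · intro y
    rw [hF₃.2 7 (by simp)]
    have := W.low y
    omega

end Algo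

/-! ### Construction of the whole cotree. -/

namespace Algo

open WordRAM Cotree

/-- The program that builds the cotree of the two dummies. -/
def initProg : Prog :=
  -- There are `n` vertices, two dummies, the root and at most two new inner nodes per vertex, so
  -- all names are below `3 * n + 3`. The modulus `3 * n + 4` distinguishes them.
  .seq (.assign 12 (.add (.add (.reg 0) (.reg 0)) (.add (.reg 0) (.const 4)))) <|
  .seq (.assign 13 (.add (.reg 0) (.const 2))) <|
  .seq (.assign 11 (.add (.reg 0) (.const 3))) <|
  .seq (.store 2 (.reg 0) (.reg 13)) <|
  .seq (.store 2 (.add (.reg 0) (.const 1)) (.reg 13)) <|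
  .seq (.store 2 (.reg 13) (.reg 13)) <|
  .seq (.store 4 (.reg 13) (.const 2)) <|
  .store 5 (.reg 13) (.add (.reg 0) (.add (.reg 0) (.const 1)))

/-- The cotree of the two dummies. -/
theorem isCotree_dummies {G : SimpleGraph ℕ} {n : ℕ} {par ser : ℕ → ℕ}
    (hG : ∀ y, ¬ G.Adj n y) (hpar : ∀ c ∈ ({n, n + 1, n + 2} : Finset ℕ), par c = n + 2)
    (hser : ser (n + 2) = 0) :
    IsCotree G (n + 2) {n, n + 1, n + 2} (leaves n 0) par ser
      (fun p => if p = n + 2 then {n, n + 1} else {p}) (n + 2) := by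
  have hV : ∀ c, c ∈ leaves n 0 ↔ c = n ∨ c = n + 1 := by simp [mem_leaves]
  have hk : ∀ p c, c ∈ kids (n + 2) {n, n + 1, n + 2} par p ↔ (c = n ∨ c = n + 1) ∧ p = n + 2 := by
    intro p c
    rw [mem_kids]
    have := hpar c
    simp only [Finset.mem_insert, Finset.mem_singleton] at *
    grind
  have hN : ∀ p ∈ ({n, n + 1, n + 2} : Finset ℕ), p ∉ leaves n 0 → p = n + 2 := by
    intro p hp hpV
    rw [hV] at hpV
    simp only [Finset.mem_insert, Finset.mem_singleton] at hp
    tauto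
  constructor
  · simp
  · simp [hV]
  · intro v hv
    rw [hV] at hv
    simp only [Finset.mem_insert, Finset.mem_singleton]
    tauto
  · exact hser
  · exact hpar _ (by simp)
  · intro p hp hpV
    rw [hN p hp hpV, hser]
    exact Nat.zero_le _
  · intro c hc
    simp [hpar c hc]
  · intro c hc
    simp [hpar c hc, hV]
  · intro p hp hpV
    rw [hN p hp hpV]
    have : kids (n + 2) {n, n + 1, n + 2} par (n + 2) = {n, n + 1} := by
      ext c
      simp [hk]
    rw [this, Finset.card_pair (by omega)]
  · intro v hv
    rw [hV] at hv
    rw [if_neg (by omega)]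
  · intro p hp hpV y
    have := hN p hp hpV
    subst this
    simp only [hk]
    constructor
    · intro hy
      rw [if_pos trivial, Finset.mem_insert, Finset.mem_singleton] at hy
      exact ⟨y, ⟨hy, trivial⟩, by rw [if_neg (by omega)]; simp⟩
    · rintro ⟨c, ⟨hc, -⟩, hy⟩
      rw [if_neg (by omega), Finset.mem_singleton] at hy
      simp [hy, hc]
  · intro p _
    split_ifs <;> simp
  · intro p _ c hc d hd hcd y hy
    rw [hk] at hc hd
    rw [if_neg (by omega), Finset.mem_singleton] at hy ⊢
    omega
  · intro p _ c hc d hd hcd y hy z hz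
    rw [hk] at hc hd
    rw [if_neg (by omega), Finset.mem_singleton] at hy hz
    rw [hc.2, hser]
    subst hy hz
    refine ⟨fun h => ?_, fun h => by omega⟩
    rcases hc.1 with rfl | rfl
    · exact (hG _ h).elim
    · rcases hd.1 with rfl | rfl
      · exact (hG _ h.symm).elim
      · exact (hcd rfl).elim
  · intro c hc hcV hcr
    exact (hcr (hN c hc hcV)).elim

theorem runs_initProg {B n k : ℕ} {G : SimpleGraph ℕ} {off adj : ℕ → ℕ}
    (hA : Lists G n off adj) (hB : 2 * (3 * n + 4) ≤ B) :
    Runs B initProg (inputState n k off adj) initProg.maxTime fun s =>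
      s.reg 2 = 0 ∧ ∃ N, Inserted G n k off adj N s := by
  refine Runs.of_wp ?_
  simp only [initProg, Prog.wp, Expr.eval, State.reg_setReg, State.arr_setReg,
    State.reg_setArr, State.arr_setArr, Nat.reduceEqDiff, if_true, if_false, inputState]
  refine ⟨by omega, by omega, by omega, by omega, by omega, by omega, by omega, by omega, trivial,
    {n, n + 1, n + 2}, ?_⟩
  have hr2 : ∀ c ∈ ({n, n + 1, n + 2} : Finset ℕ), Function.update (Function.update
      (Function.update (fun _ => 0) n (n + 2)) (n + 1) (n + 2)) (n + 2) (n + 2) c = n + 2 := by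
    intro c hc
    simp only [Finset.mem_insert, Finset.mem_singleton] at hc
    simp only [Function.update_apply]
    grind
  have hT := isCotree_dummies (G := G) (n := n) (ser := fun _ => 0)
    (fun y h => (hA.lt _ _ h).false) hr2 rfl
  have hkids : kids (n + 2) {n, n + 1, n + 2} (Function.update (Function.update
      (Function.update (fun _ => 0) n (n + 2)) (n + 1) (n + 2)) (n + 2) (n + 2)) (n + 2) =
      {n, n + 1} := by
    ext c
    rw [mem_kids]
    have := hr2 c
    simp only [Finset.mem_insert, Finset.mem_singleton] at *
    grind
  constructor <;> simp only [State.reg_setReg, State.arr_setReg,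
    State.reg_setArr, State.arr_setArr, Nat.reduceEqDiff, if_true, if_false,
    OfNat.ofNat_ne_zero, OfNat.ofNat_ne_one, OfNat.zero_ne_ofNat, OfNat.one_ne_ofNat, one_ne_zero]
  · refine ⟨⟨_, hT⟩, ?_⟩
    intro p hp hpV
    have : p = n + 2 := by
      simp only [Finset.mem_insert, Finset.mem_singleton] at hp
      simp only [mem_leaves] at hpV
      omega
    subst this
    simp only [State.reg_setReg, State.arr_setReg,
      State.reg_setArr, State.arr_setArr, Nat.reduceEqDiff, if_true, if_false]
    rw [hkids, Function.update_self, Function.update_self, Finset.card_pair (by omega),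
      Finset.sum_pair (by omega)]
    refine ⟨rfl, by omega, by push_cast; ring⟩
  · omega
  · intro c hc
    simp only [Finset.mem_insert, Finset.mem_singleton] at hc
    simp only [mem_leaves]
    omega
  · omega
  · intro c hc
    simp only [Finset.mem_insert, Finset.mem_singleton] at hc
    omega
  · omega
  · omega
  · simp
  · simp

/-- The program that inserts all vertices. -/
def buildProg : Prog := .seq initProg (.loop (.lt (.reg 2) (.reg 0)) vertexProg)

theorem Lists.off_mono {G : SimpleGraph ℕ} {n : ℕ} {off adj : ℕ → ℕ} (hA : Lists G n off adj)
    {v w : ℕ} (hvw : v ≤ w) (hw : w ≤ n) : off v ≤ off w := by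
  induction w, hvw using Nat.le_induction with
  | base => exact le_rfl
  | succ w _ ih => exact (ih (by omega)).trans (hA.off_le w (by omega))

theorem runs_buildProg {B n k : ℕ} {G : SimpleGraph ℕ} {off adj : ℕ → ℕ} (hG : PathFree G)
    (hA : Lists G n off adj) (hB : 2 * (3 * n + 4) ≤ B) (hoff : 2 * off n ≤ B) :
    Runs B buildProg (inputState n k off adj)
      (initProg.maxTime + ((vertexConst + 3) * (off n + n) + 3)) fun s =>
      s.reg 2 = n ∧ ∃ N, Inserted G n k off adj N s := by
  refine (runs_initProg hA hB).seq ?_ le_rfl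
  rintro s ⟨hs, N, I⟩
  have key := Runs.loop (B := B) (b := .lt (.reg 2) (.reg 0)) (p := vertexProg) (s := s)
    (fun s => ∃ N, Inserted G n k off adj N s)
    -- The potential counts the adjacency entries and the vertices that are still to come; the
    -- summand 3 pays for the test of the loop.
    (fun s => (vertexConst + 3) * (off n - off (s.reg 2) + (n - s.reg 2))) ?_ ⟨N, I⟩
  · refine key.mono ?_ ?_
    · rw [hs]
      simp only [Test.time, Expr.time]
      have : (vertexConst + 3) * (off n - off 0 + (n - 0)) ≤ (vertexConst + 3) * (off n + n) :=
        Nat.mul_le_mul_left _ (by omega)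
      omega
    · rintro s' ⟨⟨N', I'⟩, h⟩
      simp only [Test.holds, Expr.eval, I'.reg_n] at h
      have := I'.le
      exact ⟨by omega, N', I'⟩
  · rintro s ⟨N, I⟩ h
    simp only [Test.holds, Expr.eval, I.reg_n] at h
    refine ⟨_, (runs_vertexProg hG hA hB (fun v hv => ?_) I rfl h).mono le_rfl ?_⟩
    · have := hA.off_mono hv le_rfl
      omega
    · rintro s' ⟨h2, hI⟩
      refine ⟨hI, ?_⟩
      rw [h2]
      simp only [Test.time, Expr.time]
      have h1 := hA.off_mono (v := s.reg 2 + 1) h le_rfl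
      have h3 := hA.off_le _ h
      have : off n - off (s.reg 2) + (n - s.reg 2) = (off n - off (s.reg 2 + 1) +
        (n - (s.reg 2 + 1))) + (off (s.reg 2 + 1) - off (s.reg 2) + 1) := by omega
      rw [this]
      nlinarith

end Algo

/-! ### Rainbow numbers of induced subgraphs. -/

namespace RainbowDom

variable {k : ℕ}

open scoped Classical in
/-- The rainbow domination number of the subgraph that is induced by a finite set of vertices. -/
noncomputable def inducedNumber (G : SimpleGraph ℕ) (k : ℕ) (S : Finset ℕ) : ℕ :=
  rainbowNumber (G.induce (S : Set ℕ)) k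

theorem rainbowNumber_le_card {V : Type*} [Fintype V] (G : SimpleGraph V) (hk : 1 ≤ k) :
    rainbowNumber G k ≤ Fintype.card V := by
  have := rainbowNumber_eq_min G hk
  exact Nat.cast_le.1 (this.le.trans (min_le_left _ _))

theorem inducedNumber_le_card (G : SimpleGraph ℕ) (hk : 1 ≤ k) (S : Finset ℕ) :
    inducedNumber G k S ≤ S.card := by
  have := rainbowNumber_le_card (G.induce (S : Set ℕ)) hk
  simpa [inducedNumber] using this

theorem inducedNumber_empty (G : SimpleGraph ℕ) (hk : 1 ≤ k) : inducedNumber G k ∅ = 0 := by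
  have := inducedNumber_le_card G hk ∅
  simpa using this

theorem inducedNumber_singleton (G : SimpleGraph ℕ) (hk : 1 ≤ k) (v : ℕ) :
    inducedNumber G k {v} = 1 := by
  refine le_antisymm (by simpa using inducedNumber_le_card G hk {v}) ?_
  obtain ⟨f, hf, hc⟩ := exists_cost_eq_rainbowNumber (G.induce (({v} : Finset ℕ) : Set ℕ)) hk
  rw [inducedNumber, ← hc]
  let x : (({v} : Finset ℕ) : Set ℕ) := ⟨v, by simp⟩
  have hx : f x ≠ ∅ := by
    intro h
    obtain ⟨y, hy, -⟩ := isRainbow_iff.1 hf x h ⟨0, hk⟩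
    have : y = x := Subtype.ext (show y.1 = v by simpa using y.2)
    exact hy.ne this.symm
  rw [cost]
  exact (Nat.succ_le_of_lt (Finset.card_pos.2 (Finset.nonempty_iff_ne_empty.2 hx))).trans
    (Finset.single_le_sum (f := fun x => (f x).card) (fun _ _ => Nat.zero_le _) (Finset.mem_univ x))

/-- The map from the disjoint sum of two disjoint sets onto their union. -/
noncomputable def sumEquivUnion {S T : Finset ℕ} (h : Disjoint S T) :
    (S : Set ℕ) ⊕ (T : Set ℕ) ≃ ((S ∪ T : Finset ℕ) : Set ℕ) :=
  Equiv.ofBijective (Sum.elim (fun x => ⟨x, by simp [Finset.mem_coe.1 x.2]⟩)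
    fun x => ⟨x, by simp [Finset.mem_coe.1 x.2]⟩) <| by
    have hST := Finset.disjoint_left.1 h
    constructor
    · rintro (⟨x, hx⟩ | ⟨x, hx⟩) (⟨y, hy⟩ | ⟨y, hy⟩) h <;>
      simp only [Sum.elim_inl, Sum.elim_inr, Subtype.mk.injEq] at h <;> subst h
      · rfl
      · exact (hST hx hy).elim
      · exact (hST hy hx).elim
      · rfl
    · rintro ⟨x, hx⟩
      rcases Finset.mem_union.1 (Finset.mem_coe.1 hx) with h | h
      · exact ⟨.inl ⟨x, h⟩, rfl⟩
      · exact ⟨.inr ⟨x, h⟩, rfl⟩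

theorem inducedNumber_union {G : SimpleGraph ℕ} (hk : 1 ≤ k) {S T : Finset ℕ} (h : Disjoint S T)
    (hG : ∀ x ∈ S, ∀ y ∈ T, ¬ G.Adj x y) :
    inducedNumber G k (S ∪ T) = inducedNumber G k S + inducedNumber G k T := by
  rw [inducedNumber, inducedNumber, inducedNumber, ← rainbowNumber_sum _ _ hk]
  refine (rainbowNumber_congr ⟨sumEquivUnion h, ?_⟩ hk).symm
  rintro (⟨x, hx⟩ | ⟨x, hx⟩) (⟨y, hy⟩ | ⟨y, hy⟩) <;> simp [sumEquivUnion]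
  · exact hG x hx y hy
  · exact fun h => hG y hy x hx h.symm

theorem inducedNumber_union_of_adj {G : SimpleGraph ℕ} (hk : 1 ≤ k) {S T : Finset ℕ}
    (h : Disjoint S T) (hS : S.Nonempty) (hT : T.Nonempty) (hG : ∀ x ∈ S, ∀ y ∈ T, G.Adj x y) :
    inducedNumber G k (S ∪ T) = min (S.card + T.card)
      (min (2 * k) (max k (min (inducedNumber G k S) (inducedNumber G k T)))) := by
  have : Nonempty (S : Set ℕ) := hS.to_subtype
  have : Nonempty (T : Set ℕ) := hT.to_subtype
  have key := rainbowNumber_join (G.induce (S : Set ℕ)) (G.induce (T : Set ℕ)) hk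
  simp only [SetLike.coe_sort_coe, Fintype.card_coe] at key
  rw [inducedNumber, inducedNumber, inducedNumber]
  refine (rainbowNumber_congr ⟨sumEquivUnion h, ?_⟩ hk).symm.trans key
  rintro (⟨x, hx⟩ | ⟨x, hx⟩) (⟨y, hy⟩ | ⟨y, hy⟩) <;>
  simp [sumEquivUnion, join_adj_inl_inl, join_adj_inl_inr, join_adj_inr_inl, join_adj_inr_inr]
  · exact hG x hx y hy
  · exact (hG y hy x hx).symm

end RainbowDom

/-! ### The leaves accounted for during the evaluation. -/

namespace Cotree

variable {G : SimpleGraph ℕ} {r e : ℕ} {N V : Finset ℕ} {par ser nch : ℕ → ℕ}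
  {L : ℕ → Finset ℕ} {D : ℕ → Prop} {q cnt : ℕ → ℕ} {m i len p : ℕ}

/-- The leaves below those of the first `i` entries of the queue that are children of `p`. -/
def seen (par : ℕ → ℕ) (L : ℕ → Finset ℕ) (q : ℕ → ℕ) (i p : ℕ) : Finset ℕ :=
  ((Finset.range i).filter fun j => par (q j) = p).biUnion fun j => L (q j)

theorem mem_seen {y : ℕ} :
    y ∈ seen par L q i p ↔ ∃ j < i, par (q j) = p ∧ y ∈ L (q j) := by
  simp [seen, and_assoc]

theorem seen_succ : seen par L q (i + 1) p =
    if par (q i) = p then seen par L q i p ∪ L (q i) else seen par L q i p := by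
  ext y
  split_ifs with h <;>
  simp only [Finset.mem_union, mem_seen, Nat.lt_succ_iff_lt_or_eq, or_and_right, exists_or,
    exists_eq_left, h, true_and, false_and, or_false]

namespace Marked

variable (M : Marked N V par nch D L q cnt m len len) (T : IsCotree G r N V par ser L e)
  (hnch : ∀ p ∈ N, p ∉ V → nch p = (kids r N par p).card) (hr : ¬ ∀ y ∈ L r, D y)

include M T hnch hr in
-- All children of a full node are full, hence in the queue, and by `order` they precede it. So the
-- value of a node is complete when it is passed on to its parent.
theorem seen_self (hi : i < len) (hV : q i ∉ V) : seen par L q i (q i) = L (q i) := by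
  have hN := M.mem i hi
  ext y
  rw [mem_seen, T.mem_L _ hN hV]
  constructor
  · rintro ⟨j, hj, hp, hy⟩
    exact ⟨q j, hp ▸ M.mem_kids_of_lt hr (hj.trans hi), hy⟩
  · rintro ⟨c, hc, hy⟩
    obtain ⟨hcN, hcr, hcp⟩ := mem_kids.1 hc
    obtain ⟨j, hj, rfl⟩ := (M.full_iff_exists T hnch hcN).1 fun z hz =>
      M.full i hi z (T.subset_of_mem_kids hc hz)
    exact ⟨j, M.order j hj i hi hcp, hcp, hy⟩

include M hr in
theorem exists_kid_of_mem_seen (hi : i < len) {y : ℕ} (hy : y ∈ seen par L q i (par (q i))) :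
    ∃ c ∈ kids r N par (par (q i)), c ≠ q i ∧ y ∈ L c := by
  obtain ⟨j, hj, hp, hy⟩ := mem_seen.1 hy
  refine ⟨q j, hp ▸ M.mem_kids_of_lt hr (hj.trans hi), fun h => ?_, hy⟩
  exact hj.ne (M.inj j (hj.trans hi) i hi h)

include M T hr in
-- With `adj_seen`, this shows that processing an entry forms a disjoint union or a join with what
-- the parent has accumulated so far, according to the kind of the parent.
theorem disjoint_seen (hi : i < len) : Disjoint (seen par L q i (par (q i))) (L (q i)) := by
  refine Finset.disjoint_left.2 fun y hy hy' => ?_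
  obtain ⟨c, hc, hne, hy⟩ := M.exists_kid_of_mem_seen hr hi hy
  exact hne (T.mem_kids_unique hc (M.mem_kids_of_lt hr hi) hy hy')

include M T hr in
theorem adj_seen (hi : i < len) {y z : ℕ} (hy : y ∈ seen par L q i (par (q i))) (hz : z ∈ L (q i)) :
    G.Adj y z ↔ ser (par (q i)) = 1 := by
  obtain ⟨c, hc, hne, hy⟩ := M.exists_kid_of_mem_seen hr hi hy
  exact T.adj _ (T.par_mem _ (M.mem i hi)) c hc _ (M.mem_kids_of_lt hr hi) hne y hy z hz

include M T in
theorem seen_subset (hi : i ≤ len) : seen par L q i p ⊆ V := by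
  intro y hy
  obtain ⟨j, hj, -, hy⟩ := mem_seen.1 hy
  exact T.subset_leaves _ (M.mem j (hj.trans_le hi)) hy

end Marked

end Cotree

/-! ### Evaluation of the cotree. -/

namespace Algo

open WordRAM Cotree RainbowDom

/-- The body of the loop that initializes the queue and the values of the leaves. -/
def leafBody : Prog :=
  .seq (.store 8 (.reg 3) (.reg 3)) <| .seq (.store 9 (.reg 3) (.const 1)) <|
  .seq (.store 10 (.reg 3) (.const 1)) (.assign 3 (.add (.reg 3) (.const 1)))

def leafLoop : Prog := .loop (.lt (.reg 3) (.reg 0)) leafBody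

theorem runs_leafLoop {B : ℕ} {s : State} (h3 : s.reg 3 = 0) (hB : s.reg 0 + 1 ≤ B) :
    Runs B leafLoop s ((s.reg 0 + 1) * (leafBody.maxTime + 3)) fun s' =>
      Frame [3] [8, 9, 10] s s' ∧ (∀ v < s.reg 0, s'.arr 8 v = v) ∧
      (∀ v, s'.arr 9 v = if v < s.reg 0 then 1 else s.arr 9 v) ∧
      (∀ v, s'.arr 10 v = if v < s.reg 0 then 1 else s.arr 10 v) := by
  refine (Runs.loop_of_measure (K := leafBody.maxTime) (fun s' => Frame [3] [8, 9, 10] s s' ∧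
      s'.reg 3 ≤ s.reg 0 ∧ (∀ v < s'.reg 3, s'.arr 8 v = v) ∧
      (∀ v, s'.arr 9 v = if v < s'.reg 3 then 1 else s.arr 9 v) ∧
      (∀ v, s'.arr 10 v = if v < s'.reg 3 then 1 else s.arr 10 v))
      (fun s' => s.reg 0 - s'.reg 3) ?_ ⟨Frame.refl _ _ _, ?_, ?_, ?_, ?_⟩).mono ?_ ?_
  · rintro s' ⟨hF, hle, h8, h9, h10⟩ hlt
    have e0 : s'.reg 0 = s.reg 0 := hF.1 0 (by simp)
    simp only [Test.holds, Expr.eval, e0] at hlt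
    refine Runs.of_wp ?_
    simp only [leafBody, Prog.wp, Expr.eval, Test.holds, State.reg_setReg, State.arr_setReg,
      State.reg_setArr, State.arr_setArr]
    simp only [Nat.reduceEqDiff, if_true, if_false]
    refine ⟨by omega, by omega, by omega, by omega, ⟨by simp [frame_setReg, frame_setArr, hF],
      by omega, fun v hv => ?_, fun v => ?_, fun v => ?_⟩, by omega⟩
    · rw [Function.update_apply]
      split_ifs with h
      · exact h.symm
      · exact h8 v (by omega)
    · have := h9 v
      simp only [Function.update_apply]
      grind
    · have := h10 v
      simp only [Function.update_apply]
      grind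
  · omega
  · intro v hv
    omega
  · simp [h3]
  · simp [h3]
  · simp [h3, Test.time, Expr.time]
  · rintro s' ⟨⟨hF, hle, h⟩, hlt⟩
    have e0 : s'.reg 0 = s.reg 0 := hF.1 0 (by simp)
    simp only [Test.holds, Expr.eval, e0] at hlt
    rw [show s'.reg 3 = s.reg 0 by omega] at h
    exact ⟨hF, h⟩

/-- Replace register 15 by its minimum with the value of an expression. -/
def takeMin (e : Expr) : Prog := .ite (.lt (.reg 15) e) .skip (.assign 15 e)

/-- Replace register 15 by its maximum with the value of an expression. -/
def takeMax (e : Expr) : Prog := .ite (.lt (.reg 15) e) (.assign 15 e) .skip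

theorem State.setReg_setReg (s : State) (x v w : ℕ) : (s.setReg x v).setReg x w = s.setReg x w := by
  simp [State.setReg]

theorem wp_takeMin {B v : ℕ} {e : Expr} {s : State} {Q : State → Prop}
    (h : e.eval (s.setReg 15 v) ≤ B) (hQ : Q (s.setReg 15 (min v (e.eval (s.setReg 15 v))))) :
    (takeMin e).wp B Q (s.setReg 15 v) := by
  simp only [takeMin, Prog.wp, Test.holds, Expr.eval, State.setReg_setReg]
  have : (s.setReg 15 v).reg 15 = v := by simp [State.reg_setReg]
  rw [this]
  refine ⟨fun h' => ?_, fun h' => ⟨h, ?_⟩⟩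
  · rwa [min_eq_left h'.le] at hQ
  · rwa [min_eq_right (not_lt.1 h')] at hQ

theorem wp_takeMax {B v : ℕ} {e : Expr} {s : State} {Q : State → Prop}
    (h : e.eval (s.setReg 15 v) ≤ B) (hQ : Q (s.setReg 15 (max (e.eval (s.setReg 15 v)) v))) :
    (takeMax e).wp B Q (s.setReg 15 v) := by
  simp only [takeMax, Prog.wp, Test.holds, Expr.eval, State.setReg_setReg]
  have : (s.setReg 15 v).reg 15 = v := by simp [State.reg_setReg]
  rw [this]
  refine ⟨fun h' => ⟨h, ?_⟩, fun h' => ?_⟩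
  · rwa [max_eq_left h'.le] at hQ
  · rwa [max_eq_right (not_lt.1 h')] at hQ

/-- The body of the loop that computes the values of the nodes from those of their children. -/
def valueBody : Prog :=
  .seq (.assign 5 (.read 8 (.reg 3))) <|
  .seq (.assign 6 (.read 2 (.reg 5))) <|
  .seq (.assign 3 (.add (.reg 3) (.const 1))) <|
  -- Order zero means that no child has been processed yet. The value of the first child is copied,
  -- since the formula for joins needs two nonempty sides.
  .ite (.eq (.read 9 (.reg 6)) (.const 0))
    (.seq (.store 9 (.reg 6) (.read 9 (.reg 5))) (.store 10 (.reg 6) (.read 10 (.reg 5)))) <|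
  .seq (.store 9 (.reg 6) (.add (.read 9 (.reg 6)) (.read 9 (.reg 5)))) <|
  .ite (.eq (.read 3 (.reg 6)) (.const 0))
    (.store 10 (.reg 6) (.add (.read 10 (.reg 6)) (.read 10 (.reg 5)))) <|
  .seq (.assign 15 (.read 10 (.reg 6))) <|
  .seq (takeMin (.read 10 (.reg 5))) <|
  .seq (takeMax (.reg 1)) <|
  .seq (takeMin (.add (.reg 1) (.reg 1))) <|
  .seq (takeMin (.read 9 (.reg 6))) <|
  .store 10 (.reg 6) (.reg 15)

/-- The step of the dynamic program. -/
theorem wp_valueBody {B : ℕ} {s : State} {Q : State → Prop} {c p i k : ℕ} (hi : s.reg 3 = i)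
    (hc : s.arr 8 i = c) (hp : s.arr 2 c = p) (hk : s.reg 1 = k)
    (hcB : c ≤ B) (hpB : p ≤ B) (hiB : i + 1 ≤ B) (hkB : 2 * k ≤ B)
    (h9 : s.arr 9 p + s.arr 9 c ≤ B) (h10 : s.arr 10 p + s.arr 10 c ≤ B)
    (hQ : ∀ s', Frame [3, 5, 6, 15] [9, 10] s s' → s'.reg 3 = i + 1 →
      s'.arr 9 = Function.update (s.arr 9) p (s.arr 9 p + s.arr 9 c) →
      s'.arr 10 = Function.update (s.arr 10) p (if s.arr 9 p = 0 then s.arr 10 c else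
        if s.arr 3 p = 0 then s.arr 10 p + s.arr 10 c else
        min (s.arr 9 p + s.arr 9 c) (min (2 * k) (max k (min (s.arr 10 p) (s.arr 10 c))))) → Q s') :
    valueBody.wp B Q s := by
  simp only [valueBody, Prog.wp, Expr.eval, Test.holds, State.reg_setReg, State.arr_setReg,
    State.reg_setArr, State.arr_setArr]
  simp only [Nat.reduceEqDiff, if_true, if_false, hi, hc, hp]
  refine ⟨hcB, hpB, hiB, fun h => ⟨by omega, by omega, hQ _ (by simp [frame_setReg, frame_setArr,
    Frame.refl]) rfl ?_ ?_⟩, fun h => ⟨h9, fun h' => ⟨by omega, hQ _ (by simp [frame_setReg,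
    frame_setArr, Frame.refl]) rfl rfl ?_⟩, fun h' => ⟨by omega, ?_⟩⟩⟩
  · rw [h, zero_add]
    rfl
  · rw [if_pos h]
    rfl
  · rw [if_neg h, if_pos h']
    rfl
  refine wp_takeMin ?_ (wp_takeMax ?_ (wp_takeMin ?_ (wp_takeMin ?_ ⟨?_, hQ _ (by simp [frame_setReg,
    frame_setArr, Frame.refl]) rfl rfl ?_⟩))) <;>
  simp only [Expr.eval, State.reg_setReg, State.arr_setReg, State.reg_setArr, State.arr_setArr] <;>
  simp only [Nat.reduceEqDiff, if_true, if_false, hk, OfNat.one_ne_ofNat, Function.update_self]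
  · omega
  · omega
  · omega
  · omega
  · omega
  · rw [if_neg h, if_neg h']
    congr 1
    rw [min_comm, ← two_mul, min_comm (max _ _)]

end Algo

namespace Algo

open WordRAM Cotree RainbowDom

def valueLoop : Prog := .loop (.lt (.reg 3) (.reg 4)) valueBody

/-- The invariant concerns the partial leaf sets `seen`, so that children are merged two operands at
a time and the formulas for two graphs suffice for any number of children. -/
theorem runs_valueLoop {B k m len : ℕ} {G : SimpleGraph ℕ} {r e : ℕ} {N V : Finset ℕ}
    {nch cnt : ℕ → ℕ} {L : ℕ → Finset ℕ} {D : ℕ → Prop} {s : State}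
    (T : IsCotree G r N V (s.arr 2) (s.arr 3) L e)
    (hnch : ∀ p ∈ N, p ∉ V → nch p = (kids r N (s.arr 2) p).card) (hr : ¬ ∀ y ∈ L r, D y)
    (M : Marked N V (s.arr 2) nch D L (s.arr 8) cnt m len len)
    (h3 : s.reg 3 = 0) (h4 : s.reg 4 = len) (h1 : s.reg 1 = k) (hk : 1 ≤ k)
    (hN : ∀ c ∈ N, c ≤ B) (hV : V.card ≤ B) (hkB : 2 * k ≤ B) (hlen : len ≤ B)
    (hleaf : ∀ v ∈ V, D v → s.arr 9 v = 1 ∧ s.arr 10 v = 1)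
    (hinner : ∀ p ∈ N, p ∉ V → s.arr 9 p = 0 ∧ s.arr 10 p = 0) :
    Runs B valueLoop s ((len + 1) * (valueBody.maxTime + 3)) fun s' =>
      Frame [3, 5, 6, 15] [9, 10] s s' ∧
      ∀ p ∈ N, p ∉ V → s'.arr 10 p = inducedNumber G k (seen (s.arr 2) L (s.arr 8) len p) := by
  refine (Runs.loop_of_measure (K := valueBody.maxTime) (fun s' =>
      Frame [3, 5, 6, 15] [9, 10] s s' ∧ s'.reg 3 ≤ len ∧
      (∀ v ∈ V, D v → s'.arr 9 v = 1 ∧ s'.arr 10 v = 1) ∧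
      ∀ p ∈ N, p ∉ V → s'.arr 9 p = (seen (s.arr 2) L (s.arr 8) (s'.reg 3) p).card ∧
        s'.arr 10 p = inducedNumber G k (seen (s.arr 2) L (s.arr 8) (s'.reg 3) p))
      (fun s' => len - s'.reg 3) ?_ ⟨Frame.refl _ _ _, ?_, ?_, ?_⟩).mono ?_ ?_
  · rintro s' ⟨hF, hle, hl, hin⟩ hlt
    have e1 : s'.reg 1 = k := (hF.1 1 (by simp)).trans h1
    have e4 : s'.reg 4 = len := (hF.1 4 (by simp)).trans h4
    have f2 : s'.arr 2 = s.arr 2 := hF.2 2 (by simp)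
    have f3 : s'.arr 3 = s.arr 3 := hF.2 3 (by simp)
    have f8 : s'.arr 8 = s.arr 8 := hF.2 8 (by simp)
    simp only [Test.holds, Expr.eval, e4] at hlt
    set i := s'.reg 3 with hi
    set c := s.arr 8 i with hc
    have hcN : c ∈ N := M.mem i hlt
    have hpN := T.par_mem c hcN
    have hpV := T.par_notMem c hcN
    have hval : s'.arr 9 c = (L c).card ∧ s'.arr 10 c = inducedNumber G k (L c) := by
      by_cases hcV : c ∈ V
      · have hL := T.L_leaf c hcV
        have := hl c hcV (M.full i hlt c (by simp [← hc, hL]))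
        rw [hL, inducedNumber_singleton G hk, Finset.card_singleton]
        exact this
      · have := hin c hcN hcV
        rwa [M.seen_self T hnch hr hlt hcV] at this
    obtain ⟨p9, p10⟩ := hin _ hpN hpV
    set S := seen (s.arr 2) L (s.arr 8) i (s.arr 2 c) with hS
    have hdisj : Disjoint S (L c) := M.disjoint_seen T hr hlt
    have hadj : ∀ y ∈ S, ∀ z ∈ L c, (G.Adj y z ↔ s.arr 3 (s.arr 2 c) = 1) := fun y hy z hz =>
      M.adj_seen T hr hlt hy hz
    have hsucc : seen (s.arr 2) L (s.arr 8) (i + 1) (s.arr 2 c) = S ∪ L c := by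
      rw [seen_succ, if_pos rfl]
    have hcard := Finset.card_union_of_disjoint hdisj
    have hcB : (S ∪ L c).card ≤ V.card := by
      rw [← hsucc]
      exact Finset.card_le_card (M.seen_subset T hlt)
    have hnS := inducedNumber_le_card G hk S
    have hnL := inducedNumber_le_card G hk (L c)
    have hnum : inducedNumber G k (S ∪ L c) = if S.card = 0 then inducedNumber G k (L c) else
        if s.arr 3 (s.arr 2 c) = 0 then inducedNumber G k S + inducedNumber G k (L c) else
        min (S.card + (L c).card)
          (min (2 * k) (max k (min (inducedNumber G k S) (inducedNumber G k (L c))))) := by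
      split_ifs with h h'
      · rw [Finset.card_eq_zero.1 h, Finset.empty_union]
      · refine inducedNumber_union hk hdisj fun y hy z hz hyz => ?_
        have := (hadj y hy z hz).1 hyz
        omega
      · refine inducedNumber_union_of_adj hk hdisj ?_ (T.nonempty c hcN) fun y hy z hz => ?_
        · exact Finset.card_pos.1 (Nat.pos_of_ne_zero h)
        · have := T.ser_le _ hpN hpV
          exact (hadj y hy z hz).2 (by omega)
    refine Runs.of_wp (wp_valueBody (i := i) (c := c) (p := s.arr 2 c) (k := k) rfl
      (by rw [f8]) (by rw [f2]) e1 (hN c hcN) (hN _ hpN) (by omega) hkB (by omega) (by omega)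
      fun s'' hF' t3 t9 t10 => ?_)
    rw [p9, p10, hval.1, hval.2, f3, ← hnum] at t10
    rw [p9, hval.1, ← hcard] at t9
    rw [t3]
    refine ⟨⟨hF.trans hF', hlt, fun v hv hD => ?_, fun p hp hp' => ?_⟩, by omega⟩
    · have hne : v ≠ s.arr 2 c := by
        rintro rfl
        exact hpV hv
      rw [t9, t10, Function.update_of_ne hne, Function.update_of_ne hne]
      exact hl v hv hD
    · rw [t9, t10, Function.update_apply, Function.update_apply, seen_succ]
      by_cases h : p = s.arr 2 c
      · subst h
        rw [if_pos rfl, if_pos rfl, if_pos rfl]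
        exact ⟨rfl, rfl⟩
      · rw [if_neg h, if_neg h, if_neg (fun h' => h h'.symm)]
        exact hin p hp hp'
  · omega
  · exact hleaf
  · intro p hp hpV
    have : seen (s.arr 2) L (s.arr 8) (s.reg 3) p = ∅ := by simp [seen, h3]
    rw [this, inducedNumber_empty G hk]
    exact hinner p hp hpV
  · rw [h3]
    simp [Test.time, Expr.time]
  · rintro s' ⟨⟨hF, hle, hl, hin⟩, hlt⟩
    have e4 : s'.reg 4 = len := (hF.1 4 (by simp)).trans h4
    simp only [Test.holds, Expr.eval, e4] at hlt
    rw [show s'.reg 3 = len by omega] at hin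
    exact ⟨hF, fun p hp hpV => (hin p hp hpV).2⟩

/-- The program that computes the rainbow domination number from the cotree. -/
def evalProg : Prog :=
  .seq (.assign 3 (.const 0)) <| .seq leafLoop <|
  .seq (.assign 4 (.reg 0)) <| .seq (.assign 3 (.const 0)) <| .seq markLoop <|
  .seq (.assign 3 (.const 0)) <| .seq valueLoop <| .assign 0 (.read 10 (.reg 13))

def evalConst : ℕ :=
  (leafBody.maxTime + 3) + 2 * (markBody.maxTime + 3) + 2 * (valueBody.maxTime + 3) + 20

/-- The children of the root without dummies contain all vertices. -/
theorem seen_root {G : SimpleGraph ℕ} {n len m : ℕ} {N : Finset ℕ} {par ser nch cnt q : ℕ → ℕ}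
    {L : ℕ → Finset ℕ} (hG : ∀ v w, G.Adj v w → v < n)
    (T : IsCotree G (n + 2) N (leaves n n) par ser L (n + 2))
    (hnch : ∀ p ∈ N, p ∉ leaves n n → nch p = (kids (n + 2) N par p).card)
    (M : Marked N (leaves n n) par nch (· < n) L q cnt m len len) :
    seen par L q len (n + 2) = Finset.range n := by
  ext y
  rw [mem_seen, Finset.mem_range]
  constructor
  · rintro ⟨j, hj, -, hy⟩
    exact M.full j hj y hy
  · intro hy
    have hyr : y ∈ L (n + 2) := by
      rw [T.L_root, mem_leaves]
      omega
    obtain ⟨c, hc, hyc⟩ := (T.mem_L _ T.root_mem T.root_notMem y).1 hyr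
    obtain ⟨hcN, hcr, hcp⟩ := mem_kids.1 hc
    -- A child of the parallel root is a leaf or series. Below a series node every leaf has a
    -- neighbor, so no dummy lies there.
    have hfull : ∀ z ∈ L c, z < n := by
      intro z hz
      by_contra hzn
      have hcV : c ∉ leaves n n := by
        intro h
        rw [T.L_leaf c h, Finset.mem_singleton] at hz hyc
        omega
      have halt := T.alt c hcN hcV hcr hcr
      rw [hcp, T.ser_root, zero_add] at halt
      obtain ⟨d, hd, hzd⟩ := (T.mem_L c hcN hcV z).1 hz
      obtain ⟨d', hd', hne⟩ := T.exists_other_kid hcN hcV d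
      obtain ⟨w, hw⟩ := T.nonempty d' (mem_kids.1 hd').1
      exact hzn (hG z w ((T.adj c hcN d hd d' hd' hne.symm z hzd w hw).2 halt))
    obtain ⟨j, hj, rfl⟩ := (M.full_iff_exists T hnch hcN).1 hfull
    exact ⟨j, hj, hcp, hyc⟩

/-- Marking with the property `· < n` finds all nodes without dummies below them, children before
parents. The root is not among them, but its accumulated value is the rainbow number of the graph
without the dummies. -/
theorem runs_evalProg {B n k : ℕ} {G : SimpleGraph ℕ} {off adj : ℕ → ℕ} {N : Finset ℕ} {s : State}
    (hG : ∀ v w, G.Adj v w → v < n) (hB : 2 * (3 * n + 4) ≤ B) (hk : 1 ≤ k) (hkB : 2 * k ≤ B)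
    (I : Inserted G n k off adj N s) (hx : s.reg 2 = n) :
    Runs B evalProg s (evalConst * (n + 1)) fun s' =>
      s'.reg 0 = inducedNumber G k (Finset.range n) := by
  obtain ⟨⟨L, T⟩, C⟩ := I.holds
  have hlr := I.lt_root
  have hfresh := I.fresh_le
  rw [hx] at T C hlr hfresh
  have hnch : ∀ p ∈ N, p ∉ leaves n n → s.arr 4 p = (kids (n + 2) N (s.arr 2) p).card :=
    fun p hp hV => (C p hp hV).1
  have hr : ¬ ∀ y ∈ L (n + 2), y < n := by
    rw [T.L_root]
    exact fun h => (h n (mem_leaves.2 (.inl rfl))).false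
  have hNB : ∀ c ∈ N, c ≤ B := by
    intro c hc
    have := I.lt_fresh c hc
    omega
  have hT : (n + 1) * (leafBody.maxTime + 3) + ((2 * n + 1) * (markBody.maxTime + 3) +
      ((2 * n + 1) * (valueBody.maxTime + 3) + 15)) ≤ evalConst * (n + 1) := by
    simp only [evalConst]
    nlinarith
  refine Runs.assign_seq (Nat.zero_le _) (T' := evalConst * (n + 1) - 2) ?_
    (by simp only [Expr.time]; omega)
  simp only [Expr.eval]
  have e0 : (s.setReg 3 0).reg 0 = n := I.reg_n
  refine (runs_leafLoop (B := B) (s := s.setReg 3 0) rfl (by rw [e0]; omega)).seq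
    (T₂ := (2 * n + 1) * (markBody.maxTime + 3) + ((2 * n + 1) * (valueBody.maxTime + 3) + 13)) ?_
    (by rw [e0]; omega)
  rw [e0]
  rintro s₁ ⟨hF₁, h8, h9, h10⟩
  replace hF₁ : Frame [3] [8, 9, 10] s s₁ := Frame.trans (by simp [frame_setReg, Frame.refl]) hF₁
  simp only [State.arr_setReg, I.sz, I.g] at h9 h10
  have r0 : s₁.reg 0 = n := (hF₁.1 0 (by simp)).trans I.reg_n
  refine Runs.assign_seq (T' := (2 * n + 1) * (markBody.maxTime + 3) +
    ((2 * n + 1) * (valueBody.maxTime + 3) + 11)) ?_ ?_ (by simp only [Expr.time]; omega)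
  · simp only [Expr.eval, r0]
    omega
  refine Runs.assign_seq (T' := (2 * n + 1) * (markBody.maxTime + 3) +
    ((2 * n + 1) * (valueBody.maxTime + 3) + 9)) (Nat.zero_le _) ?_ (by simp only [Expr.time]; omega)
  simp only [Expr.eval, r0]
  set s₂ := (s₁.setReg 4 n).setReg 3 0 with hs₂
  have hF₂ : Frame [3, 4] [8, 9, 10] s s₂ := by
    simpa [hs₂, frame_setReg] using hF₁.mono (by simp) (by simp)
  have f2 : s₂.arr 2 = s.arr 2 := hF₂.2 2 (by simp)
  have f3 : s₂.arr 3 = s.arr 3 := hF₂.2 3 (by simp)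
  have f4 : s₂.arr 4 = s.arr 4 := hF₂.2 4 (by simp)
  have f6 : s₂.arr 6 = s.arr 6 := hF₂.2 6 (by simp)
  replace h8 : ∀ v < n, s₂.arr 8 v = v := h8
  replace h9 : ∀ v, s₂.arr 9 v = if v < n then 1 else 0 := h9
  replace h10 : ∀ v, s₂.arr 10 v = if v < n then 1 else 0 := h10
  rw [← f2, ← f3] at T
  rw [← f2, ← f4] at hnch
  refine Runs.seq (runs_markLoop (B := B) (m := n) (D := (· < n)) (s := s₂) T hnch hr
    (.of_leaves T hnch ?_ ?_ ?_ ?_ ?_) rfl rfl hNB (by omega))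
    (T₂ := (2 * n + 1) * (valueBody.maxTime + 3) + 9) ?_ le_rfl
  · intro j hj j' hj'
    rw [h8 j hj, h8 j' hj']
    exact id
  · intro j hj
    rw [h8 j hj, mem_leaves]
    exact .inr (.inr hj)
  · intro j hj
    rwa [h8 j hj]
  · exact fun v _ hv => ⟨v, hv, h8 v hv⟩
  · rw [f6]
    exact I.cnt
  rintro s₃ ⟨hF₃, M⟩
  have hlen := M.len_le T hnch
  have g2 : s₃.arr 2 = s₂.arr 2 := hF₃.2 2 (by simp)
  have g3 : s₃.arr 3 = s₂.arr 3 := hF₃.2 3 (by simp)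
  have g9 : s₃.arr 9 = s₂.arr 9 := hF₃.2 9 (by simp)
  have g10 : s₃.arr 10 = s₂.arr 10 := hF₃.2 10 (by simp)
  have r1 : s₃.reg 1 = k := ((hF₃.1 1 (by simp)).trans (hF₂.1 1 (by simp))).trans I.reg_k
  have r13 : s₃.reg 13 = n + 2 := ((hF₃.1 13 (by simp)).trans (hF₂.1 13 (by simp))).trans I.reg_r
  rw [← g2] at hnch M
  rw [← g2, ← g3] at T
  refine Runs.assign_seq (T' := (2 * n + 1) * (valueBody.maxTime + 3) + 6) (Nat.zero_le _) ?_
    (by simp only [Expr.time]; omega)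
  simp only [Expr.eval]
  have hroot := seen_root hG T hnch M
  refine ((runs_valueLoop (B := B) (s := s₃.setReg 3 0) (len := s₃.reg 4) T hnch hr M rfl rfl r1 hk
    hNB ?_ hkB (by omega) ?_ ?_).mono (T' := (2 * n + 1) * (valueBody.maxTime + 3)) ?_
    fun _ h => h).seq (T₂ := 4) ?_ (by omega)
  · refine (Finset.card_le_card (t := Finset.range (n + 2)) fun y hy => ?_).trans
      (by rw [Finset.card_range]; omega)
    rw [mem_leaves] at hy
    rw [Finset.mem_range]
    omega
  · intro v hv hvn
    simp only [State.arr_setReg, g9, g10, h9, h10, if_pos hvn, and_self]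
  · intro p hp hpV
    have : ¬ p < n := fun h => hpV (mem_leaves.2 (.inr (.inr h)))
    simp only [State.arr_setReg, g9, g10, h9, h10, if_neg this, and_self]
  · exact Nat.mul_le_mul_right _ (by omega)
  rintro s₄ ⟨hF₄, hval⟩
  have hv : s₄.arr 10 (s₄.reg 13) = inducedNumber G k (Finset.range n) := by
    have : s₄.reg 13 = n + 2 := (hF₄.1 13 (by simp)).trans r13
    rw [this, hval _ T.root_mem T.root_notMem, ← hroot]
    rfl
  refine (Runs.of_wp ?_).mono (by simp [Prog.maxTime, Expr.time]) fun _ h => h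
  simp only [Prog.wp, Expr.eval, hv, State.reg_setReg, if_true, and_true]
  have := inducedNumber_le_card G hk (Finset.range n)
  rw [Finset.card_range] at this
  omega

end Algo

/-! ### From graphs on `Fin n` to graphs on `ℕ`. -/

namespace Algo

open RainbowDom WordRAM Cotree

/-- A graph on `0, …, n - 1` as a graph on the natural numbers. -/
def natGraph {n : ℕ} (G : SimpleGraph (Fin n)) : SimpleGraph ℕ := G.map Fin.valEmbedding

section NatGraph

variable {n : ℕ} {G : SimpleGraph (Fin n)}

theorem natGraph_adj {v w : ℕ} : (natGraph G).Adj v w ↔ ∃ a b : Fin n, G.Adj a b ∧ a = v ∧ b = w :=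
  SimpleGraph.map_adj Fin.valEmbedding G v w

theorem natGraph_adj_val {a b : Fin n} : (natGraph G).Adj a b ↔ G.Adj a b :=
  SimpleGraph.map_adj_apply (f := Fin.valEmbedding)

theorem pathFree_natGraph (hG : IsCograph G) : PathFree (natGraph G) := by
  intro a' b' c' d' hab hbc hcd hac had
  obtain ⟨a, b, hab, rfl, rfl⟩ := natGraph_adj.1 hab
  obtain ⟨b₁, c, hbc, h, rfl⟩ := natGraph_adj.1 hbc
  obtain rfl := Fin.ext h
  obtain ⟨c₁, d, hcd, h, rfl⟩ := natGraph_adj.1 hcd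
  obtain rfl := Fin.ext h
  rw [natGraph_adj_val] at *
  by_contra hbd
  refine hG ⟨⟨⟨![a, b₁, c₁, d], ?_⟩, ?_⟩⟩
  · have h1 := hab.ne
    have h2 := hbc.ne
    have h3 := hcd.ne
    -- Distinctness of the vertices at distance two or three follows from the prescribed adjacencies
    -- and non-adjacencies.
    have h4 : a ≠ c₁ := by rintro rfl; exact had hcd
    have h5 : a ≠ d := by rintro rfl; exact hac hcd.symm
    have h6 : b₁ ≠ d := by rintro rfl; exact had hab
    intro i j hij
    fin_cases i <;> fin_cases j <;> simp_all [eq_comm]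
  · intro i j
    change G.Adj (![a, b₁, c₁, d] i) (![a, b₁, c₁, d] j) ↔ _
    have h1 := hab.symm
    have h2 := hbc.symm
    have h3 := hcd.symm
    have h4 : ¬ G.Adj c₁ a := fun h => hac h.symm
    have h5 : ¬ G.Adj d a := fun h => had h.symm
    have h6 : ¬ G.Adj d b₁ := fun h => hbd h.symm
    fin_cases i <;> fin_cases j <;>
      simp [SimpleGraph.pathGraph_adj, hab, hbc, hcd, hac, had, hbd, h1, h2, h3, h4, h5, h6]

theorem lists_natGraph {off adj : ℕ → ℕ} (h : IsAdjacencyLists G off adj) :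
    Lists (natGraph G) n off adj where
  off_le := h.off_le
  bijOn v hv := by
    have := h.bijOn ⟨v, hv⟩
    convert this using 1
    ext w
    simp only [SimpleGraph.mem_neighborSet, Set.mem_image, natGraph_adj]
    constructor
    · rintro ⟨a, b, hab, rfl, rfl⟩
      exact ⟨b, hab, rfl⟩
    · rintro ⟨b, hb, rfl⟩
      exact ⟨_, b, hb, rfl, rfl⟩
  lt v w hvw := by
    obtain ⟨a, b, -, rfl, rfl⟩ := natGraph_adj.1 hvw
    exact a.2

/-- The total length of the lists is the sum of the degrees; this converts time in terms of
adjacency entries into time in terms of edges. -/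
theorem off_eq_two_mul_ncard {off adj : ℕ → ℕ} (h : IsAdjacencyLists G off adj) :
    off n = 2 * G.edgeSet.ncard := by
  classical
  have hdeg : ∀ v : Fin n, off (v + 1) = off v + G.degree v := by
    intro v
    have h1 := (h.bijOn v).injOn.ncard_image
    rw [(h.bijOn v).image_eq, Set.ncard_image_of_injective _ Fin.val_injective,
      Set.ncard_eq_toFinset_card', Set.ncard_eq_toFinset_card', Set.toFinset_Ico, Nat.card_Ico] at h1
    have h2 := h.off_le v v.2
    have h3 : G.degree v = (G.neighborSet v).toFinset.card := rfl
    omega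
  have hsum : ∀ m (hm : m ≤ n), off m = ∑ v : Fin m, G.degree (Fin.castLE hm v) := by
    intro m
    induction m with
    | zero => exact fun _ => by simp [h.off_zero]
    | succ m ih =>
      intro hm
      rw [Fin.sum_univ_castSucc]
      have := hdeg ⟨m, hm⟩
      rw [ih (by omega)] at this
      exact this
  have := hsum n le_rfl
  rw [this, Set.ncard_eq_toFinset_card']
  exact G.sum_degrees_eq_twice_card_edges

theorem inducedNumber_natGraph {k : ℕ} (hk : 1 ≤ k) :
    inducedNumber (natGraph G) k (Finset.range n) = rainbowNumber G k := by
  let e : ((Finset.range n : Finset ℕ) : Set ℕ) ≃ Fin n :=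
    ⟨fun x => ⟨x, by simpa using x.2⟩, fun x => ⟨x, by simp⟩, fun _ => rfl, fun _ => rfl⟩
  refine rainbowNumber_congr ⟨e, ?_⟩ hk
  intro x y
  exact (natGraph_adj_val (a := e x) (b := e y)).symm

end NatGraph

/-- The algorithm that computes the rainbow domination number of a cograph. -/
def rainbowProg : Prog := .seq buildProg evalProg

theorem runs_rainbowProg {B n k : ℕ} {G : SimpleGraph (Fin n)} {off adj : ℕ → ℕ} (hk : 1 ≤ k)
    (hG : IsCograph G) (hA : IsAdjacencyLists G off adj) (hB : 2 * (3 * n + 4) ≤ B)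
    (hm : 4 * G.edgeSet.ncard ≤ B) (hkB : 2 * k ≤ B) :
    Runs B rainbowProg (inputState n k off adj)
      (initProg.maxTime + ((vertexConst + 3) * (2 * G.edgeSet.ncard + n) + 3) + evalConst * (n + 1))
      fun s => s.reg 0 = rainbowNumber G k := by
  have hoff := off_eq_two_mul_ncard hA
  rw [← hoff]
  refine (runs_buildProg (pathFree_natGraph hG) (lists_natGraph hA) hB (by omega)).seq ?_ le_rfl
  rintro s ⟨hs, N, I⟩
  rw [← inducedNumber_natGraph hk]
  exact runs_evalProg (lists_natGraph hA).lt hB hk hkB I hs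

end Algo

/-! ### The main theorem. -/

theorem mainTheorem2 :
    (∃ (P : WordRAM.Prog) (C : ℕ), ∀ (n k : ℕ) (G : SimpleGraph (Fin n)) (off adj : ℕ → ℕ),
      1 ≤ k → RainbowDom.IsCograph G → WordRAM.IsAdjacencyLists G off adj →
      ∃ (s : WordRAM.State) (t : ℕ),
        WordRAM.Exec (C * (n + G.edgeSet.ncard + k + 1)) P (WordRAM.inputState n k off adj) s t ∧
        s.reg 0 = RainbowDom.rainbowNumber G k ∧
        t ≤ C * (n + G.edgeSet.ncard + 1)) ∧
    (∀ k : ℕ, 1 ≤ k →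
      (∀ (V : Type*) [Fintype V] [Nonempty V] (H : SimpleGraph V), RainbowDom.IsCograph H →
        RainbowDom.RPlus H k = max (Fintype.card V : ℕ∞) (k : ℕ∞) ∧
        (RainbowDom.rainbowNumber H k : ℕ∞) =
          min (Fintype.card V : ℕ∞) (RainbowDom.RMinus H k)) ∧
      (∀ (V W : Type*) [Fintype V] [Nonempty V] [Fintype W] [Nonempty W]
        (H₁ : SimpleGraph V) (H₂ : SimpleGraph W),
        RainbowDom.IsCograph H₁ → RainbowDom.IsCograph H₂ →
        RainbowDom.RMinus (H₁.sum H₂) k =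
          min (RainbowDom.RMinus H₁ k + (Fintype.card W : ℕ∞))
            (min (RainbowDom.RMinus H₂ k + (Fintype.card V : ℕ∞))
              (RainbowDom.RMinus H₁ k + RainbowDom.RMinus H₂ k)) ∧
        RainbowDom.RMinus (RainbowDom.join H₁ H₂) k =
          min (RainbowDom.RPlus H₁ k)
            (min (RainbowDom.RPlus H₂ k)
              (min (RainbowDom.RMinus H₁ k)
                (min (RainbowDom.RMinus H₂ k) (2 * k : ℕ∞)))))) := by
  refine ⟨⟨Algo.rainbowProg, Algo.initProg.maxTime + 2 * (Algo.vertexConst + 3) + Algo.evalConst + 11,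
    fun n k G off adj hk hG hA => ?_⟩, fun k hk =>
    ⟨fun V _ _ H _ => ⟨RainbowDom.RPlus_eq H hk, RainbowDom.rainbowNumber_eq_min H hk⟩,
      fun V W _ _ _ _ H₁ H₂ _ _ =>
      ⟨RainbowDom.RMinus_sum H₁ H₂ hk, RainbowDom.RMinus_join H₁ H₂ hk⟩⟩⟩
  set C := Algo.initProg.maxTime + 2 * (Algo.vertexConst + 3) + Algo.evalConst + 11 with hC
  -- The summand 11 in `C` covers the word sizes `2 * (3 * n + 4)`, `4 * m` and `2 * k` for `m`
  -- edges; the factor 2 at `vertexConst + 3` is due to adjacency lists of total length `2 * m`.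
  have hB : 11 * (n + G.edgeSet.ncard + k + 1) ≤ C * (n + G.edgeSet.ncard + k + 1) :=
    Nat.mul_le_mul_right _ (by omega)
  obtain ⟨s, t, h1, h2, h3⟩ := Algo.runs_rainbowProg (B := C * (n + G.edgeSet.ncard + k + 1)) hk hG hA
    (by omega) (by omega) (by omega)
  refine ⟨s, t, h1, h3, h2.trans ?_⟩
  rw [hC]
  generalize Algo.initProg.maxTime = a
  generalize Algo.vertexConst = b
  generalize Algo.evalConst = c
  generalize G.edgeSet.ncard = m
  nlinarith [Nat.zero_le (a * n), Nat.zero_le (a * m), Nat.zero_le (b * n), Nat.zero_le (b * m),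
    Nat.zero_le (c * m), Nat.zero_le b]
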